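/- Algorithms are deterministic word RAM programs: a fixed program with finitely many registers and arrays, unit cost per instruction (arithmetic, comparisons, bitwise operations and shifts on words, indirect reads and writes of array cells, conditionals and loops), words of $O(\log(M+2))$ bits on inputs whose size and numbers are bounded by $M$, and memory that is $0$ outside the input. No overflow may occur. A running time is $\tilde{O}(s^{\gamma})$ if it is at most $C\,(s+2)^{\gamma}\log^{k}(s+2)$ for constants $C,k$ that do not depend on the input. * *Counting 4-cycles.* The input is an undirected simple graph on the nodes $0,\dots,N-1$, given as a list of its $m$ edges in any order (with $N$ and $m$). The output is the number of its simple cycles of length $4$, not necessarily induced, that is, the number of subgraphs isomorphic to $C_4$. The running time is measured in $m$ alone (isolated nodes are allowed). * *Counting a 4-pattern $\sigma$*, where $\sigma$ is a fixed permutation of length $4$. The input is a permutation $\pi$ of length $n$, given as the array of its values. The output is the number of occurrences of $\sigma$ in $\pi$, that is, of index sequences $i_1<i_2<i_3<i_4$ such that $\sigma(j)<\sigma(j')$ if and only if $\pi(i_j)<\pi(i_{j'})$ for all $j,j'$. A 4-pattern $\sigma$ is *non-trivial* if, for some occurrence of $\sigma$ in some permutation $\pi$, drawn as the points $(i,\pi(i))$,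 there are a vertical and a horizontal line, neither passing through a point of $\pi$, that divide the plane into four regions each of which contains exactly one of the four points of the occurrence. (These are all 4-patterns except $1234$, $1243$, $2134$, $2143$, $4321$, $4312$, $3421$, $3412$.) **Theorem.** Let $\gamma$ be a real number and let $\sigma$ be a non-trivial 4-pattern. There is an algorithm that counts 4-cycles in graphs with $m$ edges in $\tilde{O}(m^{\gamma})$ time if and only if there is an algorithm that counts the occurrences of $\sigma$ in permutations of length $n$ in $\tilde{O}(n^{\gamma})$ time. -/

import Mathlib

/-! ## The word RAM

A deterministic random access machine with unit cost and `w`-bit words. A program is a finite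
piece of structured code; it can mention finitely many registers and finitely many arrays, both
named by natural numbers. A register holds one word, an array holds one word per address, and
array cells are addressed indirectly through registers. -/

/-- Binary operations on words (comparisons return `0` or `1`, subtraction is truncated). -/
inductive WordOp where
  | add | sub | mul | div | mod | lt | eq | land | lor | lxor | shl | shr

/-- The value of an operation, before the check that it fits into a word. -/
def WordOp.eval : WordOp → ℕ → ℕ → ℕ
  | .add, x, y => x + y
  | .sub, x, y => x - y
  | .mul, x, y => x * y
  | .div, x, y => x / y
  | .mod, x, y => x % y
  | .lt, x, y => if x < y then 1 else 0
  | .eq, x, y => if x = y then 1 else 0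
  | .land, x, y => x &&& y
  | .lor, x, y => x ||| y
  | .lxor, x, y => x ^^^ y
  | .shl, x, y => x <<< y
  | .shr, x, y => x >>> y

/-- Programs of the word RAM. -/
inductive Prog where
  /-- the empty program -/
  | skip : Prog
  /-- `const r k` : register `r` becomes the constant `k` -/
  | const (r k : ℕ) : Prog
  /-- `op o r a b` : register `r` becomes the result of `o` on registers `a` and `b` -/
  | op (o : WordOp) (r a b : ℕ) : Prog
  /-- `load r A a` : register `r` becomes the cell of array `A` whose address is in register `a` -/
  | load (r A a : ℕ) : Prog
  /-- `store A a b` : the cell of array `A` whose address is in register `a` becomes the content of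
  register `b` -/
  | store (A a b : ℕ) : Prog
  /-- sequential composition -/
  | seq (p q : Prog) : Prog
  /-- `cond r p q` : run `p` if register `r` is nonzero, and `q` otherwise -/
  | cond (r : ℕ) (p q : Prog) : Prog
  /-- `loop r p` : while register `r` is nonzero, run `p` -/
  | loop (r : ℕ) (p : Prog) : Prog

/-- A memory state: the contents of the registers and of the array cells. -/
@[ext] structure MemState where
  /-- the content of each register -/
  reg : ℕ → ℕ
  /-- `arr A a` is the content of the cell with address `a` in array `A` -/
  arr : ℕ → ℕ → ℕ

/-- Overwrite register `r` by `x`. -/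
def MemState.setReg (s : MemState) (r x : ℕ) : MemState :=
  ⟨Function.update s.reg r x, s.arr⟩

/-- Overwrite the cell with address `a` of array `A` by `x`. -/
def MemState.setCell (s : MemState) (A a x : ℕ) : MemState :=
  ⟨s.reg, Function.update s.arr A (Function.update (s.arr A) a x)⟩

/-- `Exec w p s t s'` : on a machine with `w`-bit words, the program `p` started in the state `s`
halts after exactly `t` steps in the state `s'`, and every number that it computes fits into a
word, that is, lies below `2 ^ w` (an overflow has no successor state). Every instruction and
every test costs one step. -/
inductive Exec (w : ℕ) : Prog → MemState → ℕ → MemState → Prop where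
  | skip (s : MemState) : Exec w .skip s 0 s
  | const (r k : ℕ) (s : MemState) (hk : k < 2 ^ w) :
      Exec w (.const r k) s 1 (s.setReg r k)
  | op (o : WordOp) (r a b : ℕ) (s : MemState) (h : o.eval (s.reg a) (s.reg b) < 2 ^ w) :
      Exec w (.op o r a b) s 1 (s.setReg r (o.eval (s.reg a) (s.reg b)))
  | load (r A a : ℕ) (s : MemState) :
      Exec w (.load r A a) s 1 (s.setReg r (s.arr A (s.reg a)))
  | store (A a b : ℕ) (s : MemState) :
      Exec w (.store A a b) s 1 (s.setCell A (s.reg a) (s.reg b))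
  | seq {p q : Prog} {s₁ s₂ s₃ : MemState} {t₁ t₂ : ℕ} (h₁ : Exec w p s₁ t₁ s₂)
      (h₂ : Exec w q s₂ t₂ s₃) : Exec w (.seq p q) s₁ (t₁ + t₂) s₃
  | cond_true {r : ℕ} {p q : Prog} {s s' : MemState} {t : ℕ} (hr : s.reg r ≠ 0)
      (h : Exec w p s t s') : Exec w (.cond r p q) s (t + 1) s'
  | cond_false {r : ℕ} {p q : Prog} {s s' : MemState} {t : ℕ} (hr : s.reg r = 0)
      (h : Exec w q s t s') : Exec w (.cond r p q) s (t + 1) s'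
  | loop_done {r : ℕ} {p : Prog} {s : MemState} (hr : s.reg r = 0) :
      Exec w (.loop r p) s 1 s
  | loop_step {r : ℕ} {p : Prog} {s₁ s₂ s₃ : MemState} {t₁ t₂ : ℕ} (hr : s₁.reg r ≠ 0)
      (h₁ : Exec w p s₁ t₁ s₂) (h₂ : Exec w (.loop r p) s₂ t₂ s₃) :
      Exec w (.loop r p) s₁ (t₁ + t₂ + 1) s₃

/-! ## Computational problems and running times -/

/-- A problem that asks for a natural number. -/
structure CountingProblem where
  /-- the instances -/
  Inst : Type
  /-- the parameter in which the running time is measured -/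
  size : Inst → ℕ
  /-- a bound on the numbers in the input: words have `O(log magnitude)` bits -/
  magnitude : Inst → ℕ
  /-- the memory state in which a program is started on an instance -/
  input : Inst → MemState
  /-- the correct answer, which a program has to leave in register `0` -/
  answer : Inst → ℕ

/-- There is an algorithm that solves `P` in time `Õ(size ^ γ)`: one program, a word length of
`c * ⌈log₂ (magnitude + 2)⌉` bits, and a bound `C * size ^ γ * (log size) ^ k` on the number of
steps (with `size + 2` in place of `size`, so that the smallest instances are covered as well). -/
def SolvableInSoftO (P : CountingProblem) (γ : ℝ) : Prop :=
  ∃ (p : Prog) (c k : ℕ) (C : ℝ), ∀ x : P.Inst, ∃ (t : ℕ) (s : MemState),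
    Exec (c * Nat.clog 2 (P.magnitude x + 2)) p (P.input x) t s ∧
    s.reg 0 = P.answer x ∧
    (t : ℝ) ≤ C * ((P.size x : ℝ) + 2) ^ γ * Real.log ((P.size x : ℝ) + 2) ^ k

/-! ## Counting 4-cycles -/

/-- `l` lists every edge of `G` exactly once, as an ordered pair of its endpoints; the order of
the edges and the order of the two endpoints of an edge are arbitrary. -/
def IsEdgeList {N : ℕ} (G : SimpleGraph (Fin N)) (l : List (Fin N × Fin N)) : Prop :=
  (l.map fun e => s(e.1, e.2)).Nodup ∧ ∀ e, e ∈ l.map (fun e => s(e.1, e.2)) ↔ e ∈ G.edgeSet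

/-- An undirected simple graph on the nodes `0, …, N - 1`, given by a list of its edges. -/
structure EdgeListGraph where
  /-- the number of nodes -/
  N : ℕ
  /-- the graph -/
  G : SimpleGraph (Fin N)
  /-- its edges -/
  edges : List (Fin N × Fin N)
  isEdgeList : IsEdgeList G edges

/-- Register `0` holds the number of edges, register `1` the number of nodes, and the arrays `0`
and `1` hold the endpoints of the edges. Everything else is `0`. -/
def EdgeListGraph.toMem (x : EdgeListGraph) : MemState where
  reg r := if r = 0 then x.edges.length else if r = 1 then x.N else 0
  arr A a :=
    if h : a < x.edges.length then
      if A = 0 then ((x.edges[a]).1 : ℕ) else if A = 1 then ((x.edges[a]).2 : ℕ) else 0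
    else 0

/-- Counting the (not necessarily induced) simple cycles of length 4, that is, the subgraphs
isomorphic to `C₄`, in a graph with `m` edges. The running time is measured in `m`. -/
noncomputable def fourCycleProblem : CountingProblem where
  Inst := EdgeListGraph
  size x := x.edges.length
  magnitude x := x.N + x.edges.length
  input := EdgeListGraph.toMem
  answer x := x.G.copyCount (SimpleGraph.cycleGraph 4)

/-! ## Counting patterns -/

/-- The increasing indices `i` are an occurrence of the pattern `σ` in the permutation `π`. -/
def IsOccurrence {k n : ℕ} (σ : Equiv.Perm (Fin k)) (π : Equiv.Perm (Fin n))
    (i : Fin k ↪o Fin n) : Prop :=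
  ∀ j j' : Fin k, σ j < σ j' ↔ π (i j) < π (i j')

/-- The number of occurrences of `σ` in `π`. -/
noncomputable def patternCount {k n : ℕ} (σ : Equiv.Perm (Fin k)) (π : Equiv.Perm (Fin n)) : ℕ :=
  Nat.card {i : Fin k ↪o Fin n // IsOccurrence σ π i}

/-- The 4-pattern `σ` can form the shape with one point in each region: some occurrence of `σ` in
some permutation `π`, seen as points `(i, π i)` of the plane, and some division of the plane by a
vertical line `x = v` and a horizontal line `y = h`, neither of which passes through a point of
`π`, are such that the top-left, top-right, bottom-left and bottom-right regions contain exactly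
one point of the occurrence each. -/
def IsNontrivialPattern (σ : Equiv.Perm (Fin 4)) : Prop :=
  ∃ (n : ℕ) (π : Equiv.Perm (Fin n)) (i : Fin 4 ↪o Fin n) (v h : ℝ),
    IsOccurrence σ π i ∧
    (∀ a : Fin n, ((a : ℕ) : ℝ) ≠ v ∧ ((π a : ℕ) : ℝ) ≠ h) ∧
    (∃! j, ((i j : ℕ) : ℝ) < v ∧ h < ((π (i j) : ℕ) : ℝ)) ∧
    (∃! j, v < ((i j : ℕ) : ℝ) ∧ h < ((π (i j) : ℕ) : ℝ)) ∧
    (∃! j, ((i j : ℕ) : ℝ) < v ∧ ((π (i j) : ℕ) : ℝ) < h) ∧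
    (∃! j, v < ((i j : ℕ) : ℝ) ∧ ((π (i j) : ℕ) : ℝ) < h)

/-- Register `0` holds the length `n` of the permutation, and array `0` holds its values.
Everything else is `0`. -/
def permToMem {n : ℕ} (π : Equiv.Perm (Fin n)) : MemState where
  reg r := if r = 0 then n else 0
  arr A a := if h : a < n then (if A = 0 then (π ⟨a, h⟩ : ℕ) else 0) else 0

/-- Counting the occurrences of a fixed 4-pattern `σ` in a permutation of length `n`. -/
noncomputable def patternProblem (σ : Equiv.Perm (Fin 4)) : CountingProblem where
  Inst := Σ n : ℕ, Equiv.Perm (Fin n)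
  size x := x.1
  magnitude x := x.1
  input x := permToMem x.2
  answer x := patternCount σ x.2

/-!
A program that solves either problem in time `Õ(s ^ γ)` with `γ < 1` would skip most of its input.
An adversary argument excludes this for both problems (`not_solvable_fourCycleProblem`,
`not_solvable_patternProblem`), so that both sides of the equivalence are false. For `1 ≤ γ` the two
problems are reduced to each other.

*Programs.* Reductions are written in a structured language `WCmd` with expressions, counting loops
and calls of a subroutine. Its correctness is expressed by weakest preconditions (`WCmd.wp`), its
running time and the absence of overflow by static bounds (`WCmd.cost`, `WCmd.chk`), and
`WCmd.compile_exec` transfers all of this to the word RAM. A call runs the given program on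
relocated registers and on fresh arrays. The outcome is `solvable_of_reduction`: polylogarithmically
many calls on instances of linear size, with linear work besides, turn a solution of one problem
into a solution of the other.

*From 4-cycles to patterns.* The `2 m` arcs of the graph become points of a permutation, sorted by
their sources along the horizontal axis and by their targets along the vertical axis, with one copy
of every arc in each of the four quadrants. Copies of arcs with the same source that lie above each
other, in the same half of the plane, are ordered by their quadrants: those of one quadrant come
before those of the other one. Which quadrant comes first is a free choice for each half of each
axis. Since the two choices differ exactly when two sources (or targets) agree, an alternating
sum of the pattern counts over the sixteen choices (`ArcSystem.sum_sgn_patternCount`) leaves only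
those occurrences of `σ` with one point in each quadrant where every two points in adjacent
quadrants share a node. This is where `σ` has to be non-trivial
(`IsNontrivialPattern.splitsEvenly`). These occurrences are the closed walks of length four, whose
number and the degrees determine the number of 4-cycles.

*From patterns to 4-cycles.* For two numbers `u < v` there is exactly one bit, their level, that is
`0` in `u` and `1` in `v` while all higher bits agree. An occurrence of `σ` has three levels for its
consecutive positions and three for its consecutive values; all choices of levels are tried. For
given levels, an occurrence consists of four points with conditions on single points and with
equations between the leading bits of pairs of points. There is always a cyclic order of the four
points such that the equations between neighbours imply the remaining ones, for the positions and
for the values at once (`Levels.exists_fits`: two of the three cyclic orders are good for the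
positions, two for the values). The points become arcs from a node for the bits shared with the
predecessor to a node for the bits shared with the successor, and the occurrences become closed
sequences of four arcs in a graph with four layers (`Levels.card_chain`). Parallel arcs are
accounted for by the binary digits of their number, and the 4-cycles that pass through all four
layers by inclusion-exclusion over the layers (`LayeredArcs.card_closed`).
-/


/-! ### A structured language above the word RAM -/

/-- Expressions over registers and array cells. -/
inductive WExpr where
  /-- a constant -/
  | lit (k : ℕ)
  /-- the content of a register -/
  | var (r : ℕ)
  /-- a binary operation on words -/
  | bin (o : WordOp) (a b : WExpr)
  /-- `get A a` : the cell of the array `A` with address `a` -/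
  | get (A : ℕ) (a : WExpr)
  /-- `mods a b` : the remainder of `a` modulo `b + 1`, so that the modulus is positive -/
  | mods (a b : WExpr)

/-- The value of an expression in a memory state. -/
def WExpr.eval (s : MemState) : WExpr → ℕ
  | .lit k => k
  | .var r => s.reg r
  | .bin o a b => o.eval (a.eval s) (b.eval s)
  | .get A a => s.arr A (a.eval s)
  | .mods a b => a.eval s % (b.eval s + 1)

/-- The number of instructions that the evaluation of an expression takes. -/
def WExpr.cost : WExpr → ℕ
  | .lit _ => 1
  | .var _ => 1
  | .bin _ a b => a.cost + b.cost + 1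
  | .get _ a => a.cost + 1
  | .mods a b => a.cost + b.cost + 3

/-- A static bound for the size of a value: if the registers `r` and the cells of the arrays `A`
stay below `D ^ Γ r` and `D ^ Δ A`, then the value of `e` stays below `D ^ e.deg Γ Δ`. -/
def WExpr.deg (Γ Δ : ℕ → ℕ) : WExpr → ℕ
  | .lit k => k.size
  | .var r => Γ r
  | .bin o a b =>
    match o with
    | .add => max (a.deg Γ Δ) (b.deg Γ Δ) + 1
    | .mul => a.deg Γ Δ + b.deg Γ Δ
    | .lt => 1
    | .eq => 1
    | _ => a.deg Γ Δ
  | .get A _ => Δ A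
  | .mods _ b => b.deg Γ Δ

/-- The operations for which `WExpr.deg` is a valid bound. -/
def WordOp.isTame : WordOp → Bool
  | .lor => false
  | .lxor => false
  | .shl => false
  | _ => true

/-- All intermediate values of an expression have degree at most `K`. -/
def WExpr.chk (Γ Δ : ℕ → ℕ) (K : ℕ) : WExpr → Bool
  | .lit k => k.size ≤ K
  | .var _ => true
  | .bin o a b => o.isTame && a.chk Γ Δ K && b.chk Γ Δ K && (WExpr.bin o a b).deg Γ Δ ≤ K
  | .get _ a => a.chk Γ Δ K
  | .mods a b => a.chk Γ Δ K && b.chk Γ Δ K && b.deg Γ Δ + 1 ≤ K && 1 ≤ K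

/-- Every register and every array cell stays below the power of `D` assigned to it. -/
def MemState.Bounded (D : ℕ) (Γ Δ : ℕ → ℕ) (s : MemState) : Prop :=
  (∀ r, s.reg r < D ^ Γ r) ∧ ∀ A a, s.arr A a < D ^ Δ A

/-- Words of length `w` hold all numbers below `D ^ K`. -/
structure WordBound (w D K : ℕ) : Prop where
  two_le : 2 ≤ D
  pow_le : D ^ K ≤ 2 ^ w

theorem Nat.lt_pow_size {D : ℕ} (hD : 2 ≤ D) (k : ℕ) : k < D ^ k.size :=
  lt_of_lt_of_le (Nat.lt_size_self k) (Nat.pow_le_pow_left hD _)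

theorem WExpr.eval_lt {D K : ℕ} {Γ Δ : ℕ → ℕ} (hD : 2 ≤ D) {s : MemState}
    (hs : s.Bounded D Γ Δ) (e : WExpr) (he : e.chk Γ Δ K = true) :
    e.eval s < D ^ e.deg Γ Δ := by
  induction e with
  | lit k => exact Nat.lt_pow_size hD k
  | var r => exact hs.1 r
  | get A a => exact hs.2 A _
  | mods a b iha ihb =>
    simp only [chk, Bool.and_eq_true] at he
    have := ihb he.1.1.2
    have h2 : a.eval s % (b.eval s + 1) < b.eval s + 1 := Nat.mod_lt _ (Nat.succ_pos _)
    simp only [eval, deg]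
    omega
  | bin o a b iha ihb =>
    simp only [chk, Bool.and_eq_true] at he
    have ha := iha he.1.1.2
    have hb := ihb he.1.2
    have hone : (1 : ℕ) < D ^ 1 := by rw [pow_one]; omega
    cases o <;> simp only [eval, deg, WordOp.eval, WordOp.isTame] at he ⊢
    case add =>
      have h1 : D ^ a.deg Γ Δ ≤ D ^ max (a.deg Γ Δ) (b.deg Γ Δ) :=
        Nat.pow_le_pow_right (by omega) (le_max_left _ _)
      have h2 : D ^ b.deg Γ Δ ≤ D ^ max (a.deg Γ Δ) (b.deg Γ Δ) :=
        Nat.pow_le_pow_right (by omega) (le_max_right _ _)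
      rw [pow_succ]
      nlinarith
    case sub => omega
    case mul => rw [pow_add]; exact Nat.mul_lt_mul'' ha hb
    case div => exact lt_of_le_of_lt (Nat.div_le_self _ _) ha
    case mod => exact lt_of_le_of_lt (Nat.mod_le _ _) ha
    case lt => split <;> omega
    case eq => split <;> omega
    case land => exact lt_of_le_of_lt Nat.and_le_left ha
    case shr => exact lt_of_le_of_lt (Nat.shiftRight_le _ _) ha
    all_goals simp at he

/-- The array of the machine that holds the array `A`; the input arrays `0` and `1` stay in
place, and odd numbers from `3` on are left to the arrays of a subroutine. -/
def varr (A : ℕ) : ℕ := if A < 2 then A else 2 * A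

theorem varr_injective : Function.Injective varr := by
  intro A B h
  unfold varr at h
  split_ifs at h <;> omega

theorem varr_ne (A B : ℕ) : varr A ≠ 2 * B + 3 := by
  unfold varr
  split_ifs <;> omega

/-- The machine state `R` agrees with the state `s` of the structured program, whose register
`r` is kept in the register `4 * r`; the other residues modulo `4` hold temporaries (`1`), the
registers of a subroutine (`2`) and bookkeeping (`3`). The arrays of the subroutine are still `0`
from the address `base + S` on. -/
structure Sim (S : ℕ) (s R : MemState) (base : ℕ) : Prop where
  reg : ∀ r, R.reg (4 * r) = s.reg r
  arr : ∀ A a, R.arr (varr A) a = s.arr A a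
  baseReg : R.reg 3 = base
  stride : R.reg 7 = S
  zero : ∀ A a, base + S ≤ a → R.arr (2 * A + 3) a = 0

/-- Code that evaluates `e` into the temporary number `d`. -/
def WExpr.compile : WExpr → ℕ → Prog
  | .lit k, d => .const (4 * d + 1) k
  | .var r, d => .op .land (4 * d + 1) (4 * r) (4 * r)
  | .bin o a b, d =>
    .seq (a.compile d) (.seq (b.compile (d + 1)) (.op o (4 * d + 1) (4 * d + 1) (4 * d + 5)))
  | .get A a, d => .seq (a.compile d) (.load (4 * d + 1) (varr A) (4 * d + 1))
  | .mods a b, d =>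
    .seq (a.compile d) (.seq (b.compile (d + 1)) (.seq (.const (4 * d + 9) 1)
      (.seq (.op .add (4 * d + 5) (4 * d + 5) (4 * d + 9))
        (.op .mod (4 * d + 1) (4 * d + 1) (4 * d + 5)))))

/-- Only temporaries from number `d` on differ. -/
def TempEq (d : ℕ) (R R' : MemState) : Prop :=
  R'.arr = R.arr ∧ ∀ r, (∀ j, d ≤ j → r ≠ 4 * j + 1) → R'.reg r = R.reg r

theorem TempEq.trans {d d' : ℕ} {R R' R'' : MemState} (h : TempEq d R R') (h' : TempEq d' R' R'')
    (hd : d ≤ d') : TempEq d R R'' :=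
  ⟨h'.1.trans h.1, fun r hr => (h'.2 r fun j hj => hr j (hd.trans hj)).trans (h.2 r hr)⟩

theorem TempEq.setReg {d j : ℕ} {R R' : MemState} (h : TempEq d R R') (hj : d ≤ j) (x : ℕ) :
    TempEq d R (R'.setReg (4 * j + 1) x) :=
  ⟨h.1, fun r hr => by
    have := hr j hj
    simp only [MemState.setReg, Function.update_apply, this, if_false]
    exact h.2 r hr⟩

theorem Sim.tempEq {S base d : ℕ} {s R R' : MemState} (h : Sim S s R base) (hR : TempEq d R R') :
    Sim S s R' base where
  reg r := by rw [hR.2 _ (by omega)]; exact h.reg r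
  arr A a := by rw [hR.1]; exact h.arr A a
  baseReg := by rw [hR.2 _ (by omega)]; exact h.baseReg
  stride := by rw [hR.2 _ (by omega)]; exact h.stride
  zero A a ha := by rw [hR.1]; exact h.zero A a ha

@[simp] theorem MemState.setReg_reg_self (s : MemState) (r x : ℕ) : (s.setReg r x).reg r = x := by
  simp [setReg]

@[simp] theorem MemState.setReg_arr (s : MemState) (r x : ℕ) : (s.setReg r x).arr = s.arr := rfl

theorem MemState.setReg_reg_of_ne (s : MemState) {r r' : ℕ} (x : ℕ) (h : r' ≠ r) :
    (s.setReg r x).reg r' = s.reg r' := by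
  simp [setReg, h]

theorem MemState.setReg_reg (s : MemState) (r r' x : ℕ) :
    (s.setReg r x).reg r' = if r' = r then x else s.reg r' := by
  simp [setReg, Function.update_apply]

@[simp] theorem MemState.setCell_reg (s : MemState) (A a x : ℕ) : (s.setCell A a x).reg = s.reg :=
  rfl

theorem MemState.setCell_arr (s : MemState) (A a x A' a' : ℕ) :
    (s.setCell A a x).arr A' a' = if A' = A ∧ a' = a then x else s.arr A' a' := by
  by_cases h : A' = A
  · subst h
    simp [setCell, Function.update_apply]
  · simp [setCell, h]

theorem MemState.setCell_arr_of_ne (s : MemState) {A A' : ℕ} (a x : ℕ) (h : A' ≠ A) :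
    (s.setCell A a x).arr A' = s.arr A' := by
  simp [setCell, h]

theorem WExpr.compile_exec {D K w S base : ℕ} {Γ Δ : ℕ → ℕ} (hw : WordBound w D K)
    (hΓ : ∀ r, Γ r ≤ K) {s : MemState} (hs : s.Bounded D Γ Δ)
    (e : WExpr) (he : e.chk Γ Δ K = true) :
    ∀ (d : ℕ) (R : MemState), Sim S s R base →
      ∃ R', Exec w (e.compile d) R e.cost R' ∧ TempEq d R R' ∧ R'.reg (4 * d + 1) = e.eval s := by
  have hpow : ∀ j, j ≤ K → D ^ j ≤ 2 ^ w := fun j hj =>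
    (Nat.pow_le_pow_right (by have := hw.two_le; omega) hj).trans hw.pow_le
  have refl : ∀ d R, TempEq d R R := fun d R => ⟨rfl, fun _ _ => rfl⟩
  induction e with
  | lit k =>
    intro d R hR
    simp only [chk, decide_eq_true_eq] at he
    exact ⟨_, Exec.const _ _ _ ((Nat.lt_pow_size hw.two_le k).trans_le (hpow _ he)),
      (refl d R).setReg le_rfl _, by simp [eval]⟩
  | var r =>
    intro d R hR
    have h1 : WordOp.eval .land (R.reg (4 * r)) (R.reg (4 * r)) = s.reg r := by
      simp [WordOp.eval, hR.reg]
    refine ⟨_, Exec.op _ _ _ _ _ ?_, (refl d R).setReg le_rfl _, ?_⟩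
    · rw [h1]; exact (hs.1 r).trans_le (hpow _ (hΓ r))
    · simp [eval, h1]
  | get A a iha =>
    intro d R hR
    obtain ⟨R1, h1, t1, v1⟩ := iha he d R hR
    refine ⟨_, Exec.seq h1 (Exec.load _ _ _ _), t1.setReg le_rfl _, ?_⟩
    rw [MemState.setReg_reg_self, v1, eval, (hR.tempEq t1).arr]
  | bin o a b iha ihb =>
    intro d R hR
    have he' := he
    simp only [chk, Bool.and_eq_true] at he
    obtain ⟨R1, h1, t1, v1⟩ := iha he.1.1.2 d R hR
    obtain ⟨R2, h2, t2, v2⟩ := ihb he.1.2 (d + 1) R1 (hR.tempEq t1)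
    have v1' : R2.reg (4 * d + 1) = a.eval s := by rw [t2.2 _ (by omega), v1]
    have v2' : R2.reg (4 * d + 5) = b.eval s := by rw [← v2]; congr 1
    have hdeg : (WExpr.bin o a b).deg Γ Δ ≤ K := by simpa using he.2
    have hlt := (WExpr.eval_lt (K := K) hw.two_le hs _ he').trans_le (hpow _ hdeg)
    refine ⟨_, by
      have := Exec.seq h1 (Exec.seq h2 (Exec.op (w := w) o (4 * d + 1) (4 * d + 1) (4 * d + 5) R2
        (by rw [v1', v2']; exact hlt)))
      simpa only [compile, cost, add_assoc] using this,
      (t1.trans t2 (by omega)).setReg le_rfl _, ?_⟩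
    rw [MemState.setReg_reg_self, v1', v2', eval]
  | mods a b iha ihb =>
    intro d R hR
    simp only [chk, Bool.and_eq_true, decide_eq_true_eq] at he
    obtain ⟨R1, h1, t1, v1⟩ := iha he.1.1.1 d R hR
    obtain ⟨R2, h2, t2, v2⟩ := ihb he.1.1.2 (d + 1) R1 (hR.tempEq t1)
    have v1' : R2.reg (4 * d + 1) = a.eval s := by rw [t2.2 _ (by omega), v1]
    have v2' : R2.reg (4 * d + 5) = b.eval s := by rw [← v2]; congr 1
    have hD := hw.two_le
    have hb1 : b.eval s + 1 < D ^ (b.deg Γ Δ + 1) := by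
      have := WExpr.eval_lt (K := K) hw.two_le hs b he.1.1.2
      rw [pow_succ]; nlinarith
    have hb2 : b.eval s + 1 < 2 ^ w := hb1.trans_le (hpow _ he.1.2)
    have h3 := Exec.const (w := w) (4 * d + 9) 1 R2 (by omega)
    have e1 : (R2.setReg (4 * d + 9) 1).reg (4 * d + 5) = b.eval s := by
      rw [MemState.setReg_reg_of_ne _ _ (by omega), v2']
    have e2 : (R2.setReg (4 * d + 9) 1).reg (4 * d + 9) = 1 := by simp
    have h4 := Exec.op (w := w) .add (4 * d + 5) (4 * d + 5) (4 * d + 9) (R2.setReg (4 * d + 9) 1)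
      (by rw [e1, e2]; exact hb2)
    rw [e1, e2] at h4
    set R4 := (R2.setReg (4 * d + 9) 1).setReg (4 * d + 5) (WordOp.add.eval (b.eval s) 1) with hR4
    have e3 : R4.reg (4 * d + 1) = a.eval s := by
      rw [hR4, MemState.setReg_reg_of_ne _ _ (by omega), MemState.setReg_reg_of_ne _ _ (by omega),
        v1']
    have e4 : R4.reg (4 * d + 5) = b.eval s + 1 := by simp [hR4, WordOp.eval]
    have hm := Nat.mod_lt (a.eval s) (Nat.succ_pos (b.eval s))
    have h5 := Exec.op (w := w) .mod (4 * d + 1) (4 * d + 1) (4 * d + 5) R4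
      (by rw [e3, e4]; exact hm.trans (by omega))
    rw [e3, e4] at h5
    refine ⟨_, by
      have := Exec.seq h1 (Exec.seq h2 (Exec.seq h3 (Exec.seq h4 h5)))
      simpa only [compile, cost, add_assoc] using this, ?_, ?_⟩
    · exact (((t1.trans t2 (by omega)).setReg (j := d + 2) (by omega) _).setReg
        (j := d + 1) (by omega) _).setReg le_rfl _
    · rw [MemState.setReg_reg_self]; rfl

/-- Structured programs: assignments, branching, counting loops, and calls of a subroutine. -/
inductive WCmd where
  /-- no operation -/
  | skip
  /-- the register `r` becomes the value of `e` -/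
  | assign (r : ℕ) (e : WExpr)
  /-- the cell of `A` with address `a` becomes the value of `e` -/
  | store (A : ℕ) (a e : WExpr)
  /-- sequential composition -/
  | seq (c d : WCmd)
  /-- branching on a nonzero value -/
  | ite (e : WExpr) (c d : WCmd)
  /-- `loop i b c` : run `c` for the values `0, …, b - 1` of the register `i` -/
  | loop (i b : ℕ) (c : WCmd)
  /-- call the subroutine; its result is put into register `3` -/
  | call

namespace WCmd

/-- The registers that a program may change. -/
def wr : WCmd → List ℕ
  | skip => []
  | assign r _ => [r]
  | store _ _ _ => []
  | seq c d => c.wr ++ d.wr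
  | ite _ c d => c.wr ++ d.wr
  | .loop i _ c => i :: c.wr
  | call => [3]

/-- The arrays that a program may change. -/
def wa : WCmd → List ℕ
  | skip => []
  | assign _ _ => []
  | store A _ _ => [A]
  | seq c d => c.wa ++ d.wa
  | ite _ c d => c.wa ++ d.wa
  | .loop _ _ c => c.wa
  | call => []

/-- The states `s` and `s'` agree outside of what `c` may change. -/
def Frame (c : WCmd) (s s' : MemState) : Prop :=
  (∀ r, r ∉ c.wr → s'.reg r = s.reg r) ∧ ∀ A, A ∉ c.wa → s'.arr A = s.arr A

/-- An upper bound for the running time, where basic instructions cost `u`, calls cost `T`, and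
`ρ` bounds the registers that bound loops. -/
def cost (ρ : ℕ → ℕ) (u T : ℕ) : WCmd → ℕ
  | skip => 0
  | assign _ e => (e.cost + 1) * u
  | store _ a e => (a.cost + e.cost + 1) * u
  | seq c d => c.cost ρ u T + d.cost ρ u T
  | ite e c d => (e.cost + 1) * u + c.cost ρ u T + d.cost ρ u T
  | .loop _ b c => ρ b * (c.cost ρ u T + 4 * u) + 3 * u
  | call => T

/-- The static check that no number overflows, and that loops do not change their bounds. -/
def chk (Γ Δ : ℕ → ℕ) (K : ℕ) : WCmd → Bool
  | skip => true
  | assign r e => e.chk Γ Δ K && e.deg Γ Δ ≤ Γ r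
  | store A a e => a.chk Γ Δ K && e.chk Γ Δ K && e.deg Γ Δ ≤ Δ A
  | seq c d => c.chk Γ Δ K && d.chk Γ Δ K
  | ite e c d => e.chk Γ Δ K && c.chk Γ Δ K && d.chk Γ Δ K
  | .loop i b c => c.chk Γ Δ K && !(c.wr.contains i) && !(c.wr.contains b) && i != b && Γ b ≤ Γ i
      && 1 ≤ Γ i
  | call => true

/-- Weakest precondition. `CallOk s v` says that a call in the state `s` is legitimate and
yields `v`. Loops are treated by an invariant, for which the frame conditions come for free. -/
def wp (ρ : ℕ → ℕ) (CallOk : MemState → ℕ → Prop) : WCmd → (MemState → Prop) → MemState → Prop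
  | skip, Q, s => Q s
  | assign r e, Q, s => Q (s.setReg r (e.eval s))
  | store A a e, Q, s => Q (s.setCell A (a.eval s) (e.eval s))
  | seq c d, Q, s => c.wp ρ CallOk (d.wp ρ CallOk Q) s
  | ite e c d, Q, s => (e.eval s ≠ 0 → c.wp ρ CallOk Q s) ∧ (e.eval s = 0 → d.wp ρ CallOk Q s)
  | .loop i b c, Q, s => s.reg b ≤ ρ b ∧ ∃ I : ℕ → MemState → Prop, I 0 s ∧
      (∀ k s', k < s.reg b → Frame (.loop i b c) s s' → I k s' →
        c.wp ρ CallOk (I (k + 1)) (s'.setReg i k)) ∧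
      ∀ s', Frame (.loop i b c) s s' → I (s.reg b) s' → Q (s'.setReg i (s.reg b))
  | call, Q, s => ∃ v, CallOk s v ∧ Q (s.setReg 3 v)

/-- Translation into machine code, with `cc` as the code of a call. -/
def compile (cc : Prog) : WCmd → Prog
  | skip => .skip
  | assign r e => .seq (e.compile 0) (.op .land (4 * r) 1 1)
  | store A a e => .seq (a.compile 0) (.seq (e.compile 1) (.store (varr A) 1 5))
  | seq c d => .seq (c.compile cc) (d.compile cc)
  | ite e c d => .seq (e.compile 0) (.cond 1 (c.compile cc) (d.compile cc))
  | .loop i b c => .seq (.const (4 * i) 0) (.seq (.op .lt 1 (4 * i) (4 * b))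
      (.loop 1 (.seq (c.compile cc) (.seq (.const 1 1) (.seq (.op .add (4 * i) (4 * i) 1)
        (.op .lt 1 (4 * i) (4 * b)))))))
  | call => cc

theorem wp_mono {ρ : ℕ → ℕ} {CallOk : MemState → ℕ → Prop} (c : WCmd) {Q Q' : MemState → Prop}
    (h : ∀ s, Q s → Q' s) (s : MemState) (hc : c.wp ρ CallOk Q s) : c.wp ρ CallOk Q' s := by
  induction c generalizing Q Q' s with
  | skip => exact h _ hc
  | assign r e => exact h _ hc
  | store A a e => exact h _ hc
  | seq c d ihc ihd => exact ihc (fun s hs => ihd h s hs) s hc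
  | ite e c d ihc ihd => exact ⟨fun he => ihc h s (hc.1 he), fun he => ihd h s (hc.2 he)⟩
  | loop i b c ih =>
    obtain ⟨hb, I, h0, h1, h2⟩ := hc
    exact ⟨hb, I, h0, h1, fun s' hf hI => h _ (h2 s' hf hI)⟩
  | call => obtain ⟨v, h1, h2⟩ := hc; exact ⟨v, h1, h _ h2⟩

theorem Frame.refl (c : WCmd) (s : MemState) : Frame c s s := ⟨fun _ _ => rfl, fun _ _ => rfl⟩

theorem Frame.trans {c : WCmd} {s s' s'' : MemState} (h : Frame c s s') (h' : Frame c s' s'') :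
    Frame c s s'' :=
  ⟨fun r hr => (h'.1 r hr).trans (h.1 r hr), fun A hA => (h'.2 A hA).trans (h.2 A hA)⟩

theorem Frame.mono {c d : WCmd} {s s' : MemState} (h : Frame c s s') (h1 : ∀ r ∈ c.wr, r ∈ d.wr)
    (h2 : ∀ r ∈ c.wa, r ∈ d.wa) : Frame d s s' :=
  ⟨fun r hr => h.1 r fun h' => hr (h1 r h'), fun r hr => h.2 r fun h' => hr (h2 r h')⟩

theorem Frame.setReg {c : WCmd} {s s' : MemState} (h : Frame c s s') {r : ℕ} (hr : r ∈ c.wr)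
    (x : ℕ) : Frame c s (s'.setReg r x) :=
  ⟨fun r' hr' => by
    rw [MemState.setReg_reg_of_ne _ _ (by rintro rfl; exact hr' hr)]; exact h.1 r' hr', h.2⟩

/-- The postcondition may be strengthened by the frame condition. -/
theorem wp_frame {ρ : ℕ → ℕ} {CallOk : MemState → ℕ → Prop} (c : WCmd) {Q : MemState → Prop}
    (s : MemState) (hc : c.wp ρ CallOk Q s) : c.wp ρ CallOk (fun s' => Q s' ∧ Frame c s s') s := by
  induction c generalizing Q s with
  | skip => exact ⟨hc, .refl _ _⟩
  | assign r e => exact ⟨hc, (Frame.refl _ _).setReg (by simp [wr]) _⟩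
  | store A a e =>
    exact ⟨hc, fun r hr => rfl, fun A' hA => MemState.setCell_arr_of_ne _ _ _ (by
      simpa [wa] using hA)⟩
  | seq c d ihc ihd =>
    refine wp_mono c (fun s1 h1 => ?_) s (ihc s hc)
    refine wp_mono d (fun s2 h2 => ?_) s1 (ihd s1 h1.1)
    exact ⟨h2.1, (h1.2.mono (by simp +contextual [wr]) (by simp +contextual [wa])).trans
      (h2.2.mono (by simp +contextual [wr]) (by simp +contextual [wa]))⟩
  | ite e c d ihc ihd =>
    refine ⟨fun he => wp_mono c (fun s1 h1 => ?_) s (ihc s (hc.1 he)),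
      fun he => wp_mono d (fun s1 h1 => ?_) s (ihd s (hc.2 he))⟩
    · exact ⟨h1.1, h1.2.mono (by simp +contextual [wr]) (by simp +contextual [wa])⟩
    · exact ⟨h1.1, h1.2.mono (by simp +contextual [wr]) (by simp +contextual [wa])⟩
  | loop i b c ih =>
    obtain ⟨hb, I, h0, h1, h2⟩ := hc
    exact ⟨hb, I, h0, h1, fun s' hf hI => ⟨h2 s' hf hI, hf.setReg (by simp [wr]) _⟩⟩
  | call =>
    obtain ⟨v, h1, h2⟩ := hc
    exact ⟨v, h1, h2, (Frame.refl _ _).setReg (by simp [wr]) _⟩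

/-- `cc` is correct code for calls: within `T` steps it puts the result into the register of the
variable `3`, and it uses up the addresses below `base + 2 * S` of the subroutine's arrays. -/
def CallSpec (w S T D : ℕ) (Γ Δ : ℕ → ℕ) (CallOk : MemState → ℕ → Prop) (cc : Prog) : Prop :=
  ∀ s R base v, s.Bounded D Γ Δ → CallOk s v → Sim S s R base → base + 2 * S ≤ 2 ^ w →
    v < D ^ Γ 3 ∧ ∃ t R', t ≤ T ∧ Exec w cc R t R' ∧ Sim S (s.setReg 3 v) R' (base + S)

theorem _root_.Sim.setReg {S base : ℕ} {s R : MemState} (h : Sim S s R base) (r x : ℕ) :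
    Sim S (s.setReg r x) (R.setReg (4 * r) x) base where
  reg r' := by
    by_cases hr : r' = r
    · subst hr; simp
    · rw [MemState.setReg_reg_of_ne _ _ (by omega), MemState.setReg_reg_of_ne _ _ hr, h.reg]
  arr := h.arr
  baseReg := by rw [MemState.setReg_reg_of_ne _ _ (by omega), h.baseReg]
  stride := by rw [MemState.setReg_reg_of_ne _ _ (by omega), h.stride]
  zero := h.zero

theorem _root_.Sim.setCell {S base : ℕ} {s R : MemState} (h : Sim S s R base) (A a x : ℕ) :
    Sim S (s.setCell A a x) (R.setCell (varr A) a x) base where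
  reg := h.reg
  arr A' a' := by
    rw [MemState.setCell_arr, MemState.setCell_arr, h.arr]
    by_cases hA : A' = A
    · simp [hA]
    · simp [hA, varr_injective.eq_iff]
  baseReg := h.baseReg
  stride := h.stride
  zero A' a' ha := by
    rw [MemState.setCell_arr_of_ne _ _ _ (varr_ne A A').symm]; exact h.zero A' a' ha

theorem _root_.MemState.Bounded.setReg {D : ℕ} {Γ Δ : ℕ → ℕ} {s : MemState} (h : s.Bounded D Γ Δ)
    {r x : ℕ} (hx : x < D ^ Γ r) : (s.setReg r x).Bounded D Γ Δ :=
  ⟨fun r' => by rw [MemState.setReg_reg]; split_ifs with hr; exacts [hr ▸ hx, h.1 r'], h.2⟩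

theorem _root_.MemState.Bounded.setCell {D : ℕ} {Γ Δ : ℕ → ℕ} {s : MemState} (h : s.Bounded D Γ Δ)
    {A a x : ℕ} (hx : x < D ^ Δ A) : (s.setCell A a x).Bounded D Γ Δ :=
  ⟨h.1, fun A' a' => by
    rw [MemState.setCell_arr]; split_ifs with hr; exacts [hr.1 ▸ hx, h.2 A' a']⟩

/-- Compiled code does what the weakest precondition promises, within the static time bound. -/
theorem compile_exec {w S T D K : ℕ} {ρ Γ Δ : ℕ → ℕ} {CallOk : MemState → ℕ → Prop} {cc : Prog}
    (hw : WordBound w D K) (hΓ : ∀ r, Γ r + 1 ≤ K)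
    (hcc : CallSpec w S T D Γ Δ CallOk cc) (c : WCmd) :
    ∀ (Q : MemState → Prop) (s R : MemState) (base : ℕ), c.wp ρ CallOk Q s → s.Bounded D Γ Δ →
      c.chk Γ Δ K = true → Sim S s R base → base + (c.cost ρ 0 1 + 1) * S ≤ 2 ^ w →
      ∃ t R' s' base', t ≤ c.cost ρ 1 T ∧ Exec w (c.compile cc) R t R' ∧ Q s' ∧
        s'.Bounded D Γ Δ ∧ Sim S s' R' base' ∧ base' ≤ base + c.cost ρ 0 1 * S := by
  have hD := hw.two_le
  have hpow : ∀ j, j ≤ K → D ^ j ≤ 2 ^ w := fun j hj =>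
    (Nat.pow_le_pow_right (by omega) hj).trans hw.pow_le
  have hΓ' : ∀ r, Γ r ≤ K := fun r => (Nat.le_succ _).trans (hΓ r)
  induction c with
  | skip =>
    intro Q s R base hc hs _ hR _
    exact ⟨0, R, s, base, le_rfl, .skip R, hc, hs, hR, by omega⟩
  | assign r e =>
    intro Q s R base hc hs hk hR _
    simp only [chk, Bool.and_eq_true, decide_eq_true_eq] at hk
    obtain ⟨R1, h1, t1, v1⟩ := e.compile_exec hw hΓ' hs hk.1 0 R hR
    have hv := (e.eval_lt (K := K) hD hs hk.1)
    have hv2 : e.eval s < D ^ Γ r := hv.trans_le (Nat.pow_le_pow_right (by omega) hk.2)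
    have e1 : WordOp.eval .land (R1.reg 1) (R1.reg 1) = e.eval s := by
      simpa [WordOp.eval] using v1
    have h2 := Exec.op (w := w) .land (4 * r) 1 1 R1 (by
      rw [e1]; exact hv2.trans_le (hpow _ (hΓ' r)))
    rw [e1] at h2
    exact ⟨_, _, _, base, by simp [cost], Exec.seq h1 h2, hc, hs.setReg hv2,
      (hR.tempEq t1).setReg r _, by omega⟩
  | store A a e =>
    intro Q s R base hc hs hk hR _
    simp only [chk, Bool.and_eq_true, decide_eq_true_eq] at hk
    obtain ⟨R1, h1, t1, v1⟩ := a.compile_exec hw hΓ' hs hk.1.1 0 R hR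
    obtain ⟨R2, h2, t2, v2⟩ := e.compile_exec hw hΓ' hs hk.1.2 1 R1 (hR.tempEq t1)
    have v1' : R2.reg 1 = a.eval s := by rw [t2.2 _ (by omega)]; exact v1
    have v2' : R2.reg 5 = e.eval s := v2
    have h3 := Exec.store (w := w) (varr A) 1 5 R2
    rw [v1', v2'] at h3
    have hv2 : e.eval s < D ^ Δ A :=
      (e.eval_lt (K := K) hD hs hk.1.2).trans_le (Nat.pow_le_pow_right (by omega) hk.2)
    exact ⟨_, _, _, base, by simp [cost]; omega, Exec.seq h1 (Exec.seq h2 h3), hc, hs.setCell hv2,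
      ((hR.tempEq t1).tempEq t2).setCell A _ _, by omega⟩
  | seq c d ihc ihd =>
    intro Q s R base hc hs hk hR hS
    simp only [chk, Bool.and_eq_true] at hk
    simp only [cost] at hS ⊢
    obtain ⟨t1, R1, s1, b1, ht1, h1, q1, hs1, hR1, hb1⟩ := ihc _ s R base hc hs hk.1 hR
      (by nlinarith)
    obtain ⟨t2, R2, s2, b2, ht2, h2, q2, hs2, hR2, hb2⟩ := ihd _ s1 R1 b1 q1 hs1 hk.2 hR1
      (by nlinarith)
    exact ⟨_, R2, s2, b2, by omega, Exec.seq h1 h2, q2, hs2, hR2, by nlinarith⟩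
  | ite e c d ihc ihd =>
    intro Q s R base hc hs hk hR hS
    simp only [chk, Bool.and_eq_true] at hk
    simp only [cost] at hS ⊢
    obtain ⟨R0, h0, t0, v0⟩ := e.compile_exec hw hΓ' hs hk.1.1 0 R hR
    have hR0 := hR.tempEq t0
    by_cases he : e.eval s = 0
    · obtain ⟨t1, R1, s1, b1, ht1, h1, q1, hs1, hR1, hb1⟩ := ihd _ s R0 base (hc.2 he) hs hk.2 hR0
        (by nlinarith)
      exact ⟨_, R1, s1, b1, by omega, Exec.seq h0 (.cond_false (by rw [← he]; exact v0) h1), q1, hs1,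
        hR1, by nlinarith⟩
    · obtain ⟨t1, R1, s1, b1, ht1, h1, q1, hs1, hR1, hb1⟩ := ihc _ s R0 base (hc.1 he) hs hk.1.2
        hR0 (by nlinarith)
      exact ⟨_, R1, s1, b1, by omega,
        Exec.seq h0 (.cond_true (by rw [show R0.reg 1 = e.eval s from v0]; exact he) h1), q1, hs1,
        hR1, by nlinarith⟩
  | call =>
    intro Q s R base hc hs hk hR hS
    obtain ⟨v, h1, h2⟩ := hc
    simp only [cost] at hS ⊢
    obtain ⟨hv, t, R', ht, hE, hR'⟩ := hcc s R base v hs h1 hR (by omega)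
    exact ⟨t, R', _, _, ht, hE, h2, hs.setReg hv, hR', by omega⟩
  | loop i b c ih =>
    intro Q s R base hc hs hk hR hS
    obtain ⟨hρ, I, h0, hI, hQ⟩ := hc
    simp only [chk, Bool.and_eq_true, decide_eq_true_eq, Bool.not_eq_true',
      List.contains_eq_mem, decide_eq_false_iff_not, bne_iff_ne] at hk
    obtain ⟨⟨⟨⟨⟨hk, hi⟩, hb⟩, hib⟩, hΓi⟩, hΓ1⟩ := hk
    simp only [cost, mul_zero, add_zero] at hS ⊢
    have two : 2 ≤ 2 ^ w := by
      have := hpow 1 (by have := hΓ i; omega)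
      rw [pow_one] at this; omega
    set N := s.reg b with hN
    have hNlt : N < D ^ Γ i := (hs.1 b).trans_le (Nat.pow_le_pow_right (by omega) hΓi)
    -- the loop, from its head with counter `k` on; the flag is computed by the preceding test
    have key : ∀ j k s1 R1 b1, k + j = N → Frame (.loop i b c) s s1 → I k s1 →
        s1.Bounded D Γ Δ → Sim S (s1.setReg i k) R1 b1 →
        R1.reg 1 = (if k < N then 1 else 0) →
        b1 + (j * c.cost ρ 0 1 + 1) * S ≤ 2 ^ w →
        ∃ t R' s' base', t ≤ j * (c.cost ρ 1 T + 4) + 1 ∧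
          Exec w (.loop 1 (.seq (c.compile cc) (.seq (.const 1 1) (.seq (.op .add (4 * i) (4 * i) 1)
        (.op .lt 1 (4 * i) (4 * b)))))) R1 t R' ∧ Q s' ∧
          s'.Bounded D Γ Δ ∧ Sim S s' R' base' ∧ base' ≤ b1 + j * c.cost ρ 0 1 * S := by
      intro j
      induction j with
      | zero =>
        intro k s1 R1 b1 hkN hf hIk hs1 hR1 hfl hS1
        have : k = N := by omega
        subst this
        refine ⟨1, R1, s1.setReg i N, b1, by omega, .loop_done (by simpa using hfl), hQ s1 hf hIk,
          hs1.setReg hNlt, hR1, by omega⟩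
      | succ j ihj =>
        intro k s1 R1 b1 hkN hf hIk hs1 hR1 hfl hS1
        have hkl : k < N := by omega
        have m1 : ((j + 1) * c.cost ρ 0 1 + 1) * S
            = j * c.cost ρ 0 1 * S + c.cost ρ 0 1 * S + S := by ring
        have m2 : (c.cost ρ 0 1 + 1) * S = c.cost ρ 0 1 * S + S := by ring
        have m3 : (j * c.cost ρ 0 1 + 1) * S = j * c.cost ρ 0 1 * S + S := by ring
        have m4 : (j + 1) * c.cost ρ 0 1 * S
            = j * c.cost ρ 0 1 * S + c.cost ρ 0 1 * S := by ring
        have m5 : (j + 1) * (c.cost ρ 1 T + 4)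
            = j * (c.cost ρ 1 T + 4) + (c.cost ρ 1 T + 4) := by ring
        have hwp := wp_frame c _ (hI k s1 hkl hf hIk)
        have hsk : (s1.setReg i k).Bounded D Γ Δ := hs1.setReg (hkl.trans hNlt)
        obtain ⟨t2, R2, s2, b2, ht2, h2, ⟨q2, f2⟩, hs2, hR2, hb2⟩ := ih _ _ R1 b1 hwp hsk hk hR1
          (by omega)
        have ri : s2.reg i = k := by rw [f2.1 i hi]; simp
        have rb : s2.reg b = N := by
          rw [f2.1 b hb, MemState.setReg_reg_of_ne _ _ (Ne.symm hib), hf.1 b]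
          simp [wr, hb, Ne.symm hib]
        have hf2 : Frame (.loop i b c) s s2 :=
          (hf.setReg (by simp [wr]) k).trans
            (f2.mono (by simp +contextual [wr]) (by simp [wa]))
        have e3 := Exec.const (w := w) 1 1 R2 (by omega)
        have hR3 : Sim S s2 (R2.setReg 1 1) b2 :=
          hR2.tempEq (d := 0) (TempEq.setReg (j := 0) ⟨rfl, fun _ _ => rfl⟩ le_rfl 1)
        set R3 := R2.setReg 1 1 with hR3d
        have v1 : R3.reg 1 = 1 := by simp [hR3d]
        have vi : R3.reg (4 * i) = k := by rw [hR3.reg, ri]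
        have hk1 : k + 1 < 2 ^ w := by
          have h3 := hpow _ (hΓ' i)
          omega
        have e4 := Exec.op (w := w) .add (4 * i) (4 * i) 1 R3 (by
          rw [v1, vi]; exact hk1)
        rw [v1, vi] at e4
        have hR4 := hR3.setReg i (k + 1)
        change Exec w _ R3 1 (R3.setReg (4 * i) (k + 1)) at e4
        set R4 := R3.setReg (4 * i) (k + 1) with hR4d
        have wi : R4.reg (4 * i) = k + 1 := by rw [hR4.reg]; simp
        have wb : R4.reg (4 * b) = N := by
          rw [hR4.reg, MemState.setReg_reg_of_ne _ _ (Ne.symm hib), rb]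
        have e5 := Exec.op (w := w) .lt 1 (4 * i) (4 * b) R4 (by
          rw [wi, wb]; simp only [WordOp.eval]; split <;> omega)
        rw [wi, wb] at e5
        simp only [WordOp.eval] at e5
        have hR5 : Sim S (s2.setReg i (k + 1)) (R4.setReg 1 (if k + 1 < N then 1 else 0)) b2 :=
          hR4.tempEq (d := 0) (TempEq.setReg (j := 0) ⟨rfl, fun _ _ => rfl⟩ le_rfl _)
        obtain ⟨t6, R6, s6, b6, ht6, h6, q6, hs6, hR6, hb6⟩ := ihj (k + 1) s2 _ b2 (by omega) hf2 q2
          hs2 hR5 (by simp) (by omega)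
        refine ⟨_, R6, s6, b6, ?_, .loop_step (by rw [hfl]; simp [hkl])
          (Exec.seq h2 (Exec.seq e3 (Exec.seq e4 e5))) h6, q6, hs6, hR6, by omega⟩
        omega
    have e1 := Exec.const (w := w) (4 * i) 0 R (by omega)
    have hR1 := hR.setReg i 0
    set R1 := R.setReg (4 * i) 0 with hR1d
    have wi : R1.reg (4 * i) = 0 := by rw [hR1.reg]; simp
    have wb : R1.reg (4 * b) = N := by
      rw [hR1.reg, MemState.setReg_reg_of_ne _ _ (Ne.symm hib)]
    have e2 := Exec.op (w := w) .lt 1 (4 * i) (4 * b) R1 (by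
      rw [wi, wb]; simp only [WordOp.eval]; split <;> omega)
    rw [wi, wb] at e2
    have hR2 : Sim S (s.setReg i 0) (R1.setReg 1 (WordOp.lt.eval 0 N)) base :=
      hR1.tempEq (d := 0) (TempEq.setReg (j := 0) ⟨rfl, fun _ _ => rfl⟩ le_rfl _)
    have hcS : (N * c.cost ρ 0 1) * S ≤ ρ b * c.cost ρ 0 1 * S :=
      Nat.mul_le_mul_right _ (Nat.mul_le_mul_right _ hρ)
    obtain ⟨t, R', s', b', ht, hE, q, hs', hR', hb'⟩ := key N 0 s _ base (by omega) (.refl _ _) h0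
      hs hR2 (by simp [WordOp.eval]) (by rw [add_mul] at hS ⊢; omega)
    refine ⟨_, R', s', b', ?_, Exec.seq e1 (Exec.seq e2 hE), q, hs', hR', by omega⟩
    have : N * (c.cost ρ 1 T + 4) ≤ ρ b * (c.cost ρ 1 T + 4) := Nat.mul_le_mul_right _ hρ
    simp only [mul_one]
    omega

end WCmd


/-! ### Calling a program as a subroutine -/

theorem Exec.mono {w w' : ℕ} (h : w ≤ w') {p : Prog} {s s' : MemState} {t : ℕ}
    (hE : Exec w p s t s') : Exec w' p s t s' := by
  have h2 : 2 ^ w ≤ 2 ^ w' := Nat.pow_le_pow_right (by omega) h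
  induction hE with
  | skip s => exact .skip s
  | const r k s hk => exact .const r k s (hk.trans_le h2)
  | op o r a b s ho => exact .op o r a b s (ho.trans_le h2)
  | load r A a s => exact .load r A a s
  | store A a b s => exact .store A a b s
  | seq _ _ h₁ h₂ => exact .seq h₁ h₂
  | cond_true hr _ ih => exact .cond_true hr ih
  | cond_false hr _ ih => exact .cond_false hr ih
  | loop_done hr => exact .loop_done hr
  | loop_step hr _ _ h₁ h₂ => exact .loop_step hr h₁ h₂

namespace Prog

/-- All registers in a program are smaller than this number. -/
def regBound : Prog → ℕ
  | skip => 0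
  | const r _ => r + 1
  | op _ r a b => r + a + b + 1
  | load r _ a => r + a + 1
  | store _ a b => a + b + 1
  | seq p q => p.regBound + q.regBound
  | cond r p q => r + 1 + p.regBound + q.regBound
  | loop r p => r + 1 + p.regBound

/-- The program `p` on the registers `4 * r + 2` and the arrays `2 * A + 3`, where all addresses
are shifted by the content of the register `3`. -/
def reloc : Prog → Prog
  | skip => .skip
  | const r k => .const (4 * r + 2) k
  | op o r a b => .op o (4 * r + 2) (4 * a + 2) (4 * b + 2)
  | load r A a => .seq (.op .add 11 3 (4 * a + 2)) (.load (4 * r + 2) (2 * A + 3) 11)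
  | store A a b => .seq (.op .add 11 3 (4 * a + 2)) (.store (2 * A + 3) 11 (4 * b + 2))
  | seq p q => .seq p.reloc q.reloc
  | cond r p q => .cond (4 * r + 2) p.reloc q.reloc
  | loop r p => .loop (4 * r + 2) p.reloc

/-- The machine state `R` contains the state `s` of a relocated program, and agrees with `R₀`
elsewhere. All numbers in `s` and all addresses with nonzero content are below `B`. -/
structure RelocSim (n B base : ℕ) (s R R₀ : MemState) : Prop where
  reg : ∀ r, r < n → R.reg (4 * r + 2) = s.reg r
  arr : ∀ A a, R.arr (2 * A + 3) (base + a) = s.arr A a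
  baseReg : R₀.reg 3 = base
  frameReg : ∀ r, r % 4 ≠ 2 → r ≠ 11 → R.reg r = R₀.reg r
  frameArr : ∀ A, (∀ A', A ≠ 2 * A' + 3) → R.arr A = R₀.arr A
  reg_lt : ∀ r, s.reg r < B
  arr_lt : ∀ A a, s.arr A a < B
  zero : ∀ A a, B ≤ a → s.arr A a = 0

theorem RelocSim.setReg {n B base : ℕ} {s R R₀ : MemState} (h : RelocSim n B base s R R₀)
    (r : ℕ) {x : ℕ} (hx : x < B) :
    RelocSim n B base (s.setReg r x) (R.setReg (4 * r + 2) x) R₀ where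
  reg r' hr' := by
    rw [MemState.setReg_reg, MemState.setReg_reg, h.reg r' hr']
    by_cases hr : r' = r <;> simp [hr]
  arr := h.arr
  baseReg := h.baseReg
  frameReg r' h1 h2 := by rw [MemState.setReg_reg_of_ne _ _ (by omega), h.frameReg r' h1 h2]
  frameArr := h.frameArr
  reg_lt r' := by rw [MemState.setReg_reg]; split_ifs; exacts [hx, h.reg_lt r']
  arr_lt := h.arr_lt
  zero := h.zero

theorem RelocSim.setScratch {n B base : ℕ} {s R R₀ : MemState} (h : RelocSim n B base s R R₀)
    (x : ℕ) : RelocSim n B base s (R.setReg 11 x) R₀ where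
  reg r' hr' := by rw [MemState.setReg_reg_of_ne _ _ (by omega), h.reg r' hr']
  arr := h.arr
  baseReg := h.baseReg
  frameReg r' h1 h2 := by rw [MemState.setReg_reg_of_ne _ _ h2, h.frameReg r' h1 h2]
  frameArr := h.frameArr
  reg_lt := h.reg_lt
  arr_lt := h.arr_lt
  zero := h.zero

theorem RelocSim.setCell {n B base : ℕ} {s R R₀ : MemState} (h : RelocSim n B base s R R₀)
    (A : ℕ) {a x : ℕ} (ha : a < B) (hx : x < B) :
    RelocSim n B base (s.setCell A a x) (R.setCell (2 * A + 3) (base + a) x) R₀ where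
  reg := h.reg
  arr A' a' := by
    rw [MemState.setCell_arr, MemState.setCell_arr, h.arr]
    by_cases hA : A' = A <;> by_cases hb : a' = a <;> simp [hA, hb]
  baseReg := h.baseReg
  frameReg := h.frameReg
  frameArr A' hA' := by rw [MemState.setCell_arr_of_ne _ _ _ (hA' A), h.frameArr A' hA']
  reg_lt := h.reg_lt
  arr_lt A' a' := by rw [MemState.setCell_arr]; split_ifs; exacts [hx, h.arr_lt A' a']
  zero A' a' ha' := by
    rw [MemState.setCell_arr, if_neg (by rintro ⟨_, rfl⟩; omega), h.zero A' a' ha']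

/-- A relocated program does what the program does, with an additional instruction for every access
to an array. -/
theorem reloc_exec {n B base w w' : ℕ} {R₀ : MemState} (hw : w ≤ w') (hB : 2 ^ w ≤ B)
    (hB' : base + B ≤ 2 ^ w') {p : Prog} {s s' : MemState} {t : ℕ} (hE : Exec w p s t s') :
    ∀ R, p.regBound ≤ n → RelocSim n B base s R R₀ →
      ∃ t' R', t' ≤ 2 * t ∧ Exec w' p.reloc R t' R' ∧ RelocSim n B base s' R' R₀ := by
  have h2 : 2 ^ w ≤ 2 ^ w' := Nat.pow_le_pow_right (by omega) hw
  induction hE with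
  | skip s => intro R _ hR; exact ⟨0, R, by omega, .skip R, hR⟩
  | const r k s hk =>
    intro R _ hR
    exact ⟨1, _, by omega, .const _ _ _ (hk.trans_le h2), hR.setReg r (hk.trans_le hB)⟩
  | op o r a b s ho =>
    intro R hn hR
    simp only [regBound] at hn
    have ha := hR.reg a (by omega)
    have hb := hR.reg b (by omega)
    refine ⟨1, _, by omega, .op _ _ _ _ _ ?_, ?_⟩
    · rw [ha, hb]; exact ho.trans_le h2
    · rw [ha, hb]; exact hR.setReg r (ho.trans_le hB)
  | load r A a s =>
    intro R hn hR
    simp only [regBound] at hn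
    have ha := hR.reg a (by omega)
    have h3 : R.reg 3 = base := by rw [hR.frameReg 3 (by omega) (by omega), hR.baseReg]
    have e1 := Exec.op (w := w') .add 11 3 (4 * a + 2) R (by
      rw [ha, h3]; have := hR.reg_lt a; simp only [WordOp.eval]; omega)
    rw [ha, h3] at e1
    refine ⟨2, _, by omega, .seq e1 (.load _ _ _ _), ?_⟩
    have h4 := hR.setScratch (WordOp.add.eval base (s.reg a))
    have h5 : ((R.setReg 11 (WordOp.add.eval base (s.reg a))).arr (2 * A + 3)
        ((R.setReg 11 (WordOp.add.eval base (s.reg a))).reg 11)) = s.arr A (s.reg a) := by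
      rw [MemState.setReg_reg_self]; exact h4.arr A _
    rw [h5]
    exact h4.setReg r (hR.arr_lt _ _)
  | store A a b s =>
    intro R hn hR
    simp only [regBound] at hn
    have ha := hR.reg a (by omega)
    have h3 : R.reg 3 = base := by rw [hR.frameReg 3 (by omega) (by omega), hR.baseReg]
    have e1 := Exec.op (w := w') .add 11 3 (4 * a + 2) R (by
      rw [ha, h3]; have := hR.reg_lt a; simp only [WordOp.eval]; omega)
    rw [ha, h3] at e1
    refine ⟨2, _, by omega, .seq e1 (.store _ _ _ _), ?_⟩
    have h4 := hR.setScratch (WordOp.add.eval base (s.reg a))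
    rw [MemState.setReg_reg_self, h4.reg b (by omega)]
    exact h4.setCell A (hR.reg_lt a) (hR.reg_lt b)
  | seq _ _ ih₁ ih₂ =>
    intro R hn hR
    simp only [regBound] at hn
    obtain ⟨t1, R1, ht1, e1, hR1⟩ := ih₁ R (by omega) hR
    obtain ⟨t2, R2, ht2, e2, hR2⟩ := ih₂ R1 (by omega) hR1
    exact ⟨_, R2, by omega, .seq e1 e2, hR2⟩
  | @cond_true r p q s s' t hr _ ih =>
    intro R hn hR
    simp only [regBound] at hn
    obtain ⟨t1, R1, ht1, e1, hR1⟩ := ih R (by omega) hR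
    exact ⟨_, R1, by omega, .cond_true (by rw [hR.reg r (by omega)]; exact hr) e1, hR1⟩
  | @cond_false r p q s s' t hr _ ih =>
    intro R hn hR
    simp only [regBound] at hn
    obtain ⟨t1, R1, ht1, e1, hR1⟩ := ih R (by omega) hR
    exact ⟨_, R1, by omega, .cond_false (by rw [hR.reg r (by omega)]; exact hr) e1, hR1⟩
  | @loop_done r p s hr =>
    intro R hn hR
    simp only [regBound] at hn
    exact ⟨1, R, by omega, .loop_done (by rw [hR.reg r (by omega)]; exact hr), hR⟩
  | @loop_step r p s₁ s₂ s₃ t₁ t₂ hr _ _ ih₁ ih₂ =>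
    intro R hn hR
    have hn' := hn
    simp only [regBound] at hn
    obtain ⟨t1, R1, ht1, e1, hR1⟩ := ih₁ R (by omega) hR
    obtain ⟨t2, R2, ht2, e2, hR2⟩ := ih₂ R1 hn' hR1
    exact ⟨_, R2, by omega, .loop_step (by rw [hR.reg r (by omega)]; exact hr) e1 e2, hR2⟩

/-- Set the first `n` registers of the relocated program to `0`. -/
def clearRegs : ℕ → Prog
  | 0 => .skip
  | n + 1 => .seq (clearRegs n) (.const (4 * n + 2) 0)

theorem clearRegs_exec (w n : ℕ) (R : MemState) :
    Exec w (clearRegs n) R n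
      ⟨fun r => if r % 4 = 2 ∧ r < 4 * n then 0 else R.reg r, R.arr⟩ := by
  induction n with
  | zero =>
    have : (⟨fun r => if r % 4 = 2 ∧ r < 4 * 0 then 0 else R.reg r, R.arr⟩ : MemState) = R := by
      ext <;> simp
    rw [this]; exact .skip R
  | succ n ih =>
    have h := Exec.seq ih (Exec.const (w := w) (4 * n + 2) 0 _ (by positivity))
    have e : (⟨fun r => if r % 4 = 2 ∧ r < 4 * (n + 1) then 0 else R.reg r, R.arr⟩ : MemState)
        = MemState.setReg ⟨fun r => if r % 4 = 2 ∧ r < 4 * n then 0 else R.reg r, R.arr⟩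
          (4 * n + 2) 0 := by
      refine MemState.ext (funext fun r => ?_) rfl
      rw [MemState.setReg_reg]
      dsimp only
      split_ifs <;> first | rfl | omega
    rw [e]
    exact h

/-- Copy the cells below the content of the variable `1` of the arrays `2` and `3` into the input
arrays of the relocated program, from the address in register `3` on. -/
def copyLoop : Prog :=
  .loop 1 (.seq (.op .add 11 3 15) (.seq (.load 1 (varr 2) 15) (.seq (.store 3 11 1)
    (.seq (.load 1 (varr 3) 15) (.seq (.store 5 11 1) (.seq (.const 1 1)
      (.seq (.op .add 15 15 1) (.op .lt 1 15 4))))))))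

/-- The code of a call of the program `p`, which uses registers below `n`. -/
def callCode (p : Prog) (n : ℕ) : Prog :=
  .seq (.op .add 3 3 7) (.seq (clearRegs n) (.seq (.op .land 2 4 4) (.seq (.op .land 6 8 8)
    (.seq (.const 15 0) (.seq (.op .lt 1 15 4)
      (.seq copyLoop (.seq p.reloc (.op .land 12 2 2))))))))

end Prog

/-- The input that is handed over in a call: the variables `1` and `2` become the registers `0`
and `1`, and the arrays `2` and `3` become the arrays `0` and `1`, cut off at the length given by
the variable `1`. -/
def MemState.callInput (s : MemState) : MemState where
  reg r := if r = 0 then s.reg 1 else if r = 1 then s.reg 2 else 0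
  arr A a := if a < s.reg 1 ∧ A < 2 then s.arr (A + 2) a else 0

theorem Prog.copyLoop_exec {w : ℕ} (hw : 1 ≤ w) (j : ℕ) : ∀ (R : MemState) (k : ℕ),
    R.reg 15 = k → k + j = R.reg 4 → R.reg 3 + R.reg 4 < 2 ^ w →
    R.reg 1 = (if k < R.reg 4 then 1 else 0) →
    ∃ R', Exec w copyLoop R (9 * j + 1) R' ∧
      (∀ r, r ≠ 1 → r ≠ 11 → r ≠ 15 → R'.reg r = R.reg r) ∧
      (∀ A, A ≠ 3 → A ≠ 5 → R'.arr A = R.arr A) ∧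
      (∀ a, R'.arr 3 a = if R.reg 3 + k ≤ a ∧ a < R.reg 3 + R.reg 4 then
        R.arr 4 (a - R.reg 3) else R.arr 3 a) ∧
      (∀ a, R'.arr 5 a = if R.reg 3 + k ≤ a ∧ a < R.reg 3 + R.reg 4 then
        R.arr 6 (a - R.reg 3) else R.arr 5 a) := by
  have two : 2 ≤ 2 ^ w := by
    calc 2 = 2 ^ 1 := rfl
      _ ≤ 2 ^ w := Nat.pow_le_pow_right (by omega) hw
  induction j with
  | zero =>
    intro R k h15 hk hlt h1
    refine ⟨R, .loop_done (by rw [h1, if_neg (by omega)]), fun _ _ _ _ => rfl, fun _ _ _ => rfl,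
      fun a => ?_, fun a => ?_⟩ <;> rw [if_neg (by omega)]
  | succ j ih =>
    intro R k h15 hk hlt h1
    have v2 : varr 2 = 4 := rfl
    have v3 : varr 3 = 6 := rfl
    have e1 := Exec.op (w := w) .add 11 3 15 R (by simp only [WordOp.eval]; omega)
    simp only [WordOp.eval, h15] at e1
    set R1 := R.setReg 11 (R.reg 3 + k) with d1
    have e2 := Exec.load (w := w) 1 4 15 R1
    set R2 := R1.setReg 1 (R1.arr 4 (R1.reg 15)) with d2
    have e3 := Exec.store (w := w) 3 11 1 R2
    set R3 := R2.setCell 3 (R2.reg 11) (R2.reg 1) with d3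
    have e4 := Exec.load (w := w) 1 6 15 R3
    set R4 := R3.setReg 1 (R3.arr 6 (R3.reg 15)) with d4
    have e5 := Exec.store (w := w) 5 11 1 R4
    set R5 := R4.setCell 5 (R4.reg 11) (R4.reg 1) with d5
    have e6 := Exec.const (w := w) 1 1 R5 (by omega)
    set R6 := R5.setReg 1 1 with d6
    have r15 : R6.reg 15 = k := by
      simp [d6, d5, d4, d3, d2, d1, MemState.setReg_reg, h15]
    have r1 : R6.reg 1 = 1 := by simp [d6]
    have e7 := Exec.op (w := w) .add 15 15 1 R6 (by
      rw [r15, r1]; simp only [WordOp.eval]; omega)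
    simp only [WordOp.eval, r15, r1] at e7
    set R7 := R6.setReg 15 (k + 1) with d7
    have s15 : R7.reg 15 = k + 1 := by simp [d7]
    have s4 : R7.reg 4 = R.reg 4 := by
      simp [d7, d6, d5, d4, d3, d2, d1, MemState.setReg_reg]
    have s3 : R7.reg 3 = R.reg 3 := by
      simp [d7, d6, d5, d4, d3, d2, d1, MemState.setReg_reg]
    have e8 := Exec.op (w := w) .lt 1 15 4 R7 (by simp only [WordOp.eval]; split <;> omega)
    simp only [WordOp.eval, s15, s4] at e8
    set R8 := R7.setReg 1 (if k + 1 < R.reg 4 then 1 else 0) with d8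
    have t4 : R8.reg 4 = R.reg 4 := by rw [d8, MemState.setReg_reg_of_ne _ _ (by omega), s4]
    have t3 : R8.reg 3 = R.reg 3 := by rw [d8, MemState.setReg_reg_of_ne _ _ (by omega), s3]
    have t15 : R8.reg 15 = k + 1 := by rw [d8, MemState.setReg_reg_of_ne _ _ (by omega), s15]
    have a4 : R8.arr 4 = R.arr 4 := by
      funext a; simp [d8, d7, d6, d5, d4, d3, d2, d1, MemState.setCell_arr]
    have a6 : R8.arr 6 = R.arr 6 := by
      funext a; simp [d8, d7, d6, d5, d4, d3, d2, d1, MemState.setCell_arr]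
    have a3 : ∀ a, R8.arr 3 a = if a = R.reg 3 + k then R.arr 4 k else R.arr 3 a := by
      intro a
      simp [d8, d7, d6, d5, d4, d3, d2, d1, MemState.setCell_arr, MemState.setReg_reg, h15]
    have a5 : ∀ a, R8.arr 5 a = if a = R.reg 3 + k then R.arr 6 k else R.arr 5 a := by
      intro a
      simp [d8, d7, d6, d5, d4, d3, d2, d1, MemState.setCell_arr, MemState.setReg_reg, h15]
    obtain ⟨R', hE, f1, f2, f3, f4⟩ := ih R8 (k + 1) t15 (by omega) (by rw [t3, t4]; exact hlt)
      (by rw [t4]; simp [d8])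
    refine ⟨R', ?_, fun r h1 h11 h15 => ?_, fun A h3 h5 => ?_, fun a => ?_, fun a => ?_⟩
    · have := Exec.loop_step (w := w) (r := 1) (by rw [h1, if_pos (by omega)]; simp)
        (Exec.seq e1 (Exec.seq e2 (Exec.seq e3 (Exec.seq e4 (Exec.seq e5 (Exec.seq e6
          (Exec.seq e7 e8))))))) hE
      rw [show 9 * (j + 1) + 1 = 1 + (1 + (1 + (1 + (1 + (1 + (1 + 1)))))) + (9 * j + 1) + 1 by
        omega]
      exact this
    · rw [f1 r h1 h11 h15]
      simp [d8, d7, d6, d5, d4, d3, d2, d1, MemState.setReg_reg, h1, h11, h15]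
    · rw [f2 A h3 h5]
      funext a
      simp [d8, d7, d6, d5, d4, d3, d2, d1, MemState.setCell_arr, h3, h5]
    · rw [f3, t3, t4, a4, a3]
      by_cases ha : a = R.reg 3 + k
      · subst ha
        rw [if_neg (by omega), if_pos rfl, if_pos (by omega)]
        congr 1; omega
      · rw [if_neg ha]
        have : (R.reg 3 + (k + 1) ≤ a ∧ a < R.reg 3 + R.reg 4) ↔
          (R.reg 3 + k ≤ a ∧ a < R.reg 3 + R.reg 4) := by omega
        simp only [this]
    · rw [f4, t3, t4, a6, a5]
      by_cases ha : a = R.reg 3 + k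
      · subst ha
        rw [if_neg (by omega), if_pos rfl, if_pos (by omega)]
        congr 1; omega
      · rw [if_neg ha]
        have : (R.reg 3 + (k + 1) ≤ a ∧ a < R.reg 3 + R.reg 4) ↔
          (R.reg 3 + k ≤ a ∧ a < R.reg 3 + R.reg 4) := by omega
        simp only [this]

/-- A call is legitimate if its input is an instance `x` of `P` of size at most `X` whose numbers
are below `Y`, and if the answer is below `V`. -/
def CountingProblem.CallOk (P : CountingProblem) (X Y V : ℕ) (s : MemState) (v : ℕ) : Prop :=
  ∃ x : P.Inst, P.input x = s.callInput ∧ v = P.answer x ∧ P.size x ≤ X ∧ P.magnitude x + 2 ≤ Y ∧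
    v < V ∧ s.reg 1 ≤ X ∧ s.reg 1 < Y ∧ s.reg 2 < Y ∧
    ∀ a, a < s.reg 1 → s.arr 2 a < Y ∧ s.arr 3 a < Y

/-- Every call works on an interval of `S` addresses of its own, where all cells are still `0`; this
replaces the empty memory with which `p` has to be started. -/
theorem Prog.callCode_spec {P : CountingProblem} {p : Prog} {n wo w S X Y To D : ℕ} {Γ Δ : ℕ → ℕ}
    (hn : p.regBound ≤ n) (hn2 : 2 ≤ n) (hw1 : 1 ≤ w) (hwo : wo ≤ w) (hS1 : 2 ^ wo ≤ S)
    (hS2 : Y ≤ S)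
    (hp : ∀ x : P.Inst, P.size x ≤ X → P.magnitude x + 2 ≤ Y →
      ∃ t s, t ≤ To ∧ Exec wo p (P.input x) t s ∧ s.reg 0 = P.answer x) :
    WCmd.CallSpec w S (2 * To + 9 * X + n + 10) D Γ Δ (P.CallOk X Y (D ^ Γ 3)) (callCode p n) := by
  rintro s R base v hs ⟨x, hx, rfl, hX, hY, hV, hl, hlY, h2Y, hcells⟩ hR hb
  refine ⟨hV, ?_⟩
  obtain ⟨t, s', ht, hE, hans⟩ := hp x hX hY
  have two : 2 ≤ 2 ^ w := by
    calc 2 = 2 ^ 1 := rfl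
      _ ≤ 2 ^ w := Nat.pow_le_pow_right (by omega) hw1
  have q1 : R.reg 4 = s.reg 1 := hR.reg 1
  have q2 : R.reg 8 = s.reg 2 := hR.reg 2
  have e1 := Exec.op (w := w) .add 3 3 7 R (by
    rw [hR.baseReg, hR.stride]; simp only [WordOp.eval]; omega)
  simp only [WordOp.eval, hR.baseReg, hR.stride] at e1
  set R1 := R.setReg 3 (base + S) with d1
  have e2 := clearRegs_exec w n R1
  set R2 : MemState := ⟨fun r => if r % 4 = 2 ∧ r < 4 * n then 0 else R1.reg r, R1.arr⟩ with d2
  have e3 := Exec.op (w := w) .land 2 4 4 R2 (by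
    simp [d2, d1, WordOp.eval, MemState.setReg_reg]; omega)
  have v3 : WordOp.land.eval (R2.reg 4) (R2.reg 4) = s.reg 1 := by
    simp [d2, d1, WordOp.eval, MemState.setReg_reg, q1]
  rw [v3] at e3
  set R3 := R2.setReg 2 (s.reg 1) with d3
  have e4 := Exec.op (w := w) .land 6 8 8 R3 (by
    simp [d3, d2, d1, WordOp.eval, MemState.setReg_reg]; omega)
  have v4 : WordOp.land.eval (R3.reg 8) (R3.reg 8) = s.reg 2 := by
    simp [d3, d2, d1, WordOp.eval, MemState.setReg_reg, q2]
  rw [v4] at e4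
  set R4 := R3.setReg 6 (s.reg 2) with d4
  have e5 := Exec.const (w := w) 15 0 R4 (by omega)
  set R5 := R4.setReg 15 0 with d5
  have e6 := Exec.op (w := w) .lt 1 15 4 R5 (by simp only [WordOp.eval]; split <;> omega)
  have v6 : WordOp.lt.eval (R5.reg 15) (R5.reg 4) = if 0 < s.reg 1 then 1 else 0 := by
    simp [d5, d4, d3, d2, d1, WordOp.eval, MemState.setReg_reg, q1]
  rw [v6] at e6
  set R6 := R5.setReg 1 (if 0 < s.reg 1 then 1 else 0) with d6
  have w4 : R6.reg 4 = s.reg 1 := by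
    simp [d6, d5, d4, d3, d2, d1, MemState.setReg_reg, q1]
  have w3 : R6.reg 3 = base + S := by
    simp [d6, d5, d4, d3, d2, d1, MemState.setReg_reg]
  obtain ⟨R7, e7, f1, f2, f3, f4⟩ := copyLoop_exec hw1 (s.reg 1) R6 0
    (by simp [d6, d5, MemState.setReg_reg]) (by rw [w4]; omega) (by rw [w3, w4]; omega)
    (by rw [w4]; simp [d6])
  have hR6arr : R6.arr = R.arr := rfl
  rw [w3, w4, hR6arr] at f3 f4
  rw [hR6arr] at f2
  have hrel : RelocSim n S (base + S) (P.input x) R7 R7 := by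
    rw [hx]
    refine ⟨fun r hr => ?_, fun A a => ?_, ?_, fun _ _ _ => rfl, fun _ _ => rfl, fun r => ?_,
      fun A a => ?_, fun A a ha => ?_⟩
    · rw [f1 _ (by omega) (by omega) (by omega)]
      simp only [MemState.callInput, d6, d5, d4, d3, d2, d1, MemState.setReg_reg]
      split_ifs <;> omega
    · rcases Nat.lt_or_ge A 2 with hA | hA
      · have hA' : A = 0 ∨ A = 1 := by omega
        rcases hA' with rfl | rfl
        · have := hR.arr 2 a
          have hz := hR.zero 0 (base + S + a) (by omega)
          change R7.arr 3 _ = _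
          rw [f3]
          simp only [MemState.callInput]
          by_cases ha : a < s.reg 1
          · rw [if_pos (by omega), if_pos (by omega), ← this]
            congr 1; omega
          · rw [if_neg (by omega), if_neg (by omega)]; exact hz
        · have := hR.arr 3 a
          have hz := hR.zero 1 (base + S + a) (by omega)
          change R7.arr 5 _ = _
          rw [f4]
          simp only [MemState.callInput]
          by_cases ha : a < s.reg 1
          · rw [if_pos (by omega), if_pos (by omega), ← this]
            congr 1; omega
          · rw [if_neg (by omega), if_neg (by omega)]; exact hz
      · rw [f2 _ (by omega) (by omega), hR.zero A _ (by omega)]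
        simp only [MemState.callInput]
        rw [if_neg (by omega)]
    · rw [f1 _ (by omega) (by omega) (by omega), w3]
    · simp only [MemState.callInput]; split_ifs <;> omega
    · simp only [MemState.callInput]
      split_ifs with h
      · obtain ⟨h1, h2⟩ := h
        have := hcells a h1
        have hA' : A = 0 ∨ A = 1 := by omega
        rcases hA' with rfl | rfl
        · exact this.1.trans_le hS2
        · exact this.2.trans_le hS2
      · omega
    · simp only [MemState.callInput]; rw [if_neg (by omega)]
  obtain ⟨t8, R8, ht8, e8, h8⟩ := reloc_exec (w' := w) hwo hS1 (by omega) hE R7 hn hrel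
  have r8 : R8.reg 2 = P.answer x := by rw [← hans]; exact h8.reg 0 (by omega)
  have hfr : ∀ r, r % 4 ≠ 2 → r ≠ 1 → r ≠ 11 → r ≠ 15 → r ≠ 3 → R8.reg r = R.reg r := by
    intro r h1 h2 h3 h4 h5
    rw [h8.frameReg r h1 h3, f1 r h2 h3 h4]
    simp only [d6, d5, d4, d3, d2, d1, MemState.setReg_reg]
    split_ifs <;> omega
  have hvS : P.answer x < S := by rw [← hans]; exact h8.reg_lt 0
  have e9 := Exec.op (w := w) .land 12 2 2 R8 (by
    simp only [WordOp.eval, Nat.and_self, r8]; omega)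
  simp only [WordOp.eval, Nat.and_self, r8] at e9
  have hsim : Sim S s R8 (base + S) := by
    refine ⟨fun r => ?_, fun A a => ?_, ?_, ?_, fun A a ha => ?_⟩
    · rw [hfr _ (by omega) (by omega) (by omega) (by omega) (by omega), hR.reg]
    · rw [h8.frameArr _ (fun A' => varr_ne A A'), f2 _ (fun h => varr_ne A 0 h)
        (fun h => varr_ne A 1 h), hR.arr]
    · rw [h8.frameReg 3 (by omega) (by omega), f1 _ (by omega) (by omega) (by omega), w3]
    · rw [hfr 7 (by omega) (by omega) (by omega) (by omega) (by omega), hR.stride]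
    · obtain ⟨a', rfl⟩ : ∃ a', a = base + S + a' := ⟨a - (base + S), by omega⟩
      rw [h8.arr, h8.zero _ _ (by omega)]
  refine ⟨_, _, ?_, .seq e1 (.seq e2 (.seq e3 (.seq e4 (.seq e5 (.seq e6 (.seq e7
    (.seq e8 e9))))))), hsim.setReg 3 _⟩
  omega


/-! ### Running times of reductions -/

theorem Real.one_le_two_mul_log {u : ℝ} (hu : 2 ≤ u) : 1 ≤ 2 * Real.log u := by
  have h1 := Real.log_two_gt_d9
  have h2 := Real.log_le_log (by norm_num) hu
  linarith

theorem Nat.clog_le_three_mul_log (s : ℕ) :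
    (Nat.clog 2 (s + 2) : ℝ) ≤ 3 * Real.log ((s : ℝ) + 2) := by
  have h1 := Real.log_two_gt_d9
  have hpos : (0 : ℝ) < (s : ℝ) + 2 := by positivity
  have h2 : Real.log 2 ≤ Real.log ((s : ℝ) + 2) :=
    Real.log_le_log (by norm_num) (by have := Nat.cast_nonneg (α := ℝ) s; linarith)
  have h3 : 2 ^ (Nat.clog 2 (s + 2) - 1) < s + 2 :=
    Nat.pow_pred_clog_lt_self one_lt_two (x := s + 2) (by omega)
  have h4 : 1 ≤ Nat.clog 2 (s + 2) := Nat.clog_pos (by norm_num) (by omega)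
  have h5 : ((Nat.clog 2 (s + 2) - 1 : ℕ) : ℝ) * Real.log 2 ≤ Real.log ((s : ℝ) + 2) := by
    rw [← Real.log_pow]
    refine Real.log_le_log (by positivity) ?_
    exact_mod_cast h3.le
  rw [Nat.cast_sub h4, Nat.cast_one] at h5
  nlinarith

theorem Real.log_nine_mul_le {u : ℝ} (hu : 2 ≤ u) : Real.log (9 * u) ≤ 5 * Real.log u := by
  have h2 := Real.log_le_log (by norm_num) hu
  have h9 : Real.log 9 ≤ 4 * Real.log 2 := by
    have : (4 : ℝ) * Real.log 2 = Real.log (2 ^ 4) := by rw [Real.log_pow]; norm_num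
    rw [this]
    exact Real.log_le_log (by norm_num) (by norm_num)
  rw [Real.log_mul (by norm_num) (by linarith)]
  linarith

/-- The bound on the running time of a program that makes polylogarithmically many calls on inputs
of linear size, and takes linear time up to logarithmic factors otherwise. -/
theorem reduction_time_bound {γ C : ℝ} (hγ : 1 ≤ γ) (a A e k n : ℕ) :
    ∃ C' : ℝ, ∀ s t To : ℕ, (To : ℝ) ≤ |C| * ((8 * (s + 2) : ℕ) + 2 : ℝ) ^ γ *
        Real.log ((8 * (s + 2) : ℕ) + 2 : ℝ) ^ k →
      t ≤ a + A * Nat.clog 2 (s + 2) ^ e * (s + 2 + (2 * To + 9 * (8 * (s + 2)) + n + 10)) →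
      (t : ℝ) ≤ C' * ((s : ℝ) + 2) ^ γ * Real.log ((s : ℝ) + 2) ^ (k + e) := by
  refine ⟨a * 2 ^ (k + e) + A * 3 ^ e * ((83 + n) * 2 ^ k + 2 * (|C| * 9 ^ γ * 5 ^ k)),
    fun s t To hTo ht => ?_⟩
  set u : ℝ := (s : ℝ) + 2 with hu
  have hs := Nat.cast_nonneg (α := ℝ) s
  have hu2 : 2 ≤ u := by linarith
  have hl := Real.one_le_two_mul_log hu2
  have hl0 : 0 < Real.log u := by linarith
  have hug : u ≤ u ^ γ := by
    calc u = u ^ (1 : ℝ) := (Real.rpow_one u).symm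
      _ ≤ u ^ γ := Real.rpow_le_rpow_of_exponent_le (by linarith) hγ
  have hug1 : 1 ≤ u ^ γ := by linarith
  have hug0 : 0 ≤ u ^ γ := by linarith
  have hk : ∀ j : ℕ, 1 ≤ 2 ^ j * Real.log u ^ j := fun j => by
    rw [← mul_pow]; exact one_le_pow₀ hl
  have hX : (((8 * (s + 2) : ℕ) : ℝ) + 2) ≤ 9 * u := by push_cast; linarith
  have hX0 : (0 : ℝ) < ((8 * (s + 2) : ℕ) : ℝ) + 2 := by positivity
  have hX1 : (1 : ℝ) ≤ ((8 * (s + 2) : ℕ) : ℝ) + 2 := by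
    have := Nat.cast_nonneg (α := ℝ) (8 * (s + 2)); linarith
  have hTo' : (To : ℝ) ≤ |C| * 9 ^ γ * 5 ^ k * (u ^ γ * Real.log u ^ k) := by
    refine hTo.trans ?_
    have e1 : (((8 * (s + 2) : ℕ) : ℝ) + 2) ^ γ ≤ 9 ^ γ * u ^ γ := by
      rw [← Real.mul_rpow (by norm_num) (by linarith)]
      exact Real.rpow_le_rpow hX0.le hX (by linarith)
    have e2 : Real.log (((8 * (s + 2) : ℕ) : ℝ) + 2) ^ k ≤ 5 ^ k * Real.log u ^ k := by
      rw [← mul_pow]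
      exact pow_le_pow_left₀ (Real.log_nonneg hX1)
        ((Real.log_le_log hX0 hX).trans (Real.log_nine_mul_le hu2)) _
    calc _ ≤ |C| * (9 ^ γ * u ^ γ) * (5 ^ k * Real.log u ^ k) := by
          gcongr
          exact pow_nonneg (Real.log_nonneg hX1) _
      _ = _ := by ring
  have hcl := Nat.clog_le_three_mul_log s
  rw [← hu] at hcl
  have ht' : (t : ℝ) ≤ a + A * (Nat.clog 2 (s + 2) : ℝ) ^ e *
      (u + (2 * To + 72 * u + n + 10)) := by
    have : (t : ℝ) ≤ ((a + A * Nat.clog 2 (s + 2) ^ e *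
      (s + 2 + (2 * To + 9 * (8 * (s + 2)) + n + 10)) : ℕ) : ℝ) := by exact_mod_cast ht
    push_cast at this
    refine this.trans (le_of_eq ?_)
    rw [hu]; ring
  have hpar : u + (2 * To + 72 * u + n + 10) ≤
      ((83 + n) * 2 ^ k + 2 * (|C| * 9 ^ γ * 5 ^ k)) * (u ^ γ * Real.log u ^ k) := by
    have h1 : u + 72 * u + n + 10 ≤ (83 + n) * (u ^ γ * (2 ^ k * Real.log u ^ k)) := by
      have h2 : u ^ γ ≤ u ^ γ * (2 ^ k * Real.log u ^ k) := le_mul_of_one_le_right hug0 (hk k)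
      have hn := Nat.cast_nonneg (α := ℝ) n
      have h3 : (n : ℝ) ≤ n * (u ^ γ * (2 ^ k * Real.log u ^ k)) :=
        le_mul_of_one_le_right hn (hug1.trans h2)
      nlinarith
    nlinarith
  have hlk : 0 ≤ Real.log u ^ k := pow_nonneg hl0.le _
  calc (t : ℝ) ≤ a + A * (Nat.clog 2 (s + 2) : ℝ) ^ e * (u + (2 * To + 72 * u + n + 10)) := ht'
    _ ≤ a * (u ^ γ * (2 ^ (k + e) * Real.log u ^ (k + e))) + A * (3 * Real.log u) ^ e *
        (((83 + n) * 2 ^ k + 2 * (|C| * 9 ^ γ * 5 ^ k)) * (u ^ γ * Real.log u ^ k)) := by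
      refine add_le_add (le_mul_of_one_le_right (Nat.cast_nonneg _) ?_) ?_
      · exact one_le_mul_of_one_le_of_one_le hug1 (hk _)
      · gcongr
    _ = _ := by rw [mul_pow, pow_add, pow_add]; ring

/-- Repeated multiplication of the register `7` with the register `11`. -/
def Prog.powLoop : ℕ → Prog
  | 0 => .skip
  | j + 1 => .seq (Prog.powLoop j) (.op .mul 7 7 11)

/-- Code that puts `(2 * (x + 2)) ^ j` into the register `7`, where `x` is the content of the
register `0`. -/
def Prog.stride (j : ℕ) : Prog :=
  .seq (.const 7 1) (.seq (.const 1 2) (.seq (.op .add 11 0 1) (.seq (.op .mul 11 11 1)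
    (Prog.powLoop j))))

theorem Prog.powLoop_exec {w : ℕ} (j : ℕ) (R : MemState) (h7 : R.reg 7 = 1)
    (h : ∀ i ≤ j, R.reg 11 ^ i < 2 ^ w) :
    Exec w (powLoop j) R j (R.setReg 7 (R.reg 11 ^ j)) := by
  induction j with
  | zero =>
    have : R.setReg 7 (R.reg 11 ^ 0) = R := by
      refine MemState.ext (funext fun r => ?_) rfl
      rw [MemState.setReg_reg]; split_ifs with hr <;> simp [hr, h7]
    rw [this]; exact .skip R
  | succ j ih =>
    have h1 := ih (fun i hi => h i (by omega))
    have h2 := Exec.op (w := w) .mul 7 7 11 (R.setReg 7 (R.reg 11 ^ j)) (by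
      have := h (j + 1) le_rfl
      simpa [WordOp.eval, MemState.setReg_reg, pow_succ] using this)
    have h3 := Exec.seq h1 h2
    have : (R.setReg 7 (R.reg 11 ^ j)).setReg 7 (WordOp.mul.eval
        ((R.setReg 7 (R.reg 11 ^ j)).reg 7) ((R.setReg 7 (R.reg 11 ^ j)).reg 11))
        = R.setReg 7 (R.reg 11 ^ (j + 1)) := by
      refine MemState.ext (funext fun r => ?_) rfl
      simp only [MemState.setReg_reg, WordOp.eval]
      split_ifs <;> simp_all [pow_succ]
    rw [this] at h3
    exact h3

theorem Prog.stride_exec {w j : ℕ} (R : MemState) (hw : 4 ≤ 2 ^ w)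
    (h : ∀ i ≤ j + 1, (2 * (R.reg 0 + 2)) ^ i < 2 ^ w) :
    ∃ R', Exec w (stride j) R (j + 4) R' ∧ R'.arr = R.arr ∧
      R'.reg 7 = (2 * (R.reg 0 + 2)) ^ j ∧
      ∀ r, r ≠ 1 → r ≠ 7 → r ≠ 11 → R'.reg r = R.reg r := by
  have e1 := Exec.const (w := w) 7 1 R (by omega)
  set R1 := R.setReg 7 1 with d1
  have e2 := Exec.const (w := w) 1 2 R1 (by omega)
  set R2 := R1.setReg 1 2 with d2
  have h1 := h 1 (by omega)
  rw [pow_one] at h1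
  have v3 : WordOp.add.eval (R2.reg 0) (R2.reg 1) = R.reg 0 + 2 := by
    simp [d2, d1, WordOp.eval, MemState.setReg_reg]
  have e3 := Exec.op (w := w) .add 11 0 1 R2 (by rw [v3]; omega)
  rw [v3] at e3
  set R3 := R2.setReg 11 (R.reg 0 + 2) with d3
  have v4 : WordOp.mul.eval (R3.reg 11) (R3.reg 1) = 2 * (R.reg 0 + 2) := by
    simp [d3, d2, d1, WordOp.eval, MemState.setReg_reg, mul_comm]
  have e4 := Exec.op (w := w) .mul 11 11 1 R3 (by rw [v4]; omega)
  rw [v4] at e4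
  set R4 := R3.setReg 11 (2 * (R.reg 0 + 2)) with d4
  have v5 : R4.reg 11 = 2 * (R.reg 0 + 2) := by simp [d4]
  have e5 := powLoop_exec (w := w) j R4 (by simp [d4, d3, d2, d1, MemState.setReg_reg])
    (fun i hi => by rw [v5]; exact h i (by omega))
  refine ⟨R4.setReg 7 (R4.reg 11 ^ j), ?_, ?_, ?_, fun r h1 h7 h11 => ?_⟩
  · have := Exec.seq e1 (Exec.seq e2 (Exec.seq e3 (Exec.seq e4 e5)))
    rw [show j + 4 = 1 + (1 + (1 + (1 + j))) by omega]
    exact this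
  · rfl
  · simp [v5]
  · simp [d4, d3, d2, d1, MemState.setReg_reg, h1, h7, h11]

/-- The state in which a structured program starts on an instance. -/
def CountingProblem.start (Q : CountingProblem) (y : Q.Inst) : MemState where
  reg r := if r = 0 then Q.size y else 0
  arr := (Q.input y).arr

/-- What the input of a problem has to look like for `solvable_of_reduction`. -/
structure CountingProblem.StandardInput (Q : CountingProblem) : Prop where
  size_le : ∀ y, Q.size y ≤ Q.magnitude y
  reg_zero : ∀ y, (Q.input y).reg 0 = Q.size y
  reg_two : ∀ y r, 2 ≤ r → (Q.input y).reg r = 0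
  arr_two : ∀ y A a, 2 ≤ A → (Q.input y).arr A a = 0
  arr_lt : ∀ y A a, (Q.input y).arr A a < Q.magnitude y + 2

/-- A structured program that solves `Q` with polylogarithmically many calls of a subroutine for
`P`, each on an instance of linear size with polynomially bounded numbers, and otherwise takes
linear time up to logarithmic factors, and that leaves its result in the register `4`, transfers
solvability from `P` to `Q`. -/
theorem solvable_of_reduction {P Q : CountingProblem} {γ : ℝ} (hγ : 1 ≤ γ)
    (hP : SolvableInSoftO P γ) (hQ : Q.StandardInput) (c : WCmd) (Γ Δ : ℕ → ℕ) (K q e A : ℕ)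
    (ρ : Q.Inst → ℕ → ℕ) (hq : 1 ≤ q) (hΓ : ∀ r, Γ r + 1 ≤ K) (hΓ0 : 1 ≤ Γ 0) (hΔ0 : 1 ≤ Δ 0)
    (hΔ1 : 1 ≤ Δ 1) (hchk : c.chk Γ Δ K = true)
    (hwp : ∀ y, c.wp (ρ y) (P.CallOk (8 * (Q.size y + 2)) ((Q.size y + 2) ^ q)
      ((Q.magnitude y + 2) ^ Γ 3)) (fun s => s.reg 4 = Q.answer y) (Q.start y))
    (hcost : ∀ y T, c.cost (ρ y) 1 T ≤ A * Nat.clog 2 (Q.size y + 2) ^ e * (Q.size y + 2 + T))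
    (hcalls : ∀ y, c.cost (ρ y) 0 1 ≤ (Q.magnitude y + 2) ^ K) : SolvableInSoftO Q γ := by
  obtain ⟨p, cP, k, C, hp⟩ := hP
  set n := p.regBound + 2 with hn
  set j := (cP + 1) * q with hj
  have hj1 : 1 ≤ j := Nat.mul_pos (by omega) hq
  obtain ⟨C', hC'⟩ := reduction_time_bound (C := C) hγ (j + 5) A e k n
  refine ⟨
    .seq (.stride j) (.seq (c.compile (.callCode p n)) (.op .land 0 16 16)), K + 1 + 2 * j, k + e, C',
    fun y => ?_⟩
  set D := Q.magnitude y + 2 with hD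
  set w := (K + 1 + 2 * j) * Nat.clog 2 D with hw
  set z := Q.size y with hz
  have hzD : z + 2 ≤ D := by have := hQ.size_le y; omega
  have hDw : D ≤ 2 ^ Nat.clog 2 D := Nat.le_pow_clog (by norm_num) _
  have hpow : D ^ (K + 1 + 2 * j) ≤ 2 ^ w := by
    rw [hw, mul_comm (K + 1 + 2 * j), pow_mul]; exact Nat.pow_le_pow_left hDw _
  have hD2 : 2 ≤ D := by omega
  have hw1 : WordBound w D K := ⟨hD2, (Nat.pow_le_pow_right (by omega) (by omega)).trans hpow⟩
  set S := (2 * (z + 2)) ^ j with hS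
  have hSD : ∀ i, (2 * (z + 2)) ^ i ≤ D ^ (2 * i) := fun i => by
    rw [pow_mul]; exact Nat.pow_le_pow_left (by nlinarith) _
  set wo := (cP + 1) * (q * Nat.clog 2 (z + 2)) with hwo
  have hclog : ∀ x, 2 ^ Nat.clog 2 (x + 2) ≤ 2 * (x + 2) := fun x => by
    have h3 : 2 ^ (Nat.clog 2 (x + 2) - 1) < x + 2 :=
      Nat.pow_pred_clog_lt_self one_lt_two (x := x + 2) (by omega)
    have h4 : 1 ≤ Nat.clog 2 (x + 2) := Nat.clog_pos (by norm_num) (by omega)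
    have h5 : 2 ^ Nat.clog 2 (x + 2) = 2 ^ (Nat.clog 2 (x + 2) - 1) * 2 := by
      rw [← pow_succ]; congr 1
    omega
  have hwoS : 2 ^ wo ≤ S := by
    have h1 : 2 ^ wo = (2 ^ Nat.clog 2 (z + 2)) ^ j := by
      rw [← pow_mul, hwo, hj]; congr 1; ring
    rw [h1]; exact Nat.pow_le_pow_left (hclog z) _
  have hSw : (D ^ K + 1) * S ≤ 2 ^ w := by
    calc (D ^ K + 1) * S ≤ D ^ (K + 1) * D ^ (2 * j) := by
          refine Nat.mul_le_mul ?_ (hSD j)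
          have := Nat.one_le_pow K D (by omega)
          rw [pow_succ]; nlinarith
      _ = D ^ (K + 1 + 2 * j) := by rw [← pow_add]
      _ ≤ 2 ^ w := hpow
  have hSw' : 2 * S ≤ 2 ^ w := by
    have := Nat.one_le_pow K D (by omega)
    exact (Nat.mul_le_mul_right S (by omega)).trans hSw
  have hwow : wo ≤ w := by
    refine (Nat.pow_le_pow_iff_right (a := 2) (by norm_num)).1 ?_
    omega
  have hYS : (z + 2) ^ q ≤ S := by
    calc (z + 2) ^ q ≤ (2 * (z + 2)) ^ q := Nat.pow_le_pow_left (by omega) _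
      _ ≤ S := Nat.pow_le_pow_right (by omega) (by rw [hj]; nlinarith)
  set X := 8 * (z + 2) with hX
  set To := ⌊|C| * ((X : ℝ) + 2) ^ γ * Real.log ((X : ℝ) + 2) ^ k⌋₊ with hTo
  have hX1 : (1 : ℝ) ≤ (X : ℝ) + 2 := by
    have := Nat.cast_nonneg (α := ℝ) X; linarith
  have hpx : ∀ x : P.Inst, P.size x ≤ X → P.magnitude x + 2 ≤ (z + 2) ^ q →
      ∃ t s, t ≤ To ∧ Exec wo p (P.input x) t s ∧ s.reg 0 = P.answer x := by
    intro x hx1 hx2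
    obtain ⟨t, s, hE, ha, ht⟩ := hp x
    refine ⟨t, s, ?_, hE.mono ?_, ha⟩
    · refine Nat.le_floor (ht.trans ?_)
      have hsx : (P.size x : ℝ) ≤ X := by exact_mod_cast hx1
      have h0 := Nat.cast_nonneg (α := ℝ) (P.size x)
      have hl : 0 ≤ Real.log ((P.size x : ℝ) + 2) := Real.log_nonneg (by linarith)
      gcongr
      exact le_abs_self C
    · refine Nat.mul_le_mul (by omega) ?_
      refine (Nat.clog_mono_right 2 hx2).trans (Nat.clog_le_of_le_pow ?_)
      rw [mul_comm, pow_mul]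
      exact Nat.pow_le_pow_left (Nat.le_pow_clog (by norm_num) _) _
  have h4w : 4 ≤ 2 ^ w := by
    have : 2 ≤ S := by
      calc 2 ≤ 2 * (z + 2) := by omega
        _ = (2 * (z + 2)) ^ 1 := (pow_one _).symm
        _ ≤ S := Nat.pow_le_pow_right (by omega) hj1
    omega
  have hspec := Prog.callCode_spec (P := P) (p := p) (n := n) (wo := wo) (w := w) (S := S) (X := X)
    (Y := (z + 2) ^ q) (To := To) (D := D) (Γ := Γ) (Δ := Δ) (by omega) (by omega)
    (by by_contra h; have : w = 0 := by omega
        rw [this] at h4w; omega) hwow hwoS hYS hpx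
  obtain ⟨R', hE1, harr, h7, hreg⟩ := Prog.stride_exec (w := w) (j := j) (Q.input y) h4w (by
    intro i hi
    rw [hQ.reg_zero]
    calc (2 * (z + 2)) ^ i ≤ D ^ (2 * i) := hSD i
      _ < D ^ (2 * i + 1) := Nat.pow_lt_pow_right (by omega) (by omega)
      _ ≤ D ^ (K + 1 + 2 * j) := Nat.pow_le_pow_right (by omega)
          (by have := hΓ 0; omega)
      _ ≤ 2 ^ w := hpow)
  rw [hQ.reg_zero] at h7
  have hsim : Sim S (Q.start y) R' 0 := by
    refine ⟨fun r => ?_, fun A a => ?_, ?_, h7, fun A a _ => ?_⟩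
    · rw [hreg _ (by omega) (by omega) (by omega)]
      by_cases hr : r = 0
      · subst hr; simp [CountingProblem.start, hQ.reg_zero]
      · rw [hQ.reg_two y _ (by omega)]; simp [CountingProblem.start, hr]
    · rw [harr]
      unfold varr CountingProblem.start
      split_ifs with hA
      · rfl
      · rw [hQ.arr_two y _ _ (by omega), hQ.arr_two y _ _ (by omega)]
    · rw [hreg 3 (by omega) (by omega) (by omega), hQ.reg_two y 3 (by omega)]
    · rw [harr, hQ.arr_two y _ _ (by omega)]
  have hpos : ∀ i, 0 < D ^ i := fun i => Nat.pow_pos (by omega)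
  have hle : ∀ i, 1 ≤ i → D ≤ D ^ i := fun i hi => by
    calc D = D ^ 1 := (pow_one D).symm
      _ ≤ D ^ i := Nat.pow_le_pow_right (by omega) hi
  have hbd : (Q.start y).Bounded D Γ Δ := by
    refine ⟨fun r => ?_, fun A a => ?_⟩
    · simp only [CountingProblem.start]
      split_ifs with hr
      · subst hr; have := hle _ hΓ0; omega
      · exact hpos _
    · simp only [CountingProblem.start]
      have h1 := hQ.arr_lt y A a
      by_cases hA : 2 ≤ A
      · rw [hQ.arr_two y _ _ hA]; exact hpos _
      · have hA' : A = 0 ∨ A = 1 := by omega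
        rcases hA' with rfl | rfl
        · exact h1.trans_le (hle _ hΔ0)
        · exact h1.trans_le (hle _ hΔ1)
  obtain ⟨t, R, s', base, ht, hE, hans, hbd', hsim', -⟩ := WCmd.compile_exec hw1 hΓ hspec c _ _ R' 0
    (hwp y) hbd hchk hsim (by
      rw [zero_add]
      exact (Nat.mul_le_mul_right S (Nat.succ_le_succ (hcalls y))).trans hSw)
  have h16 : WordOp.land.eval (R.reg 16) (R.reg 16) = Q.answer y := by
    rw [← hans, ← hsim'.reg 4]
    exact Nat.and_self _
  have hE2 := Exec.op (w := w) .land 0 16 16 R (by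
    rw [h16, ← hans]
    exact (hbd'.1 4).trans_le ((Nat.pow_le_pow_right (by omega) (by have := hΓ 4; omega)).trans
      hpow))
  rw [h16] at hE2
  refine ⟨_, _, .seq hE1 (.seq hE hE2), MemState.setReg_reg_self _ _ _, ?_⟩
  refine hC' z _ To ?_ ?_
  · exact Nat.floor_le (by
      have := Real.log_nonneg hX1
      positivity)
  · have h1 := hcost y (2 * To + 9 * X + n + 10)
    rw [show j + 4 + (t + 1) = j + 5 + t by ring]
    exact Nat.add_le_add_left (ht.trans h1) (j + 5)


/-! ### Counting 4-cycles by closed walks -/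

namespace SimpleGraph

variable {V : Type*} {G : SimpleGraph V}

theorem Copy.toSubgraph_adj_apply {W : Type*} {H : SimpleGraph W} (f : Copy H G) (a b : W) :
    f.toSubgraph.Adj (f a) (f b) ↔ H.Adj a b := by
  have hf := f.injective
  constructor
  · rintro ⟨a', b', h, ha, hb⟩
    rw [← hf ha, ← hf hb]
    exact h
  · intro h
    exact ⟨a, b, h, rfl, rfl⟩

/-- The closed walks of length 4 through four distinct nodes. -/
def IsFourCycle (G : SimpleGraph V) (v : Fin 4 → V) : Prop :=
  Function.Injective v ∧ ∀ t, G.Adj (v t) (v (t + 1))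

theorem cycleGraph_four_adj {u v : Fin 4} :
    (cycleGraph 4).Adj u v ↔ v = u + 1 ∨ u = v + 1 := by
  rw [cycleGraph_adj]
  revert u v
  decide

/-- Copies of the 4-cycle, described by the images of its nodes. -/
def copyEquivFourCycle (G : SimpleGraph V) :
    Copy (cycleGraph 4) G ≃ {v : Fin 4 → V // G.IsFourCycle v} where
  toFun f := ⟨f, f.injective, fun t => f.toHom.map_adj (cycleGraph_four_adj.2 (.inl rfl))⟩
  invFun v := ⟨⟨v.1, fun {a b} h => by
    rcases cycleGraph_four_adj.1 h with rfl | rfl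
    · exact v.2.2 a
    · exact (v.2.2 b).symm⟩, v.2.1⟩
  left_inv f := rfl
  right_inv v := rfl

/-- The symmetries of the 4-cycle. -/
abbrev FourCycleSymm : Type :=
  {φ : Equiv.Perm (Fin 4) // ∀ t, φ (t + 1) = φ t + 1 ∨ φ t = φ (t + 1) + 1}

theorem card_fourCycleSymm : Fintype.card FourCycleSymm = 8 := by decide

theorem FourCycleSymm.adj_iff (φ : FourCycleSymm) (a b : Fin 4) :
    (cycleGraph 4).Adj (φ.1 a) (φ.1 b) ↔ (cycleGraph 4).Adj a b := by
  obtain ⟨φ, h⟩ := φ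
  rw [cycleGraph_four_adj, cycleGraph_four_adj]
  revert a b
  revert φ
  decide

/-- Two copies of the 4-cycle span the same subgraph if and only if they differ by a symmetry. -/
noncomputable def fiberEquivFourCycleSymm (f : Copy (cycleGraph 4) G) :
    FourCycleSymm ≃ {g : Copy (cycleGraph 4) G // g.toSubgraph = f.toSubgraph} := by
  have hsub : ∀ φ : FourCycleSymm, ∀ g : Copy (cycleGraph 4) G, (∀ a, g a = f (φ.1 a)) →
      g.toSubgraph = f.toSubgraph := by
    intro φ g hg
    refine Subgraph.ext ?_ ?_
    · ext x
      simp only [Subgraph.map_verts, Subgraph.verts_top, Set.image_univ, Set.mem_range]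
      constructor
      · rintro ⟨a, rfl⟩
        exact ⟨φ.1 a, (hg a).symm⟩
      · rintro ⟨a, rfl⟩
        exact ⟨φ.1.symm a, by simpa using hg (φ.1.symm a)⟩
    · funext x y
      refine propext ⟨?_, ?_⟩
      · rintro ⟨a, b, h, rfl, rfl⟩
        exact ⟨φ.1 a, φ.1 b, (φ.adj_iff a b).2 h, (hg a).symm, (hg b).symm⟩
      · rintro ⟨a, b, h, rfl, rfl⟩
        refine ⟨φ.1.symm a, φ.1.symm b, (φ.adj_iff _ _).1 (by simpa using h), ?_, ?_⟩
        · simpa using hg (φ.1.symm a)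
        · simpa using hg (φ.1.symm b)
  refine Equiv.ofBijective (fun φ => ⟨(copyEquivFourCycle G).symm ⟨fun a => f (φ.1 a),
    fun a b h => φ.1.injective (f.injective h), fun t => f.toHom.map_adj
      ((φ.adj_iff _ _).2 (cycleGraph_four_adj.2 (.inl rfl)))⟩, hsub φ _ fun a => rfl⟩)
    ⟨fun φ ψ h => ?_, fun g => ?_⟩
  · refine Subtype.ext (Equiv.ext fun a => f.injective ?_)
    have h1 := congrArg Subtype.val h
    exact DFunLike.congr_fun h1 a
  · obtain ⟨g, hg⟩ := g
    have hex : ∀ a, ∃ b, f b = g a := by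
      intro a
      have h1 : g a ∈ g.toSubgraph.verts := by simp
      rw [hg] at h1
      simpa using h1
    choose φ hφ using hex
    have hinj : Function.Injective φ := fun a b h => g.injective (by
      change g a = g b
      rw [← hφ a, ← hφ b, h])
    have hadj : ∀ a b, (cycleGraph 4).Adj (φ a) (φ b) ↔ (cycleGraph 4).Adj a b := by
      intro a b
      rw [← Copy.toSubgraph_adj_apply f, hφ, hφ, ← hg, Copy.toSubgraph_adj_apply]
    refine ⟨⟨Equiv.ofBijective φ ⟨hinj, Finite.surjective_of_injective hinj⟩, fun t => ?_⟩, ?_⟩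
    · exact cycleGraph_four_adj.1 ((hadj t (t + 1)).2 (cycleGraph_four_adj.2 (.inl rfl)))
    · refine Subtype.ext (DFunLike.ext _ _ fun a => ?_)
      exact hφ a

/-- A 4-cycle is traversed in eight ways. -/
theorem eight_mul_copyCount [Fintype V] (G : SimpleGraph V) :
    8 * G.copyCount (cycleGraph 4) = Nat.card {v : Fin 4 → V // G.IsFourCycle v} := by
  classical
  rw [copyCount_eq_card_image_copyToSubgraph, ← Nat.card_congr (copyEquivFourCycle G),
    Nat.card_eq_fintype_card, ← Finset.card_univ,
    Finset.card_eq_sum_card_image (Copy.toSubgraph (A := cycleGraph 4) (B := G)),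
    Finset.sum_const_nat (m := 8), mul_comm]
  intro G' hG'
  obtain ⟨f, -, rfl⟩ := Finset.mem_image.1 hG'
  rw [← card_fourCycleSymm, Fintype.card_congr (fiberEquivFourCycleSymm f), Fintype.card_subtype]

theorem sum_neg_one_pow_card_superset (I : Finset (Fin 4)) :
    ∑ S : Finset (Fin 4), (-1 : ℤ) ^ S.card * (if I ⊆ S then 1 else 0)
      = if I = Finset.univ then 1 else 0 := by
  revert I
  decide

set_option maxRecDepth 100000 in
/-- The steps of a closed walk around the cycle `ℤ/4` that uses all of its four edges: an edge is
named by its lower end. -/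
theorem closedWalk_bijective : ∀ φ : Fin 4 → Fin 4,
    (∀ t, φ (t + 1) = φ t + 1 ∨ φ t = φ (t + 1) + 1) →
    (∀ c, ∃ t, (if φ (t + 1) = φ t + 1 then φ t else φ (t + 1)) = c) → Function.Injective φ := by
  decide

/-- Inclusion and exclusion over the four edge classes of a graph whose nodes are arranged
cyclically in four layers: only the 4-cycles that go around the layers survive. -/
theorem sum_copyCount_layers [Fintype V] (lay : V → Fin 4) (B : Fin 4 → V → V → Prop)
    (hB : ∀ t u v, B t u v → lay u = t ∧ lay v = t + 1) (G : Finset (Fin 4) → SimpleGraph V)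
    (hG : ∀ S u v, (G S).Adj u v ↔ ∃ t ∈ S, B t u v ∨ B t v u) :
    ∑ S : Finset (Fin 4), (-1 : ℤ) ^ S.card * ((G S).copyCount (cycleGraph 4) : ℤ)
      = Nat.card {v : Fin 4 → V // ∀ t, B t (v t) (v (t + 1))} := by
  classical
  set W := {v : Fin 4 → V // ∀ t, B t (v t) (v (t + 1))} with hW
  have hlay : ∀ w : W, ∀ t, lay (w.1 t) = t := fun w t => (hB _ _ _ (w.2 t)).1
  -- going around the layers in any of the 8 ways
  let F : W × FourCycleSymm → Fin 4 → V := fun p => p.1.1 ∘ p.2.1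
  have hF : Function.Injective F := by
    rintro ⟨w, φ⟩ ⟨w', φ'⟩ h
    have h1 : φ = φ' := by
      refine Subtype.ext (Equiv.ext fun t => ?_)
      have := congrArg lay (congrFun h t)
      simpa [F, hlay] using this
    subst h1
    have h2 : w = w' := by
      refine Subtype.ext (funext fun t => ?_)
      have := congrFun h (φ.1.symm t)
      simpa [F] using this
    rw [h2]
  have main : ∀ v : Fin 4 → V,
      ∑ S : Finset (Fin 4), (-1 : ℤ) ^ S.card * (if (G S).IsFourCycle v then 1 else 0)
        = if v ∈ Set.range F then 1 else 0 := by
    intro v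
    by_cases hE : ∀ t, ∃ c, B c (v t) (v (t + 1)) ∨ B c (v (t + 1)) (v t)
    · choose c hc using hE
      have hφ : ∀ t, (lay (v (t + 1)) = lay (v t) + 1 ∨ lay (v t) = lay (v (t + 1)) + 1) ∧
          (if lay (v (t + 1)) = lay (v t) + 1 then lay (v t) else lay (v (t + 1))) = c t := by
        intro t
        rcases hc t with h | h
        · have := hB _ _ _ h
          rw [this.1, this.2]; simp
        · have := hB _ _ _ h
          rw [this.1, this.2]
          have h3 : ∀ x : Fin 4, x ≠ x + 1 + 1 := by decide
          simp [h3]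
      have hadj : ∀ S t, (G S).Adj (v t) (v (t + 1)) ↔ c t ∈ S := by
        intro S t
        rw [hG]
        constructor
        · rintro ⟨d, hd, h⟩
          have hd' : d = c t := by
            rw [← (hφ t).2]
            rcases h with h | h
            · have := hB _ _ _ h
              rw [this.1, this.2]; simp
            · have := hB _ _ _ h
              rw [this.1, this.2]
              have h3 : ∀ x : Fin 4, x ≠ x + 1 + 1 := by decide
              simp [h3]
          rw [← hd']; exact hd
        · intro h; exact ⟨c t, h, hc t⟩
      by_cases hcs : Finset.univ.image c = Finset.univ
      · have hinj : Function.Injective (fun t => lay (v t)) := by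
          refine closedWalk_bijective _ (fun t => (hφ t).1) fun d => ?_
          obtain ⟨t, -, ht⟩ := Finset.mem_image.1 (hcs ▸ Finset.mem_univ d)
          exact ⟨t, by rw [← ht]; exact (hφ t).2⟩
        have hvinj : Function.Injective v := fun a b h => hinj (congrArg lay h)
        have e1 : ∀ S, (G S).IsFourCycle v ↔ Finset.univ.image c ⊆ S := fun S => by
          simp [IsFourCycle, hvinj, hadj, Finset.image_subset_iff]
        simp only [e1, sum_neg_one_pow_card_superset, hcs, if_true]
        rw [if_pos]
        let φ : Equiv.Perm (Fin 4) :=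
          Equiv.ofBijective (fun t => lay (v t)) ⟨hinj, Finite.surjective_of_injective hinj⟩
        refine ⟨(⟨v ∘ φ.symm, fun s => ?_⟩, ⟨φ, fun t => (hφ t).1⟩), ?_⟩
        · obtain ⟨t, -, ht⟩ := Finset.mem_image.1 (hcs ▸ Finset.mem_univ s)
          rcases hc t with h | h
          · rw [ht] at h
            have h1 : φ.symm s = t := by rw [Equiv.symm_apply_eq]; exact (hB _ _ _ h).1.symm
            have h2 : φ.symm (s + 1) = t + 1 := by
              rw [Equiv.symm_apply_eq]; exact (hB _ _ _ h).2.symm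
            simp only [Function.comp_apply, h1, h2]; exact h
          · rw [ht] at h
            have h1 : φ.symm s = t + 1 := by rw [Equiv.symm_apply_eq]; exact (hB _ _ _ h).1.symm
            have h2 : φ.symm (s + 1) = t := by
              rw [Equiv.symm_apply_eq]; exact (hB _ _ _ h).2.symm
            simp only [Function.comp_apply, h1, h2]; exact h
        · funext t; simp [F]
      · have hR : v ∉ Set.range F := by
          rintro ⟨⟨w, φ⟩, rfl⟩
          apply hcs
          refine Finset.eq_univ_of_forall fun d => Finset.mem_image.2 ?_
          have hw : ∀ t, lay (F (w, φ) t) = φ.1 t := fun t => hlay w _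
          simp only [hw] at hφ
          have hs : ∀ φ : FourCycleSymm, ∀ d, ∃ t,
              (if φ.1 (t + 1) = φ.1 t + 1 then φ.1 t else φ.1 (t + 1)) = d := by decide
          obtain ⟨t, ht⟩ := hs φ d
          exact ⟨t, Finset.mem_univ _, by rw [← (hφ t).2, ht]⟩
        rw [if_neg hR]
        by_cases hvinj : Function.Injective v
        · have e1 : ∀ S, (G S).IsFourCycle v ↔ Finset.univ.image c ⊆ S := fun S => by
            simp [IsFourCycle, hvinj, hadj, Finset.image_subset_iff]
          simp only [e1, sum_neg_one_pow_card_superset, hcs, if_false]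
        · have e1 : ∀ S, ¬ (G S).IsFourCycle v := fun S h => hvinj h.1
          simp [e1]
    · have e1 : ∀ S, ¬ (G S).IsFourCycle v := fun S h => hE fun t => by
        obtain ⟨d, _, h2⟩ := (hG _ _ _).1 (h.2 t)
        exact ⟨d, h2⟩
      have e2 : v ∉ Set.range F := by
        rintro ⟨⟨w, φ⟩, rfl⟩
        apply hE
        intro t
        rcases φ.2 t with h | h
        · refine ⟨φ.1 t, .inl ?_⟩
          have := w.2 (φ.1 t)
          rw [← h] at this; exact this
        · refine ⟨φ.1 (t + 1), .inr ?_⟩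
          have := w.2 (φ.1 (t + 1))
          rw [← h] at this; exact this
      simp [e1, e2]
  have h8 : (8 : ℤ) * ∑ S : Finset (Fin 4), (-1 : ℤ) ^ S.card *
      ((G S).copyCount (cycleGraph 4) : ℤ) = 8 * Nat.card W := by
    have e1 : ∀ S, (8 : ℤ) * ((G S).copyCount (cycleGraph 4) : ℤ)
        = ∑ v : Fin 4 → V, (if (G S).IsFourCycle v then 1 else 0) := by
      intro S
      have := eight_mul_copyCount (G S)
      rw [Nat.card_eq_fintype_card, Fintype.card_subtype] at this
      rw [Finset.sum_boole]
      exact_mod_cast this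
    rw [Finset.mul_sum]
    simp only [mul_left_comm (8 : ℤ), e1, Finset.mul_sum]
    rw [Finset.sum_comm]
    simp only [main]
    rw [Finset.sum_boole, ← Fintype.card_subtype, ← Nat.card_eq_fintype_card]
    have : Nat.card {v // v ∈ Set.range F} = Nat.card (W × FourCycleSymm) :=
      Nat.card_congr (Equiv.ofInjective F hF).symm
    rw [this, Nat.card_prod, Nat.card_eq_fintype_card (α := FourCycleSymm), card_fourCycleSymm]
    push_cast; ring
  linarith

end SimpleGraph


/-! ### Sublinear running times are impossible -/

theorem Exec.deterministic {w : ℕ} {p : Prog} {s s₁ : MemState} {t₁ : ℕ}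
    (h : Exec w p s t₁ s₁) : ∀ {s₂ t₂}, Exec w p s t₂ s₂ → s₁ = s₂ := by
  induction h with
  | skip s => intro _ _ h; cases h; rfl
  | const => intro _ _ h; cases h; rfl
  | op => intro _ _ h; cases h; rfl
  | load => intro _ _ h; cases h; rfl
  | store => intro _ _ h; cases h; rfl
  | seq _ _ ih₁ ih₂ =>
    intro _ _ h
    cases h with
    | seq h₁ h₂ =>
      have := ih₁ h₁
      subst this
      exact ih₂ h₂
  | cond_true hr _ ih =>
    intro _ _ h
    cases h with
    | cond_true _ h => exact ih h
    | cond_false hr' _ => exact absurd hr' hr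
  | cond_false hr _ ih =>
    intro _ _ h
    cases h with
    | cond_true hr' _ => exact absurd hr hr'
    | cond_false _ h => exact ih h
  | loop_done hr =>
    intro _ _ h
    cases h with
    | loop_done => rfl
    | loop_step hr' _ _ => exact absurd hr hr'
  | loop_step hr _ _ ih₁ ih₂ =>
    intro _ _ h
    cases h with
    | loop_done hr' => exact absurd hr' hr
    | loop_step _ h₁ h₂ =>
      have := ih₁ h₁
      subst this
      exact ih₂ h₂

/-- A program that runs for `t` steps depends on at most `t` addresses: changing the memory at
other addresses does not change the final registers. -/
theorem Exec.exists_readSet {w : ℕ} {p : Prog} {s s' : MemState} {t : ℕ} (h : Exec w p s t s') :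
    ∃ I : Finset ℕ, I.card ≤ t ∧ ∀ r : MemState, r.reg = s.reg →
      (∀ A, ∀ a ∈ I, r.arr A a = s.arr A a) →
      ∃ r', Exec w p r t r' ∧ r'.reg = s'.reg ∧
        ∀ A a, r.arr A a = s.arr A a → r'.arr A a = s'.arr A a := by
  induction h with
  | skip s => exact ⟨∅, by simp, fun r hr _ => ⟨r, .skip r, hr, fun _ _ h => h⟩⟩
  | const x k s hk =>
    refine ⟨∅, by simp, fun r hr _ => ⟨_, .const x k r hk, ?_, fun _ _ h => h⟩⟩
    simp [MemState.setReg, hr]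
  | op o x a b s ho =>
    refine ⟨∅, by simp, fun r hr _ => ⟨_, .op o x a b r (by rw [hr]; exact ho), ?_,
      fun _ _ h => h⟩⟩
    simp [MemState.setReg, hr]
  | load x A a s =>
    refine ⟨{s.reg a}, by simp, fun r hr hI => ⟨_, .load x A a r, ?_, fun _ _ h => h⟩⟩
    simp [MemState.setReg, hr, hI A (s.reg a) (by simp)]
  | store A a b s =>
    refine ⟨∅, by simp, fun r hr _ => ⟨_, .store A a b r, hr, fun A' a' h => ?_⟩⟩
    rw [MemState.setCell_arr, MemState.setCell_arr, hr, h]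
  | seq _ _ ih₁ ih₂ =>
    obtain ⟨I₁, hc₁, h₁⟩ := ih₁
    obtain ⟨I₂, hc₂, h₂⟩ := ih₂
    refine ⟨I₁ ∪ I₂, (Finset.card_union_le _ _).trans (by omega), fun r hr hI => ?_⟩
    obtain ⟨r₁, e₁, g₁, f₁⟩ := h₁ r hr fun A a ha => hI A a (Finset.mem_union_left _ ha)
    obtain ⟨r₂, e₂, g₂, f₂⟩ := h₂ r₁ g₁ fun A a ha =>
      f₁ A a (hI A a (Finset.mem_union_right _ ha))
    exact ⟨r₂, .seq e₁ e₂, g₂, fun A a h => f₂ A a (f₁ A a h)⟩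
  | cond_true hx _ ih =>
    obtain ⟨I, hc, h⟩ := ih
    refine ⟨I, by omega, fun r hr hI => ?_⟩
    obtain ⟨r₁, e₁, g₁, f₁⟩ := h r hr hI
    exact ⟨r₁, .cond_true (by rw [hr]; exact hx) e₁, g₁, f₁⟩
  | cond_false hx _ ih =>
    obtain ⟨I, hc, h⟩ := ih
    refine ⟨I, by omega, fun r hr hI => ?_⟩
    obtain ⟨r₁, e₁, g₁, f₁⟩ := h r hr hI
    exact ⟨r₁, .cond_false (by rw [hr]; exact hx) e₁, g₁, f₁⟩
  | loop_done hx =>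
    exact ⟨∅, by simp, fun r hr _ => ⟨r, .loop_done (by rw [hr]; exact hx), hr, fun _ _ h => h⟩⟩
  | loop_step hx _ _ ih₁ ih₂ =>
    obtain ⟨I₁, hc₁, h₁⟩ := ih₁
    obtain ⟨I₂, hc₂, h₂⟩ := ih₂
    refine ⟨I₁ ∪ I₂, (Finset.card_union_le _ _).trans (by omega), fun r hr hI => ?_⟩
    obtain ⟨r₁, e₁, g₁, f₁⟩ := h₁ r hr fun A a ha => hI A a (Finset.mem_union_left _ ha)
    obtain ⟨r₂, e₂, g₂, f₂⟩ := h₂ r₁ g₁ fun A a ha =>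
      f₁ A a (hI A a (Finset.mem_union_right _ ha))
    exact ⟨r₂, .loop_step (by rw [hr]; exact hx) e₁ e₂, g₂, fun A a h => f₂ A a (f₁ A a h)⟩

theorem exists_softO_lt {γ : ℝ} (hγ : γ < 1) (C : ℝ) (k : ℕ) :
    ∃ m : ℕ, C * ((m : ℝ) + 2) ^ γ * Real.log ((m : ℝ) + 2) ^ k + 4 < m := by
  have h1 : (fun x : ℝ => x ^ γ * Real.log x ^ k) =o[Filter.atTop] fun x : ℝ => x := by
    have h := (isLittleO_log_rpow_rpow_atTop (s := 1 - γ) (k : ℝ) (by linarith))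
    have h2 := (Asymptotics.isBigO_refl (fun x : ℝ => x ^ γ) Filter.atTop).mul_isLittleO h
    refine (h2.congr' ?_ ?_)
    · filter_upwards with x; rw [Real.rpow_natCast]
    · filter_upwards [Filter.eventually_gt_atTop 0] with x hx
      rw [← Real.rpow_add hx]; simp
  have h3 := h1.bound (c := 1 / (2 * (|C| + 1))) (by positivity)
  obtain ⟨m, hm, hm2⟩ := ((tendsto_natCast_atTop_atTop (R := ℝ)).comp
    (Filter.tendsto_add_atTop_nat 2)).eventually h3 |>.and
      (Filter.eventually_gt_atTop 20) |>.exists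
  refine ⟨m, ?_⟩
  simp only [Function.comp_apply, Nat.cast_add, Nat.cast_ofNat, Real.norm_eq_abs] at hm
  have hm0 : (20 : ℝ) < m := by exact_mod_cast hm2
  rw [abs_of_nonneg (by linarith : (0 : ℝ) ≤ (m : ℝ) + 2)] at hm
  set X := ((m : ℝ) + 2) ^ γ * Real.log ((m : ℝ) + 2) ^ k with hX
  have h4 : C * X ≤ |C| * |X| := by rw [← abs_mul]; exact le_abs_self _
  have h5 : |C| * |X| ≤ ((m : ℝ) + 2) / 2 := by
    have h0 := abs_nonneg C
    calc |C| * |X| ≤ (|C| + 1) * |X| := by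
          have := abs_nonneg X; nlinarith
      _ ≤ (|C| + 1) * (1 / (2 * (|C| + 1)) * ((m : ℝ) + 2)) := by gcongr
      _ = ((m : ℝ) + 2) / 2 := by field_simp
  rw [mul_assoc, ← hX]
  linarith

/-- If in some instance of every size it takes the knowledge of all but a few addresses to
determine the answer, then no algorithm runs in sublinear time. -/
theorem not_solvable_of_adversary {P : CountingProblem} {γ : ℝ} (hγ : γ < 1)
    (H : ∀ m : ℕ, ∃ x : P.Inst, P.size x = m ∧ ∀ I : Finset ℕ, I.card + 4 ≤ m →
      ∃ y, P.magnitude y = P.magnitude x ∧ (P.input y).reg = (P.input x).reg ∧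
        (∀ A, ∀ a ∈ I, (P.input y).arr A a = (P.input x).arr A a) ∧
        P.answer y ≠ P.answer x) : ¬ SolvableInSoftO P γ := by
  rintro ⟨p, c, k, C, h⟩
  obtain ⟨m, hm⟩ := exists_softO_lt hγ C k
  obtain ⟨x, rfl, hx⟩ := H m
  obtain ⟨t, s, hE, ha, ht⟩ := h x
  obtain ⟨I, hI, hread⟩ := hE.exists_readSet
  obtain ⟨y, hy1, hy2, hy3, hy4⟩ := hx I (by
    have h4 : (t : ℝ) + 4 ≤ P.size x := by linarith
    have h5 : t + 4 ≤ P.size x := by exact_mod_cast h4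
    omega)
  obtain ⟨r, hr1, hr2, -⟩ := hread _ hy2 hy3
  obtain ⟨t', s', hE', ha', -⟩ := h y
  rw [hy1] at hE'
  have := hr1.deterministic hE'
  subst this
  exact hy4 (by rw [← ha, ← ha', hr2])

/-- The graph with a given list of edges. -/
def EdgeListGraph.ofList {N : ℕ} (l : List (Fin N × Fin N))
    (h1 : (l.map fun e => s(e.1, e.2)).Nodup) (h2 : ∀ e ∈ l, e.1 ≠ e.2) : EdgeListGraph where
  N := N
  G := SimpleGraph.fromEdgeSet {e | e ∈ l.map fun e => s(e.1, e.2)}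
  edges := l
  isEdgeList := by
    refine ⟨h1, fun e => ?_⟩
    rw [SimpleGraph.edgeSet_fromEdgeSet]
    constructor
    · intro he
      refine ⟨he, fun hd => ?_⟩
      obtain ⟨e', he', rfl⟩ := List.mem_map.1 he
      exact h2 e' he' (by simpa using hd)
    · exact fun he => he.1

theorem EdgeListGraph.ofList_adj {N : ℕ} {l : List (Fin N × Fin N)} {h1 h2} {u v : Fin N} :
    (ofList l h1 h2).G.Adj u v ↔ (u, v) ∈ l ∨ (v, u) ∈ l := by
  have e1 : (ofList l h1 h2).G.Adj u v ↔ s(u, v) ∈ l.map fun e => s(e.1, e.2) :=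
    ((ofList l h1 h2).isEdgeList.2 s(u, v)).symm
  rw [e1]
  simp only [List.mem_map, Sym2.eq_iff, Prod.exists]
  constructor
  · rintro ⟨a, b, h, ⟨rfl, rfl⟩ | ⟨rfl, rfl⟩⟩
    · exact .inl h
    · exact .inr h
  · rintro (h | h)
    · exact ⟨u, v, h, .inl ⟨rfl, rfl⟩⟩
    · exact ⟨v, u, h, .inr ⟨rfl, rfl⟩⟩

/-- Four positions outside of a given set. -/
theorem exists_orderEmb_avoiding {m : ℕ} (I : Finset ℕ) (hI : I.card + 4 ≤ m) :
    ∃ e : Fin 4 ↪o Fin m, ∀ t, (e t : ℕ) ∉ I := by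
  classical
  let J : Finset (Fin m) := Finset.univ.filter fun i => (i : ℕ) ∉ I
  have hJ : 4 ≤ J.card := by
    have h1 : (Finset.univ.filter fun i : Fin m => (i : ℕ) ∈ I).card ≤ I.card :=
      Finset.card_le_card_of_injOn (fun i => (i : ℕ)) (by intro i; simp) (by
        intro a _ b _ h; exact Fin.ext h)
    have h2 := Finset.card_filter_add_card_filter_not (s := Finset.univ (α := Fin m))
      (p := fun i => (i : ℕ) ∈ I)
    rw [Finset.card_univ, Fintype.card_fin] at h2
    change 4 ≤ (Finset.univ.filter fun i : Fin m => (i : ℕ) ∉ I).card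
    omega
  refine ⟨J.orderEmbOfCardLe hJ, fun t => ?_⟩
  have := J.orderEmbOfCardLe_mem hJ t
  simpa [J] using this

/-- A star, where four rays may have been replaced by a 4-cycle on their outer ends. -/
noncomputable def rayOrCycle {m : ℕ} (e : Option (Fin 4 ↪o Fin m)) (i : Fin m) :
    Fin (m + 1) × Fin (m + 1) :=
  match e with
  | none => (i.castSucc, Fin.last m)
  | some e => if h : ∃ t, e t = i then (i.castSucc, (e (h.choose + 1)).castSucc)
      else (i.castSucc, Fin.last m)

theorem rayOrCycle_some_apply {m : ℕ} (e : Fin 4 ↪o Fin m) (t : Fin 4) :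
    rayOrCycle (some e) (e t) = ((e t).castSucc, (e (t + 1)).castSucc) := by
  have h : ∃ t', e t' = e t := ⟨t, rfl⟩
  have h2 : h.choose = t := e.injective h.choose_spec
  simp only [rayOrCycle, dif_pos h, h2]

theorem rayOrCycle_fst {m : ℕ} (e : Option (Fin 4 ↪o Fin m)) (i : Fin m) :
    (rayOrCycle e i).1 = i.castSucc := by
  unfold rayOrCycle
  split
  · rfl
  · split_ifs <;> rfl

theorem rayOrCycle_snd {m : ℕ} (e : Option (Fin 4 ↪o Fin m)) (i : Fin m) :
    (rayOrCycle e i).2 = Fin.last m ∨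
      ∃ e' t, e = some e' ∧ i = e' t ∧ (rayOrCycle e i).2 = (e' (t + 1)).castSucc := by
  match e with
  | none => exact .inl rfl
  | some e =>
    by_cases h : ∃ t, e t = i
    · obtain ⟨t, rfl⟩ := h
      exact .inr ⟨e, t, rfl, rfl, by rw [rayOrCycle_some_apply]⟩
    · left; simp [rayOrCycle, h]

/-- The instance of the 4-cycle problem with these edges. -/
noncomputable def starInstance {m : ℕ} (e : Option (Fin 4 ↪o Fin m)) : EdgeListGraph :=
  EdgeListGraph.ofList (List.ofFn (rayOrCycle e))
    (by
      rw [List.map_ofFn, List.nodup_ofFn]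
      intro i j h
      simp only [Function.comp_apply, Sym2.eq_iff, rayOrCycle_fst] at h
      rcases h with ⟨h, -⟩ | ⟨h1, h2⟩
      · exact Fin.castSucc_injective _ h
      · rcases rayOrCycle_snd e j with hj | ⟨e', t, rfl, rfl, hj⟩
        · rw [hj] at h1
          exact absurd h1 (Fin.castSucc_lt_last i).ne
        · rw [hj] at h1
          have hi : i = e' (t + 1) := Fin.castSucc_injective _ h1
          subst hi
          rw [rayOrCycle_some_apply] at h2
          have h3 := e'.injective (Fin.castSucc_injective _ h2)
          have h4 : ∀ t : Fin 4, t + 1 + 1 ≠ t := by decide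
          exact absurd h3 (h4 t))
    (by
      intro p hp
      obtain ⟨i, rfl⟩ := List.mem_ofFn.1 hp
      rw [rayOrCycle_fst]
      rcases rayOrCycle_snd e i with hj | ⟨e', t, rfl, rfl, hj⟩
      · rw [hj]; exact (Fin.castSucc_lt_last i).ne
      · rw [hj]
        intro h
        have h3 := e'.injective (Fin.castSucc_injective _ h)
        have h4 : ∀ t : Fin 4, t ≠ t + 1 := by decide
        exact h4 t h3)

theorem copyCount_star (m : ℕ) :
    (starInstance (m := m) none).G.copyCount (SimpleGraph.cycleGraph 4) = 0 := by
  have : IsEmpty {v : Fin 4 → Fin (m + 1) // (starInstance (m := m) none).G.IsFourCycle v} := by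
    refine ⟨fun ⟨v, hv, hadj⟩ => ?_⟩
    have h : ∀ t, v t = Fin.last m ∨ v (t + 1) = Fin.last m := by
      intro t
      rcases EdgeListGraph.ofList_adj.1 (hadj t) with h | h
      · obtain ⟨i, hi⟩ := List.mem_ofFn.1 h
        right; exact (congrArg Prod.snd hi).symm
      · obtain ⟨i, hi⟩ := List.mem_ofFn.1 h
        left; exact (congrArg Prod.snd hi).symm
    have hne : ∀ a b, a ≠ b → v a = Fin.last m → v b = Fin.last m → False :=
      fun a b hab ha hb => hab (hv (ha.trans hb.symm))
    rcases h 0 with h0 | h0 <;> rcases h 2 with h2 | h2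
    · exact hne 0 2 (by decide) h0 h2
    · exact hne 0 (2 + 1) (by decide) h0 h2
    · exact hne (0 + 1) 2 (by decide) h0 h2
    · exact hne (0 + 1) (2 + 1) (by decide) h0 h2
  have h0 : Nat.card {v : Fin 4 → Fin (m + 1) //
    (starInstance (m := m) none).G.IsFourCycle v} = 0 := Nat.card_of_isEmpty
  have h9 := (SimpleGraph.eight_mul_copyCount (starInstance (m := m) none).G).trans h0
  omega

theorem copyCount_starInstance_some_pos {m : ℕ} (e : Fin 4 ↪o Fin m) :
    (starInstance (some e)).G.copyCount (SimpleGraph.cycleGraph 4) ≠ 0 := by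
  have h8 := SimpleGraph.eight_mul_copyCount (starInstance (some e)).G
  have : Nonempty {v : Fin 4 → Fin (m + 1) // (starInstance (some e)).G.IsFourCycle v} := by
    refine ⟨⟨fun t => (e t).castSucc, fun a b h => e.injective (Fin.castSucc_injective _ h),
      fun t => EdgeListGraph.ofList_adj.2 (.inl (List.mem_ofFn.2 ⟨e t, ?_⟩))⟩⟩
    exact rayOrCycle_some_apply e t
  have hf : Finite {v : Fin 4 → Fin (m + 1) // (starInstance (some e)).G.IsFourCycle v} :=
    Subtype.finite
  have := Nat.card_pos (α := {v : Fin 4 → Fin (m + 1) // (starInstance (some e)).G.IsFourCycle v})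
  intro h0
  rw [h0] at h8
  change 8 * 0 = Nat.card {v : Fin 4 → Fin (m + 1) // (starInstance (some e)).G.IsFourCycle v} at h8
  omega

/-- A star has no 4-cycle, but four edges of it whose cells have not been read can be replaced by
the edges of a 4-cycle. -/
theorem not_solvable_fourCycleProblem {γ : ℝ} (hγ : γ < 1) :
    ¬ SolvableInSoftO fourCycleProblem γ := by
  refine not_solvable_of_adversary hγ fun m => ⟨starInstance (m := m) none,
    by simp [fourCycleProblem, starInstance, EdgeListGraph.ofList], fun I hI => ?_⟩
  obtain ⟨e, he⟩ := exists_orderEmb_avoiding I hI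
  refine ⟨starInstance (some e), ?_, ?_, fun A a ha => ?_, ?_⟩
  · simp [fourCycleProblem, starInstance, EdgeListGraph.ofList]
  · simp [fourCycleProblem, starInstance, EdgeListGraph.ofList, EdgeListGraph.toMem]
  · have hr : ∀ h : a < m, rayOrCycle (some e) ⟨a, h⟩ = rayOrCycle none ⟨a, h⟩ := by
      intro h
      have : ¬ ∃ t, e t = ⟨a, h⟩ := by
        rintro ⟨t, ht⟩
        exact he t (by rw [ht]; exact ha)
      simp [rayOrCycle, this]
    by_cases h : a < m
    · simp [fourCycleProblem, starInstance, EdgeListGraph.ofList, EdgeListGraph.toMem, h, hr h]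
    · simp [fourCycleProblem, starInstance, EdgeListGraph.ofList, EdgeListGraph.toMem, h]
  · change (starInstance (some e)).G.copyCount _ ≠ (starInstance (m := m) none).G.copyCount _
    rw [copyCount_star]
    exact copyCount_starInstance_some_pos e

theorem Equiv.Perm.eq_one_of_lt_iff_lt :
    ∀ σ : Equiv.Perm (Fin 4), (∀ j j', σ j < σ j' ↔ j < j') → σ = 1 := by
  decide

theorem patternCount_one {n : ℕ} {σ : Equiv.Perm (Fin 4)} (hσ : σ ≠ 1) :
    patternCount σ (1 : Equiv.Perm (Fin n)) = 0 := by
  unfold patternCount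
  have : IsEmpty {i : Fin 4 ↪o Fin n // IsOccurrence σ 1 i} := by
    refine ⟨fun ⟨i, hi⟩ => hσ ?_⟩
    have hm : ∀ j j', σ j < σ j' ↔ j < j' := fun j j' => by
      rw [hi j j']; simp
    exact Equiv.Perm.eq_one_of_lt_iff_lt σ hm
  exact Nat.card_of_isEmpty

/-- The identity only contains the increasing pattern, but four of its entries that have not been
read can be rearranged to an occurrence of `σ`. -/
theorem not_solvable_patternProblem {γ : ℝ} (hγ : γ < 1) {σ : Equiv.Perm (Fin 4)} (hσ : σ ≠ 1) :
    ¬ SolvableInSoftO (patternProblem σ) γ := by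
  refine not_solvable_of_adversary hγ fun m => ⟨⟨m, 1⟩, rfl, fun I hI => ?_⟩
  obtain ⟨e, he⟩ := exists_orderEmb_avoiding I hI
  refine ⟨⟨m, σ.viaFintypeEmbedding e.toEmbedding⟩, rfl, rfl, fun A a ha => ?_, ?_⟩
  · simp only [patternProblem, permToMem]
    by_cases h : a < m
    · have : (⟨a, h⟩ : Fin m) ∉ Set.range e.toEmbedding := by
        rintro ⟨t, ht⟩
        apply he t
        have h2 : e t = ⟨a, h⟩ := ht
        rw [h2]; exact ha
      rw [dif_pos h, dif_pos h, Equiv.Perm.viaFintypeEmbedding_apply_notMem_range _ _ this]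
      rfl
    · rw [dif_neg h, dif_neg h]
  · change patternCount σ _ ≠ patternCount σ 1
    rw [patternCount_one hσ]
    unfold patternCount
    have : Nonempty {i : Fin 4 ↪o Fin m //
        IsOccurrence σ (σ.viaFintypeEmbedding e.toEmbedding) i} := by
      refine ⟨⟨e, fun j j' => ?_⟩⟩
      have h : ∀ j, σ.viaFintypeEmbedding e.toEmbedding (e j) = e (σ j) :=
        fun j => Equiv.Perm.viaFintypeEmbedding_apply_image σ e.toEmbedding j
      rw [h, h, e.lt_iff_lt]
    have hf : Finite {i : Fin 4 ↪o Fin m //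
        IsOccurrence σ (σ.viaFintypeEmbedding e.toEmbedding) i} := by
      have : Finite (Fin 4 ↪o Fin m) := Finite.of_injective
        (fun f : Fin 4 ↪o Fin m => (f : Fin 4 → Fin m)) DFunLike.coe_injective
      exact Subtype.finite
    exact Nat.card_pos.ne'


/-! ### Sorting the arcs of a graph by their sources -/

/-- Numbers `0, …, M - 1` are grouped by a function `src`; the groups are arranged one after the
other in the order of their first elements. -/
structure ArcOrder where
  /-- the number of arcs -/
  M : ℕ
  /-- the source of an arc -/
  src : ℕ → ℕ

namespace ArcOrder

variable (a : ArcOrder)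

/-- The first arc with the same source. -/
def first (i : ℕ) : ℕ := Nat.find (⟨i, rfl⟩ : ∃ j, a.src j = a.src i)

/-- The number of arcs with the same source. -/
def deg (i : ℕ) : ℕ := ((Finset.range a.M).filter fun j => a.src j = a.src i).card

/-- The number of arcs whose group comes earlier. -/
def off (i : ℕ) : ℕ := ((Finset.range a.M).filter fun j => a.first j < a.first i).card

/-- The number of arcs that come earlier. -/
def rho (i : ℕ) : ℕ := a.off i + ((Finset.range i).filter fun j => a.src j = a.src i).card

theorem src_first (i : ℕ) : a.src (a.first i) = a.src i :=
  Nat.find_spec (⟨i, rfl⟩ : ∃ j, a.src j = a.src i)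

theorem first_le (i : ℕ) : a.first i ≤ i := Nat.find_min' _ rfl

theorem first_congr {i j : ℕ} (h : a.src i = a.src j) : a.first i = a.first j := by
  unfold first; congr 1; funext k; rw [h]

theorem first_eq_iff {i j : ℕ} : a.first i = a.first j ↔ a.src i = a.src j :=
  ⟨fun h => by rw [← a.src_first i, h, a.src_first], a.first_congr⟩

theorem deg_congr {i j : ℕ} (h : a.src i = a.src j) : a.deg i = a.deg j := by
  unfold deg; rw [h]

theorem off_congr {i j : ℕ} (h : a.src i = a.src j) : a.off i = a.off j := by
  unfold off; rw [a.first_congr h]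

theorem off_add_deg_le {i j : ℕ} (h : a.first i < a.first j) : a.off i + a.deg i ≤ a.off j := by
  unfold off deg
  rw [← Finset.card_union_of_disjoint]
  · refine Finset.card_le_card fun k hk => ?_
    simp only [Finset.mem_union, Finset.mem_filter] at hk ⊢
    rcases hk with ⟨h1, h2⟩ | ⟨h1, h2⟩
    · exact ⟨h1, h2.trans h⟩
    · exact ⟨h1, by rw [a.first_congr h2]; exact h⟩
  · rw [Finset.disjoint_left]
    intro k hk hk'
    simp only [Finset.mem_filter] at hk hk'
    rw [a.first_congr hk'.2] at hk
    exact lt_irrefl _ hk.2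

theorem off_add_deg_le_card (i : ℕ) : a.off i + a.deg i ≤ a.M := by
  unfold off deg
  rw [← Finset.card_union_of_disjoint]
  · exact (Finset.card_le_card (Finset.union_subset (Finset.filter_subset _ _)
      (Finset.filter_subset _ _))).trans (by simp)
  · rw [Finset.disjoint_left]
    intro k hk hk'
    simp only [Finset.mem_filter] at hk hk'
    rw [a.first_congr hk'.2] at hk
    exact lt_irrefl _ hk.2

theorem off_le_rho (i : ℕ) : a.off i ≤ a.rho i := Nat.le_add_right _ _

theorem rho_lt_off_add_deg {i : ℕ} (hi : i < a.M) : a.rho i < a.off i + a.deg i := by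
  unfold rho deg
  refine Nat.add_lt_add_left (Finset.card_lt_card ?_) _
  rw [Finset.ssubset_iff_of_subset (Finset.filter_subset_filter _ (by simpa using hi.le))]
  exact ⟨i, by simpa using hi, by simp⟩

theorem rho_lt_rho {i j : ℕ} (h : a.src i = a.src j) (hij : i < j) : a.rho i < a.rho j := by
  unfold rho
  rw [a.off_congr h, h]
  refine Nat.add_lt_add_left (Finset.card_lt_card ?_) _
  rw [Finset.ssubset_iff_of_subset (Finset.filter_subset_filter _ (by simpa using hij.le))]
  exact ⟨i, by simpa [h] using hij, by simp⟩

theorem rho_injOn {i j : ℕ} (hi : i < a.M) (hj : j < a.M) (h : a.rho i = a.rho j) : i = j := by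
  have h1 := a.rho_lt_off_add_deg hi
  have h2 := a.rho_lt_off_add_deg hj
  have h3 := a.off_le_rho i
  have h4 := a.off_le_rho j
  rcases lt_trichotomy (a.first i) (a.first j) with hf | hf | hf
  · have := a.off_add_deg_le hf; omega
  · have hs := a.first_eq_iff.1 hf
    rcases lt_trichotomy i j with hij | hij | hij
    · have := a.rho_lt_rho hs hij; omega
    · exact hij
    · have := a.rho_lt_rho hs.symm hij; omega
  · have := a.off_add_deg_le hf; omega

/-- The coordinate of the arc `i` on an axis on which every arc occurs in four classes. The half
`h` of the axis holds the two classes `(h, false)` and `(h, true)`, sorted by the sources of the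
arcs. Among equal sources the class `(h, second h)` comes second. -/
def pos (second : Bool → Bool) (i : ℕ) (h v : Bool) : ℕ :=
  2 * a.M * h.toNat + a.rho i + a.off i + (if second h = v then a.deg i else 0)

theorem pos_bounds {second : Bool → Bool} {i : ℕ} (hi : i < a.M) (h v : Bool) :
    2 * a.M * h.toNat + 2 * a.off i ≤ a.pos second i h v ∧
      a.pos second i h v < 2 * a.M * h.toNat + 2 * (a.off i + a.deg i) := by
  have h1 := a.rho_lt_off_add_deg hi
  have h3 := a.off_le_rho i
  unfold pos
  split_ifs <;> omega

/-- How two coordinates compare. -/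
theorem pos_lt_iff {second : Bool → Bool} {i i' : ℕ} (hi : i < a.M) (hi' : i' < a.M)
    (h v h' v' : Bool) : a.pos second i h v < a.pos second i' h' v' ↔
      if h = h' then
        if a.src i = a.src i' then
          if v = v' then a.rho i < a.rho i' else second h = v'
        else a.first i < a.first i'
      else h' = true := by
  obtain ⟨b1, b2⟩ := a.pos_bounds (second := second) hi h v
  obtain ⟨b3, b4⟩ := a.pos_bounds (second := second) hi' h' v'
  have c1 := a.off_add_deg_le_card i
  have c2 := a.off_add_deg_le_card i'
  by_cases hh : h = h'
  · subst hh
    rw [if_pos rfl]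
    by_cases hs : a.src i = a.src i'
    · rw [if_pos hs]
      have e1 := a.off_congr hs
      have e2 := a.deg_congr hs
      by_cases hv : v = v'
      · subst hv
        rw [if_pos rfl]
        unfold pos
        rw [e1, e2]
        omega
      · rw [if_neg hv]
        have d1 := a.rho_lt_off_add_deg hi
        have d2 := a.off_le_rho i
        have d3 := a.rho_lt_off_add_deg hi'
        have d4 := a.off_le_rho i'
        unfold pos
        by_cases hs2 : second h = v'
        · rw [if_pos hs2, if_neg (by rw [hs2]; exact fun h => hv h.symm)]
          simp only [hs2, iff_true]; omega
        · have : second h = v := by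
            cases v <;> cases v' <;> simp_all
          rw [if_neg hs2, if_pos this]
          simp only [hs2, iff_false]; omega
    · rw [if_neg hs]
      constructor
      · intro hlt
        by_contra hf
        rcases (not_lt.1 hf).lt_or_eq with hf | hf
        · have := a.off_add_deg_le hf; omega
        · exact hs (a.first_eq_iff.1 hf.symm)
      · intro hf
        have := a.off_add_deg_le hf; omega
  · rw [if_neg hh]
    have : (h = false ∧ h' = true) ∨ (h = true ∧ h' = false) := by
      cases h <;> cases h' <;> simp_all
    rcases this with ⟨rfl, rfl⟩ | ⟨rfl, rfl⟩
    · simp only [Bool.toNat_false, Bool.toNat_true, iff_true] at *; omega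
    · simp only [Bool.toNat_false, Bool.toNat_true, Bool.false_eq_true, iff_false] at *; omega

theorem pos_lt {second : Bool → Bool} {i : ℕ} (hi : i < a.M) (h v : Bool) :
    a.pos second i h v < 4 * a.M := by
  have b2 := (a.pos_bounds (second := second) hi h v).2
  have c1 := a.off_add_deg_le_card i
  cases h <;> simp only [Bool.toNat_false, Bool.toNat_true] at b2 <;> omega

theorem pos_injective {second : Bool → Bool} {i i' : ℕ} (hi : i < a.M) (hi' : i' < a.M)
    {h v h' v' : Bool} (he : a.pos second i h v = a.pos second i' h' v') :
    i = i' ∧ h = h' ∧ v = v' := by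
  have h1 := (a.pos_lt_iff hi hi' h v h' v').not.1 he.ge.not_gt
  have h2 := (a.pos_lt_iff hi' hi h' v' h v).not.1 he.le.not_gt
  by_cases hh : h = h'
  · subst hh
    rw [if_pos rfl] at h1 h2
    by_cases hs : a.src i = a.src i'
    · rw [if_pos hs] at h1
      rw [if_pos hs.symm] at h2
      by_cases hv : v = v'
      · subst hv
        rw [if_pos rfl] at h1 h2
        exact ⟨a.rho_injOn hi hi' (by omega), rfl, rfl⟩
      · rw [if_neg hv] at h1
        rw [if_neg (Ne.symm hv)] at h2
        cases v <;> cases v' <;> simp_all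
    · rw [if_neg hs] at h1
      rw [if_neg (Ne.symm hs)] at h2
      exact absurd (a.first_eq_iff.1 (by omega)) hs
  · rw [if_neg hh] at h1
    rw [if_neg (Ne.symm hh)] at h2
    cases h <;> cases h' <;> simp_all

end ArcOrder

/-! ### Counting closed walks by patterns -/

/-- Arcs together with an involution that reverses them. -/
structure ArcSystem extends ArcOrder where
  /-- the reversed arc -/
  rev : ℕ → ℕ
  rev_lt : ∀ i, i < M → rev i < M
  rev_rev : ∀ i, i < M → rev (rev i) = i

namespace ArcSystem

variable (a : ArcSystem)

/-- The points of the permutation: every arc occurs in each of the four quadrants. The first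
Boolean is the half of the horizontal axis, the second one the half of the vertical axis. -/
abbrev Point : Type := Fin a.M × Bool × Bool

/-- The horizontal coordinate: points are sorted by the source of the arc. -/
def xpos (sx : Bool → Bool) (u : a.Point) : ℕ := a.pos sx u.1 u.2.1 u.2.2

/-- The vertical coordinate: points are sorted by the target of the arc. -/
def ypos (sy : Bool → Bool) (u : a.Point) : ℕ := a.pos sy (a.rev u.1) u.2.2 u.2.1

theorem rev_injOn {i j : ℕ} (hi : i < a.M) (hj : j < a.M) (h : a.rev i = a.rev j) : i = j := by
  rw [← a.rev_rev i hi, h, a.rev_rev j hj]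

theorem card_point : Fintype.card a.Point = 4 * a.M := by
  simp [Point]; ring

/-- The columns of the points. -/
noncomputable def xEquiv (sx : Bool → Bool) : a.Point ≃ Fin (4 * a.M) :=
  Equiv.ofBijective (fun u => ⟨a.xpos sx u, a.pos_lt u.1.2 _ _⟩) (by
    rw [Fintype.bijective_iff_injective_and_card]
    refine ⟨fun u v h => ?_, by rw [a.card_point, Fintype.card_fin]⟩
    obtain ⟨h1, h2, h3⟩ := a.pos_injective u.1.2 v.1.2 (Fin.mk.inj_iff.1 h)
    exact Prod.ext (Fin.ext h1) (Prod.ext h2 h3))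

/-- The rows of the points. -/
noncomputable def yEquiv (sy : Bool → Bool) : a.Point ≃ Fin (4 * a.M) :=
  Equiv.ofBijective (fun u => ⟨a.ypos sy u, a.pos_lt (a.rev_lt _ u.1.2) _ _⟩) (by
    rw [Fintype.bijective_iff_injective_and_card]
    refine ⟨fun u v h => ?_, by rw [a.card_point, Fintype.card_fin]⟩
    obtain ⟨h1, h2, h3⟩ := a.pos_injective (a.rev_lt _ u.1.2) (a.rev_lt _ v.1.2)
      (Fin.mk.inj_iff.1 h)
    exact Prod.ext (Fin.ext (a.rev_injOn u.1.2 v.1.2 h1)) (Prod.ext h3 h2))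

/-- The permutation whose points are the points `u`. -/
noncomputable def perm (sx sy : Bool → Bool) : Equiv.Perm (Fin (4 * a.M)) :=
  (a.xEquiv sx).symm.trans (a.yEquiv sy)

theorem perm_apply (sx sy : Bool → Bool) (u : a.Point) (h : a.xpos sx u < 4 * a.M) :
    (a.perm sx sy ⟨a.xpos sx u, h⟩ : ℕ) = a.ypos sy u := by
  have : (⟨a.xpos sx u, h⟩ : Fin (4 * a.M)) = a.xEquiv sx u := rfl
  rw [this]
  simp [perm, yEquiv]

/-- Four points form the pattern `σ`. -/
def IsOcc (σ : Equiv.Perm (Fin 4)) (sx sy : Bool → Bool) (u : Fin 4 → a.Point) : Prop :=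
  (∀ j j', j < j' ↔ a.xpos sx (u j) < a.xpos sx (u j')) ∧
    ∀ j j', σ j < σ j' ↔ a.ypos sy (u j) < a.ypos sy (u j')

theorem patternCount_perm (σ : Equiv.Perm (Fin 4)) (sx sy : Bool → Bool) :
    patternCount σ (a.perm sx sy) = Nat.card {u : Fin 4 → a.Point // a.IsOcc σ sx sy u} := by
  refine Nat.card_congr
    { toFun := fun i => ⟨fun j => (a.xEquiv sx).symm (i.1 j), fun j j' => ?_, fun j j' => ?_⟩
      invFun := fun u => ⟨OrderEmbedding.ofStrictMono (fun j => a.xEquiv sx (u.1 j))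
        (fun j j' h => (u.2.1 j j').1 h), fun j j' => ?_⟩
      left_inv := fun i => ?_
      right_inv := fun u => ?_ }
  · have e : ∀ j, a.xpos sx ((a.xEquiv sx).symm (i.1 j)) = i.1 j := fun j =>
      congrArg Fin.val ((a.xEquiv sx).apply_symm_apply (i.1 j))
    rw [e, e, Fin.val_fin_lt, i.1.lt_iff_lt]
  · rw [i.2 j j', ← Fin.val_fin_lt]; rfl
  · have e : ∀ j, (a.perm sx sy (a.xEquiv sx (u.1 j)) : ℕ) = a.ypos sy (u.1 j) := fun j =>
      congrArg (fun v => (a.yEquiv sy v : ℕ)) ((a.xEquiv sx).symm_apply_apply (u.1 j))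
    rw [u.2.2 j j', ← Fin.val_fin_lt]
    exact (by rw [e, e] : (a.perm sx sy (a.xEquiv sx (u.1 j)) : ℕ) <
      a.perm sx sy (a.xEquiv sx (u.1 j')) ↔ _).symm
  · exact Subtype.ext (DFunLike.ext _ _ fun j => (a.xEquiv sx).apply_symm_apply (i.1 j))
  · exact Subtype.ext (funext fun j => (a.xEquiv sx).symm_apply_apply (u.1 j))

/-- The quadrant that the `j`-th point of an occurrence of `σ` has to be in. -/
def quad (σ : Equiv.Perm (Fin 4)) (j : Fin 4) : Bool × Bool := (decide (2 ≤ j), decide (2 ≤ σ j))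

/-- The pattern `σ` puts one point into each quadrant. -/
def SplitsEvenly (σ : Equiv.Perm (Fin 4)) : Prop := ∀ q : Bool × Bool, ∃ j, quad σ j = q

instance : DecidablePred SplitsEvenly := fun σ => by unfold SplitsEvenly; infer_instance

/-- The class that comes second among equal keys if ties count as increasing; `flip` exchanges
the two classes, so that ties do not count. -/
def sndX (σ : Equiv.Perm (Fin 4)) (flip : Bool × Bool) (h : Bool) : Bool :=
  if h then xor (decide (2 ≤ σ 3)) flip.2 else xor (decide (2 ≤ σ 1)) flip.1

/-- The analogue of `sndX` for the vertical axis. -/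
def sndY (σ : Equiv.Perm (Fin 4)) (flip : Bool × Bool) (v : Bool) : Bool :=
  if v then xor (decide (2 ≤ σ.symm 3)) flip.2 else xor (decide (2 ≤ σ.symm 1)) flip.1

/-- The sign of a choice of flips. -/
def sgn (f : Bool × Bool) : ℤ := (if f.1 then -1 else 1) * (if f.2 then -1 else 1)

set_option maxRecDepth 100000 in
theorem quad_eq_of_monotone : ∀ q : Fin 4 → Bool × Bool, (∀ p, ∃ j, q j = p) →
    (∀ j j', j < j' → ((q j).1 = true → (q j').1 = true)) → ∀ j, (q j).1 = decide (2 ≤ j) := by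
  decide

theorem SplitsEvenly.ne {σ : Equiv.Perm (Fin 4)} (hσ : SplitsEvenly σ) :
    (decide (2 ≤ σ 0) ≠ decide (2 ≤ σ 1) ∧ decide (2 ≤ σ 2) ≠ decide (2 ≤ σ 3)) ∧
    (decide (2 ≤ σ.symm 0) ≠ decide (2 ≤ σ.symm 1) ∧
      decide (2 ≤ σ.symm 2) ≠ decide (2 ≤ σ.symm 3)) := by
  revert hσ
  revert σ
  decide

theorem xpos_lt_congr {sx sx' : Bool → Bool} {u u' : a.Point} (h v : Bool)
    (hs : ∀ k, k ≠ h → sx k = sx' k) (hu : u.2 ≠ (h, v)) (hu' : u'.2 ≠ (h, v)) :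
    a.xpos sx u < a.xpos sx u' ↔ a.xpos sx' u < a.xpos sx' u' := by
  obtain ⟨i, k, w⟩ := u
  obtain ⟨i', k', w'⟩ := u'
  simp only [xpos, a.pos_lt_iff i.2 i'.2]
  by_cases hk : k = k'
  · subst hk
    by_cases hkh : k = h
    · subst hkh
      have : w = w' := by
        simp only [ne_eq, Prod.mk.injEq, true_and] at hu hu'
        cases v <;> cases w <;> cases w' <;> simp_all
      simp [this]
    · simp [hs k hkh]
  · simp [hk]

/-- Every occurrence that meets all quadrants meets them in the prescribed way. -/
theorem IsOcc.quad_eq {σ : Equiv.Perm (Fin 4)} {sx sy : Bool → Bool} {u : Fin 4 → a.Point}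
    (h : a.IsOcc σ sx sy u) (hq : ∀ q, ∃ j, (u j).2 = q) (j : Fin 4) : (u j).2 = quad σ j := by
  have h1 : ∀ j, (u j).2.1 = decide (2 ≤ j) := by
    refine quad_eq_of_monotone (fun j => (u j).2) hq fun j j' hj ht => ?_
    have := (h.1 j j').1 hj
    rw [xpos, xpos, a.pos_lt_iff (u j).1.2 (u j').1.2] at this
    by_contra hf
    have hf : (u j').2.1 = false := by simpa using hf
    simp [ht, hf] at this
  have h2 : ∀ r, (u (σ.symm r)).2.2 = decide (2 ≤ r) := by
    refine quad_eq_of_monotone (fun r => ((u (σ.symm r)).2.2, (u (σ.symm r)).2.1)) (fun p => ?_)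
      fun r r' hr ht => ?_
    · obtain ⟨j, hj⟩ := hq (p.2, p.1)
      exact ⟨σ j, by simp [hj]⟩
    · have := (h.2 (σ.symm r) (σ.symm r')).1 (by simpa using hr)
      rw [ypos, ypos, a.pos_lt_iff (a.rev_lt _ (u (σ.symm r)).1.2)
        (a.rev_lt _ (u (σ.symm r')).1.2)] at this
      by_contra hf
      have hf : (u (σ.symm r')).2.2 = false := by simpa using hf
      have ht' : (u (σ.symm r)).2.2 = true := ht
      simp [ht', hf] at this
  refine Prod.ext (h1 j) ?_
  have := h2 (σ j)
  rwa [σ.symm_apply_apply] at this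

/-- The four equalities of keys that arrange four arcs to a closed walk. -/
def KeysAgree (σ : Equiv.Perm (Fin 4)) (e : Fin 4 → Fin a.M) : Prop :=
  (a.src (e 0) = a.src (e 1) ∧ a.src (e 2) = a.src (e 3)) ∧
    (a.src (a.rev (e (σ.symm 0))) = a.src (a.rev (e (σ.symm 1))) ∧
      a.src (a.rev (e (σ.symm 2))) = a.src (a.rev (e (σ.symm 3))))

theorem isOcc_iff_of_quad {σ : Equiv.Perm (Fin 4)} {sx sy : Bool → Bool} {u : Fin 4 → a.Point}
    (hu : ∀ j, (u j).2 = quad σ j) : a.IsOcc σ sx sy u ↔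
      (a.xpos sx (u 0) < a.xpos sx (u 1) ∧ a.xpos sx (u 2) < a.xpos sx (u 3)) ∧
      (a.ypos sy (u (σ.symm 0)) < a.ypos sy (u (σ.symm 1)) ∧
        a.ypos sy (u (σ.symm 2)) < a.ypos sy (u (σ.symm 3))) := by
  have chain : ∀ X : Fin 4 → ℕ, X 1 < X 2 →
      ((∀ j j', j < j' ↔ X j < X j') ↔ X 0 < X 1 ∧ X 2 < X 3) := by
    intro X h12
    constructor
    · intro h
      exact ⟨(h 0 1).1 (by decide), (h 2 3).1 (by decide)⟩
    · rintro ⟨h01, h23⟩ j j'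
      fin_cases j <;> fin_cases j' <;> simp <;> omega
  unfold IsOcc
  have hx : a.xpos sx (u 1) < a.xpos sx (u 2) := by
    rw [xpos, xpos, a.pos_lt_iff (u 1).1.2 (u 2).1.2, hu, hu]
    simp [quad]
  have hy : a.ypos sy (u (σ.symm 1)) < a.ypos sy (u (σ.symm 2)) := by
    rw [ypos, ypos, a.pos_lt_iff (a.rev_lt _ (u (σ.symm 1)).1.2) (a.rev_lt _ (u (σ.symm 2)).1.2),
      hu, hu]
    simp [quad]
  rw [chain (fun j => a.xpos sx (u j)) hx,
    ← chain (fun r => a.ypos sy (u (σ.symm r))) hy]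
  refine and_congr Iff.rfl ⟨fun h r r' => ?_, fun h j j' => ?_⟩
  · have := h (σ.symm r) (σ.symm r')
    simpa using this
  · have := h (σ j) (σ j')
    simpa using this

open Classical in
/-- The indicator of a proposition. -/
noncomputable def ind (p : Prop) : ℤ := if p then 1 else 0

theorem sum_ind {α : Type*} [Fintype α] (p : α → Prop) :
    ∑ u, ind (p u) = Nat.card {u // p u} := by
  classical
  rw [Nat.card_eq_fintype_card, Fintype.card_subtype, ← Finset.sum_boole]
  refine Finset.sum_congr rfl fun u _ => ?_
  by_cases p u <;> simp [ind, *]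

theorem ind_and (p q : Prop) : ind (p ∧ q) = ind p * ind q := by
  by_cases p <;> by_cases q <;> simp [ind, *]

/-- The difference between the two ways of treating ties is the indicator of equal keys. -/
theorem tie_difference {i i' : ℕ} (hi : i < a.M) (hi' : i' < a.M) (h : Bool) {v v' : Bool}
    (hv : v ≠ v') (second : Bool → Bool → Bool) (hs : ∀ f, second f h = xor v' f) :
    ind (a.pos (second false) i h v < a.pos (second false) i' h v') -
      ind (a.pos (second true) i h v < a.pos (second true) i' h v')
        = ind (a.src i = a.src i') := by
  simp only [ind, a.pos_lt_iff hi hi', hs, hv]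
  by_cases h1 : a.src i = a.src i'
  · cases v' <;> simp [h1]
  · simp [h1]

/-- Summed over all signed ways to treat ties, the occurrences of `σ` that miss a quadrant cancel,
and there remain the closed walks. -/
theorem sum_sgn_isOcc {σ : Equiv.Perm (Fin 4)} (hσ : SplitsEvenly σ)
    (u : Fin 4 → a.Point) :
    ∑ f : Bool × Bool, ∑ g : Bool × Bool, sgn f * sgn g *
      ind (a.IsOcc σ (sndX σ f) (sndY σ g) u)
      = ind ((∀ j, (u j).2 = quad σ j) ∧ a.KeysAgree σ (fun j => (u j).1)) := by
  by_cases hu : ∀ j, (u j).2 = quad σ j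
  · obtain ⟨⟨n1, n2⟩, n3, n4⟩ := hσ.ne
    have q1 : ∀ j, (u j).2.1 = decide (2 ≤ j) := fun j => congrArg Prod.fst (hu j)
    have q2 : ∀ j, (u j).2.2 = decide (2 ≤ σ j) := fun j => congrArg Prod.snd (hu j)
    simp only [isOcc_iff_of_quad a hu, hu, KeysAgree]
    have t1 := a.tie_difference (u 0).1.2 (u 1).1.2 false n1 (fun f => sndX σ (f, false))
      (fun f => by simp [sndX])
    have t2 := a.tie_difference (u 2).1.2 (u 3).1.2 true n2 (fun f => sndX σ (false, f))
      (fun f => by simp [sndX])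
    have t3 := a.tie_difference (a.rev_lt _ (u (σ.symm 0)).1.2) (a.rev_lt _ (u (σ.symm 1)).1.2)
      false n3 (fun f => sndY σ (f, false)) (fun f => by simp [sndY])
    have t4 := a.tie_difference (a.rev_lt _ (u (σ.symm 2)).1.2) (a.rev_lt _ (u (σ.symm 3)).1.2)
      true n4 (fun f => sndY σ (false, f)) (fun f => by simp [sndY])
    have e1 : ∀ f : Bool × Bool, (a.xpos (sndX σ f) (u 0) < a.xpos (sndX σ f) (u 1)) ↔
        a.pos (sndX σ (f.1, false)) (u 0).1 false (decide (2 ≤ σ 0)) <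
          a.pos (sndX σ (f.1, false)) (u 1).1 false (decide (2 ≤ σ 1)) := fun f => by
      simp [xpos, q1, q2, ArcOrder.pos, sndX]
    have e2 : ∀ f : Bool × Bool, (a.xpos (sndX σ f) (u 2) < a.xpos (sndX σ f) (u 3)) ↔
        a.pos (sndX σ (false, f.2)) (u 2).1 true (decide (2 ≤ σ 2)) <
          a.pos (sndX σ (false, f.2)) (u 3).1 true (decide (2 ≤ σ 3)) := fun f => by
      simp [xpos, q1, q2, ArcOrder.pos, sndX]
    have e3 : ∀ f : Bool × Bool,
        (a.ypos (sndY σ f) (u (σ.symm 0)) < a.ypos (sndY σ f) (u (σ.symm 1))) ↔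
        a.pos (sndY σ (f.1, false)) (a.rev (u (σ.symm 0)).1) false (decide (2 ≤ σ.symm 0)) <
          a.pos (sndY σ (f.1, false)) (a.rev (u (σ.symm 1)).1) false (decide (2 ≤ σ.symm 1)) :=
      fun f => by simp [ypos, q1, q2, ArcOrder.pos, sndY]
    have e4 : ∀ f : Bool × Bool,
        (a.ypos (sndY σ f) (u (σ.symm 2)) < a.ypos (sndY σ f) (u (σ.symm 3))) ↔
        a.pos (sndY σ (false, f.2)) (a.rev (u (σ.symm 2)).1) true (decide (2 ≤ σ.symm 2)) <
          a.pos (sndY σ (false, f.2)) (a.rev (u (σ.symm 3)).1) true (decide (2 ≤ σ.symm 3)) :=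
      fun f => by simp [ypos, q1, q2, ArcOrder.pos, sndY]
    simp only [e1, e2, e3, e4]
    simp only [implies_true, true_and, ind_and, Fintype.sum_prod_type, Fintype.sum_bool, sgn,
      Bool.false_eq_true, if_true, if_false]
    rw [← t1, ← t2, ← t3, ← t4]
    ring
  · rw [show ind _ = 0 from if_neg (fun h => hu h.1)]
    by_cases hq : ∀ q, ∃ j, (u j).2 = q
    · have : ∀ f g, ¬ a.IsOcc σ (sndX σ f) (sndY σ g) u := fun f g h =>
        hu (h.quad_eq a hq)
      simp [ind, this]
    · push Not at hq
      obtain ⟨⟨h, v⟩, hq⟩ := hq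
      have hc : ∀ f f', (∀ k, k ≠ h → sndX σ f k = sndX σ f' k) → ∀ g,
          (a.IsOcc σ (sndX σ f) (sndY σ g) u ↔ a.IsOcc σ (sndX σ f') (sndY σ g) u) := by
        intro f f' hs g
        unfold IsOcc
        simp only [fun j j' => a.xpos_lt_congr h v hs (hq j) (hq j')]
      cases h with
      | false =>
        have c1 := hc (true, true) (false, true) (by intro k hk; cases k <;> simp_all [sndX])
        have c2 := hc (true, false) (false, false) (by intro k hk; cases k <;> simp_all [sndX])
        simp only [Fintype.sum_prod_type, Fintype.sum_bool, sgn, c1, c2, if_true,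
          Bool.false_eq_true, if_false]
        ring
      | true =>
        have c1 := hc (true, true) (true, false) (by intro k hk; cases k <;> simp_all [sndX])
        have c2 := hc (false, true) (false, false) (by intro k hk; cases k <;> simp_all [sndX])
        simp only [Fintype.sum_prod_type, Fintype.sum_bool, sgn, c1, c2, if_true,
          Bool.false_eq_true, if_false]
        ring

/-- The signed sum of the pattern counts. -/
theorem sum_sgn_patternCount {σ : Equiv.Perm (Fin 4)} (hσ : SplitsEvenly σ) :
    ∑ f : Bool × Bool, ∑ g : Bool × Bool, sgn f * sgn g *
      (patternCount σ (a.perm (sndX σ f) (sndY σ g)) : ℤ)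
      = Nat.card {e : Fin 4 → Fin a.M // a.KeysAgree σ e} := by
  classical
  have e1 : ∀ f g, (patternCount σ (a.perm (sndX σ f) (sndY σ g)) : ℤ)
      = ∑ u : Fin 4 → a.Point, ind (a.IsOcc σ (sndX σ f) (sndY σ g) u) := by
    intro f g
    rw [patternCount_perm, sum_ind]
  simp only [e1, Finset.mul_sum]
  rw [Finset.sum_congr rfl (fun f _ => Finset.sum_comm), Finset.sum_comm]
  simp only [a.sum_sgn_isOcc hσ]
  rw [sum_ind]
  congr 1
  refine Nat.card_congr
    { toFun := fun u => ⟨fun j => (u.1 j).1, u.2.2⟩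
      invFun := fun e => ⟨fun j => (e.1 j, quad σ j), fun j => rfl, e.2⟩
      left_inv := fun u => Subtype.ext (funext fun j => Prod.ext rfl (u.2.1 j).symm)
      right_inv := fun e => rfl }

end ArcSystem


/-! ### Closed walks of length four -/

namespace SimpleGraph

variable {V : Type*} [Fintype V] (G : SimpleGraph V)

/-- A closed walk of length four is a 4-cycle, or it turns back at one of the two pairs of opposite
nodes. -/
theorem card_closedWalks_add :
    Nat.card {w : Fin 4 → V // ∀ t, G.Adj (w t) (w (t + 1))} + Nat.card {d : V × V // G.Adj d.1 d.2}
      = 8 * G.copyCount (cycleGraph 4)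
        + 2 * Nat.card {p : V × V × V // G.Adj p.1 p.2.1 ∧ G.Adj p.1 p.2.2} := by
  classical
  have adj4 : ∀ w : Fin 4 → V, (∀ t, G.Adj (w t) (w (t + 1))) ↔
      G.Adj (w 0) (w 1) ∧ G.Adj (w 1) (w 2) ∧ G.Adj (w 2) (w 3) ∧ G.Adj (w 3) (w 0) := by
    intro w
    rw [Fin.forall_fin_succ, Fin.forall_fin_succ, Fin.forall_fin_succ, Fin.forall_fin_succ]
    simp
  set H := Finset.univ.filter fun w : Fin 4 → V => ∀ t, G.Adj (w t) (w (t + 1)) with hH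
  have hcyc : Nat.card {v : Fin 4 → V // G.IsFourCycle v}
      = (H \ (H.filter (fun w => w 0 = w 2) ∪ H.filter fun w => w 1 = w 3)).card := by
    rw [Nat.card_eq_fintype_card, Fintype.card_subtype]
    congr 1
    ext w
    simp only [hH, IsFourCycle, Finset.mem_filter, Finset.mem_univ, true_and, Finset.mem_sdiff,
      Finset.mem_union, adj4]
    constructor
    · rintro ⟨h1, h2⟩
      refine ⟨h2, ?_⟩
      rintro (⟨-, h⟩ | ⟨-, h⟩)
      · exact absurd (h1 h) (by decide)
      · exact absurd (h1 h) (by decide)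
    · rintro ⟨h2, h1⟩
      refine ⟨?_, h2⟩
      have a1 := h2.1.ne
      have a2 := h2.2.1.ne
      have a3 := h2.2.2.1.ne
      have a4 := h2.2.2.2.ne
      intro i j hij
      fin_cases i <;> fin_cases j <;> simp_all
  have hA : (H.filter fun w => w 0 = w 2).card
      = Nat.card {p : V × V × V // G.Adj p.1 p.2.1 ∧ G.Adj p.1 p.2.2} := by
    rw [Nat.card_eq_fintype_card, Fintype.card_subtype]
    refine Finset.card_bij' (fun w _ => (w 0, w 1, w 3)) (fun p _ => ![p.1, p.2.1, p.1, p.2.2])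
      ?_ ?_ ?_ ?_
    · intro w hw
      simp only [hH, Finset.mem_filter, Finset.mem_univ, true_and, adj4] at hw ⊢
      exact ⟨hw.1.1, hw.1.2.2.2.symm⟩
    · rintro ⟨u, v, w⟩ hp
      simp only [hH, Finset.mem_filter, Finset.mem_univ, true_and, adj4] at hp ⊢
      simpa using ⟨hp.1, hp.1.symm, hp.2, hp.2.symm⟩
    · intro w hw
      simp only [Finset.mem_filter] at hw
      funext t; fin_cases t <;> simp [hw.2]
    · intro p hp; rfl
  have hB : (H.filter fun w => w 1 = w 3).card
      = Nat.card {p : V × V × V // G.Adj p.1 p.2.1 ∧ G.Adj p.1 p.2.2} := by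
    rw [Nat.card_eq_fintype_card, Fintype.card_subtype]
    refine Finset.card_bij' (fun w _ => (w 1, w 0, w 2)) (fun p _ => ![p.2.1, p.1, p.2.2, p.1])
      ?_ ?_ ?_ ?_
    · intro w hw
      simp only [hH, Finset.mem_filter, Finset.mem_univ, true_and, adj4] at hw ⊢
      exact ⟨hw.1.1.symm, hw.1.2.1⟩
    · rintro ⟨u, v, w⟩ hp
      simp only [hH, Finset.mem_filter, Finset.mem_univ, true_and, adj4] at hp ⊢
      simpa using ⟨hp.1.symm, hp.2, hp.2.symm, hp.1⟩
    · intro w hw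
      simp only [Finset.mem_filter] at hw
      funext t; fin_cases t <;> simp [hw.2]
    · intro p hp; rfl
  have hAB : (H.filter (fun w => w 0 = w 2) ∩ H.filter fun w => w 1 = w 3).card
      = Nat.card {d : V × V // G.Adj d.1 d.2} := by
    rw [Nat.card_eq_fintype_card, Fintype.card_subtype]
    refine Finset.card_bij' (fun w _ => (w 0, w 1)) (fun p _ => ![p.1, p.2, p.1, p.2])
      ?_ ?_ ?_ ?_
    · intro w hw
      simp only [hH, Finset.mem_filter, Finset.mem_univ, true_and, adj4, Finset.mem_inter] at hw ⊢
      exact hw.1.1.1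
    · rintro ⟨u, v⟩ hp
      simp only [hH, Finset.mem_filter, Finset.mem_univ, true_and, adj4, Finset.mem_inter] at hp ⊢
      simpa using ⟨hp, hp.symm, hp, hp.symm⟩
    · intro w hw
      simp only [Finset.mem_filter, Finset.mem_inter] at hw
      funext t; fin_cases t <;> simp [hw.1.2, hw.2.2]
    · intro p hp; rfl
  have hsub : H.filter (fun w => w 0 = w 2) ∪ H.filter (fun w => w 1 = w 3) ⊆ H :=
    Finset.union_subset (Finset.filter_subset _ _) (Finset.filter_subset _ _)
  have h1 := Finset.card_union_add_card_inter (H.filter fun w => w 0 = w 2)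
    (H.filter fun w => w 1 = w 3)
  have h2 := Finset.card_sdiff_add_card_eq_card hsub
  have h3 : Nat.card {w : Fin 4 → V // ∀ t, G.Adj (w t) (w (t + 1))} = H.card := by
    rw [Nat.card_eq_fintype_card, Fintype.card_subtype]
  rw [eight_mul_copyCount, hcyc, h3]
  omega

end SimpleGraph

/-! ### The arcs of an edge list -/

namespace EdgeListGraph

variable (x : EdgeListGraph)

/-- The arcs of the graph: every edge of the list, and after these every edge reversed. -/
def arcs : ArcSystem where
  M := 2 * x.edges.length
  src i := if i < x.edges.length then x.toMem.arr 0 i else x.toMem.arr 1 (i - x.edges.length)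
  rev i := (i + x.edges.length) % (2 * x.edges.length)
  rev_lt i hi := Nat.mod_lt _ (by omega)
  rev_rev i hi := by
    rcases lt_or_ge i x.edges.length with h | h
    · rw [Nat.mod_eq_of_lt (by omega : i + x.edges.length < 2 * x.edges.length),
        add_assoc, ← two_mul, Nat.add_mod_right, Nat.mod_eq_of_lt hi]
    · rw [Nat.mod_eq_sub_mod (by omega : 2 * x.edges.length ≤ i + x.edges.length),
        Nat.mod_eq_of_lt (by omega : i + x.edges.length - 2 * x.edges.length < _),
        show i + x.edges.length - 2 * x.edges.length + x.edges.length = i by omega,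
        Nat.mod_eq_of_lt hi]

theorem arcs_fst {i : ℕ} (h : i < x.edges.length) :
    x.arcs.src i = (x.edges[i]).1 ∧ x.arcs.src (x.arcs.rev i) = (x.edges[i]).2 := by
  have : x.arcs.rev i = i + x.edges.length := Nat.mod_eq_of_lt (by omega)
  rw [this]
  simp [arcs, h, toMem]

theorem arcs_snd {i : ℕ} (h : i < x.edges.length) :
    x.arcs.src (i + x.edges.length) = (x.edges[i]).2 ∧
      x.arcs.src (x.arcs.rev (i + x.edges.length)) = (x.edges[i]).1 := by
  have : x.arcs.rev (i + x.edges.length) = i := by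
    simp only [arcs]
    rw [add_assoc, ← two_mul, Nat.add_mod_right, Nat.mod_eq_of_lt (by omega)]
  rw [this]
  simp [arcs, h, toMem]

theorem mem_edges_adj {i : ℕ} (h : i < x.edges.length) :
    x.G.Adj (x.edges[i]).1 (x.edges[i]).2 := by
  have := (x.isEdgeList.2 s((x.edges[i]).1, (x.edges[i]).2)).1
    (List.mem_map.2 ⟨x.edges[i], List.getElem_mem h, rfl⟩)
  simpa using this

theorem edges_inj {i j : ℕ} (hi : i < x.edges.length) (hj : j < x.edges.length)
    (h : s((x.edges[i]).1, (x.edges[i]).2) = s((x.edges[j]).1, (x.edges[j]).2)) : i = j := by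
  have := x.isEdgeList.1
  refine (List.Nodup.getElem_inj_iff this (hi := by simpa using hi) (hj := by simpa using hj)).1 ?_
  simpa using h

/-- Every arc joins two adjacent nodes. -/
theorem exists_adj_of_arc {i : ℕ} (hi : i < x.arcs.M) : ∃ u v : Fin x.N,
    x.arcs.src i = u ∧ x.arcs.src (x.arcs.rev i) = v ∧ x.G.Adj u v := by
  rcases lt_or_ge i x.edges.length with h | h
  · exact ⟨_, _, (x.arcs_fst h).1, (x.arcs_fst h).2, x.mem_edges_adj h⟩
  · obtain ⟨j, rfl⟩ := Nat.exists_eq_add_of_le' h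
    have hj : j < x.edges.length := by simp only [arcs] at hi; omega
    exact ⟨_, _, (x.arcs_snd hj).1, (x.arcs_snd hj).2, (x.mem_edges_adj hj).symm⟩

/-- Any two adjacent nodes are joined by an arc. -/
theorem exists_arc_of_adj {u v : Fin x.N} (h : x.G.Adj u v) : ∃ i < x.arcs.M,
    x.arcs.src i = u ∧ x.arcs.src (x.arcs.rev i) = v := by
  have := (x.isEdgeList.2 s(u, v)).2 (by simpa using h)
  obtain ⟨e, he, hs⟩ := List.mem_map.1 this
  obtain ⟨i, hi, rfl⟩ := List.getElem_of_mem he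
  rcases Sym2.eq_iff.1 hs with ⟨h1, h2⟩ | ⟨h1, h2⟩
  · refine ⟨i, by simp only [arcs]; omega, ?_⟩
    rw [(x.arcs_fst hi).1, (x.arcs_fst hi).2, h1, h2]; exact ⟨rfl, rfl⟩
  · refine ⟨i + x.edges.length, by simp only [arcs]; omega, ?_⟩
    rw [(x.arcs_snd hi).1, (x.arcs_snd hi).2, h1, h2]; exact ⟨rfl, rfl⟩

/-- No two nodes are joined by two arcs. -/
theorem arc_unique {i j : ℕ} (hi : i < x.arcs.M) (hj : j < x.arcs.M)
    (h1 : x.arcs.src i = x.arcs.src j)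
    (h2 : x.arcs.src (x.arcs.rev i) = x.arcs.src (x.arcs.rev j)) : i = j := by
  have irr : ∀ k (hk : k < x.edges.length), ((x.edges[k]).1 : ℕ) ≠ (x.edges[k]).2 := fun k hk h =>
    (x.mem_edges_adj hk).ne (Fin.ext h)
  rcases lt_or_ge i x.edges.length with h | h <;> rcases lt_or_ge j x.edges.length with h' | h'
  · rw [(x.arcs_fst h).1, (x.arcs_fst h').1] at h1
    rw [(x.arcs_fst h).2, (x.arcs_fst h').2] at h2
    exact x.edges_inj h h' (by rw [Fin.ext h1, Fin.ext h2])
  · obtain ⟨k, rfl⟩ := Nat.exists_eq_add_of_le' h'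
    have hk : k < x.edges.length := by simp only [arcs] at hj; omega
    rw [(x.arcs_fst h).1, (x.arcs_snd hk).1] at h1
    rw [(x.arcs_fst h).2, (x.arcs_snd hk).2] at h2
    have e := x.edges_inj h hk (by rw [Fin.ext h1, Fin.ext h2, Sym2.eq_swap])
    subst e
    exact absurd h1 (irr i h)
  · obtain ⟨k, rfl⟩ := Nat.exists_eq_add_of_le' h
    have hk : k < x.edges.length := by simp only [arcs] at hi; omega
    rw [(x.arcs_fst h').1, (x.arcs_snd hk).1] at h1
    rw [(x.arcs_fst h').2, (x.arcs_snd hk).2] at h2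
    have e := x.edges_inj hk h' (by rw [Fin.ext h1, Fin.ext h2, Sym2.eq_swap])
    subst e
    exact absurd h2 (irr k h')
  · obtain ⟨k, rfl⟩ := Nat.exists_eq_add_of_le' h
    have hk : k < x.edges.length := by simp only [arcs] at hi; omega
    obtain ⟨l, rfl⟩ := Nat.exists_eq_add_of_le' h'
    have hl : l < x.edges.length := by simp only [arcs] at hj; omega
    rw [(x.arcs_snd hk).1, (x.arcs_snd hl).1] at h1
    rw [(x.arcs_snd hk).2, (x.arcs_snd hl).2] at h2
    rw [x.edges_inj hk hl (by rw [Fin.ext h1, Fin.ext h2])]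

/-- The arcs are the ordered pairs of adjacent nodes. -/
noncomputable def arcEquiv : Fin x.arcs.M ≃ {d : Fin x.N × Fin x.N // x.G.Adj d.1 d.2} :=
  Equiv.ofBijective
    (fun i => ⟨((x.exists_adj_of_arc i.2).choose, (x.exists_adj_of_arc i.2).choose_spec.choose),
      (x.exists_adj_of_arc i.2).choose_spec.choose_spec.2.2⟩) (by
    have h1 : ∀ i : Fin x.arcs.M, x.arcs.src i = ((x.exists_adj_of_arc i.2).choose : ℕ) :=
      fun i => (x.exists_adj_of_arc i.2).choose_spec.choose_spec.1
    have h2 : ∀ i : Fin x.arcs.M, x.arcs.src (x.arcs.rev i) =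
      ((x.exists_adj_of_arc i.2).choose_spec.choose : ℕ) :=
      fun i => (x.exists_adj_of_arc i.2).choose_spec.choose_spec.2.1
    refine ⟨fun i j h => ?_, fun d => ?_⟩
    · have h := Prod.ext_iff.1 (Subtype.ext_iff.1 h)
      refine Fin.ext (x.arc_unique i.2 j.2 ?_ ?_)
      · exact (h1 i).trans ((congrArg Fin.val h.1).trans (h1 j).symm)
      · exact (h2 i).trans ((congrArg Fin.val h.2).trans (h2 j).symm)
    · obtain ⟨i, hi, e1, e2⟩ := x.exists_arc_of_adj d.2
      refine ⟨⟨i, hi⟩, Subtype.ext (Prod.ext (Fin.ext ?_) (Fin.ext ?_))⟩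
      · rw [← e1]; exact (h1 ⟨i, hi⟩).symm
      · rw [← e2]; exact (h2 ⟨i, hi⟩).symm)

theorem src_eq (i : Fin x.arcs.M) : x.arcs.src i = ((x.arcEquiv i).1.1 : ℕ) :=
  (x.exists_adj_of_arc i.2).choose_spec.choose_spec.1

theorem src_rev_eq (i : Fin x.arcs.M) : x.arcs.src (x.arcs.rev i) = ((x.arcEquiv i).1.2 : ℕ) :=
  (x.exists_adj_of_arc i.2).choose_spec.choose_spec.2.1

theorem card_adj : Nat.card {d : Fin x.N × Fin x.N // x.G.Adj d.1 d.2} = 2 * x.edges.length := by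
  rw [Nat.card_congr x.arcEquiv.symm]
  simp [arcs]

theorem sum_deg : ∑ i ∈ Finset.range x.arcs.M, x.arcs.deg i
    = Nat.card {p : Fin x.N × Fin x.N × Fin x.N // x.G.Adj p.1 p.2.1 ∧ x.G.Adj p.1 p.2.2} := by
  have e : ∑ i ∈ Finset.range x.arcs.M, x.arcs.deg i
      = Nat.card {q : Fin x.arcs.M × Fin x.arcs.M // x.arcs.src q.2 = x.arcs.src q.1} := by
    rw [Nat.card_eq_fintype_card, Fintype.card_subtype, Finset.card_filter,
      Fintype.sum_prod_type, Finset.sum_range]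
    refine Finset.sum_congr rfl fun i _ => ?_
    rw [ArcOrder.deg, Finset.card_filter, Finset.sum_range]
  rw [e]
  refine Nat.card_congr
    { toFun := fun q => ⟨((x.arcEquiv q.1.1).1.1, (x.arcEquiv q.1.1).1.2, (x.arcEquiv q.1.2).1.2),
        (x.arcEquiv q.1.1).2, ?_⟩
      invFun := fun p => ⟨(x.arcEquiv.symm ⟨(p.1.1, p.1.2.1), p.2.1⟩,
        x.arcEquiv.symm ⟨(p.1.1, p.1.2.2), p.2.2⟩), ?_⟩
      left_inv := fun q => ?_
      right_inv := fun p => ?_ }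
  · have h := q.2
    rw [src_eq, src_eq] at h
    rw [← Fin.ext h]
    exact (x.arcEquiv q.1.2).2
  · simp [src_eq]
  · have h := q.2
    rw [src_eq, src_eq] at h
    refine Subtype.ext (Prod.ext ?_ ?_)
    · exact x.arcEquiv.symm_apply_apply q.1.1
    · rw [Equiv.symm_apply_eq]
      exact Subtype.ext (Prod.ext (Fin.ext h).symm rfl)
  · simp

/-- Four arcs whose keys agree in the way prescribed by an evenly splitting pattern are a closed
walk of length four. -/
theorem card_keysAgree {σ : Equiv.Perm (Fin 4)} (hσ : ArcSystem.SplitsEvenly σ) :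
    Nat.card {e : Fin 4 → Fin x.arcs.M // x.arcs.KeysAgree σ e}
      = Nat.card {w : Fin 4 → Fin x.N // ∀ t, x.G.Adj (w t) (w (t + 1))} := by
  have hkey : ∀ e, x.arcs.KeysAgree σ e → ∀ j,
      (x.arcEquiv (e j)).1.1 = (x.arcEquiv (e (if 2 ≤ j then 2 else 0))).1.1 ∧
      (x.arcEquiv (e j)).1.2 = (x.arcEquiv (e (σ.symm (if 2 ≤ σ j then 2 else 0)))).1.2 := by
    rintro e ⟨⟨h1, h2⟩, h3, h4⟩ j
    simp only [src_eq, src_rev_eq, Fin.val_inj] at h1 h2 h3 h4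
    constructor
    · fin_cases j <;> simp [h1, h2]
    · obtain ⟨r, rfl⟩ := σ.symm.surjective j
      fin_cases r <;> simp [h3, h4]
  have hsum : ∀ e, x.arcs.KeysAgree σ e → ∀ p q : Bool,
      x.G.Adj (x.arcEquiv (e (if p then 2 else 0))).1.1
        (x.arcEquiv (e (σ.symm (if q then 2 else 0)))).1.2 := by
    intro e he p q
    obtain ⟨j, hj⟩ := hσ (p, q)
    simp only [ArcSystem.quad, Prod.mk.injEq] at hj
    have := hkey e he j
    rw [show (if p then (2 : Fin 4) else 0) = if 2 ≤ j then 2 else 0 by rw [← hj.1]; simp,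
      show (if q then (2 : Fin 4) else 0) = if 2 ≤ σ j then 2 else 0 by rw [← hj.2]; simp,
      ← this.1, ← this.2]
    exact (x.arcEquiv (e j)).2
  refine Nat.card_eq_of_bijective (fun e => ⟨![(x.arcEquiv (e.1 0)).1.1,
    (x.arcEquiv (e.1 (σ.symm 0))).1.2, (x.arcEquiv (e.1 2)).1.1,
    (x.arcEquiv (e.1 (σ.symm 2))).1.2], ?_⟩) ⟨?_, ?_⟩
  · have a1 := hsum e.1 e.2 false false
    have a2 := (hsum e.1 e.2 true false).symm
    have a3 := hsum e.1 e.2 true true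
    have a4 := (hsum e.1 e.2 false true).symm
    simp only [Bool.false_eq_true, if_false, if_true] at a1 a2 a3 a4
    intro t
    fin_cases t
    exacts [a1, a2, a3, a4]
  · intro e e' h
    have h := Subtype.ext_iff.1 h
    have h0 := congrFun h 0
    have h1 := congrFun h 1
    have h2 := congrFun h 2
    have h3 := congrFun h 3
    simp at h0 h1 h2 h3
    refine Subtype.ext (funext fun j => x.arcEquiv.injective (Subtype.ext (Prod.ext ?_ ?_)))
    · rw [(hkey e.1 e.2 j).1, (hkey e'.1 e'.2 j).1]
      split_ifs <;> assumption
    · rw [(hkey e.1 e.2 j).2, (hkey e'.1 e'.2 j).2]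
      split_ifs <;> assumption
  · intro w
    have hw : ∀ p q : Bool, x.G.Adj (w.1 (if p then 2 else 0)) (w.1 (if q then 3 else 1)) := by
      intro p q
      cases p <;> cases q
      exacts [w.2 0, (w.2 3).symm, (w.2 1).symm, w.2 2]
    set e : Fin 4 → Fin x.arcs.M := fun j => x.arcEquiv.symm
      ⟨(w.1 (if decide (2 ≤ j) then 2 else 0), w.1 (if decide (2 ≤ σ j) then 3 else 1)),
        hw (decide (2 ≤ j)) (decide (2 ≤ σ j))⟩ with he
    have v : ∀ j, (x.arcEquiv (e j)).1 = (w.1 (if 2 ≤ j then 2 else 0),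
        w.1 (if 2 ≤ σ j then 3 else 1)) := fun j => by simp [he]
    refine ⟨⟨e, ?_⟩, ?_⟩
    · simp [ArcSystem.KeysAgree, src_eq, src_rev_eq, v]
    · refine Subtype.ext (funext fun t => ?_)
      fin_cases t <;> simp [v]

/-- The number of 4-cycles in terms of pattern counts. -/
theorem sum_sgn_patternCount_arcs {σ : Equiv.Perm (Fin 4)} (hσ : ArcSystem.SplitsEvenly σ) :
    ∑ f : Bool × Bool, ∑ g : Bool × Bool, ArcSystem.sgn f * ArcSystem.sgn g *
      (patternCount σ (x.arcs.perm (ArcSystem.sndX σ f) (ArcSystem.sndY σ g)) : ℤ)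
      = 8 * (x.G.copyCount (SimpleGraph.cycleGraph 4) : ℤ)
        + 2 * ∑ i ∈ Finset.range x.arcs.M, (x.arcs.deg i : ℤ) - 2 * x.edges.length := by
  rw [x.arcs.sum_sgn_patternCount hσ, x.card_keysAgree hσ]
  have h := x.G.card_closedWalks_add
  rw [x.card_adj, ← x.sum_deg] at h
  zify at h
  linarith

end EdgeListGraph

/-- With one point in each region, two of the four points lie on either side of each line. So the
lines separate the first two positions from the last two, and likewise for the values. -/
theorem IsNontrivialPattern.splitsEvenly {σ : Equiv.Perm (Fin 4)} (hσ : IsNontrivialPattern σ) :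
    ArcSystem.SplitsEvenly σ := by
  obtain ⟨n, π, i, v, h, hocc, hne, htl, htr, hbl, hbr⟩ := hσ
  classical
  -- the quadrant of a point of the occurrence
  let q : Fin 4 → Bool × Bool := fun j =>
    (decide (v < ((i j : ℕ) : ℝ)), decide (h < ((π (i j) : ℕ) : ℝ)))
  have hq : ∀ p, ∃ j, q j = p := by
    rintro ⟨_ | _, _ | _⟩
    · obtain ⟨j, hj, -⟩ := hbl; exact ⟨j, by simp [q, hj.1.le, hj.2.le]⟩
    · obtain ⟨j, hj, -⟩ := htl; exact ⟨j, by simp [q, hj.1.le, hj.2]⟩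
    · obtain ⟨j, hj, -⟩ := hbr; exact ⟨j, by simp [q, hj.1, hj.2.le]⟩
    · obtain ⟨j, hj, -⟩ := htr; exact ⟨j, by simp [q, hj.1, hj.2]⟩
  have h1 : ∀ j, (q j).1 = decide (2 ≤ j) :=
    ArcSystem.quad_eq_of_monotone q hq fun j j' hj ht => by
      simp only [q, decide_eq_true_eq] at ht ⊢
      refine ht.trans ?_
      exact_mod_cast i.lt_iff_lt.2 hj
  have h2 : ∀ r, (q (σ.symm r)).2 = decide (2 ≤ r) := by
    refine ArcSystem.quad_eq_of_monotone (fun r => ((q (σ.symm r)).2, (q (σ.symm r)).1))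
      (fun p => ?_) fun r r' hr ht => ?_
    · obtain ⟨j, hj⟩ := hq (p.2, p.1)
      exact ⟨σ j, by simp [hj]⟩
    · simp only [q, decide_eq_true_eq] at ht ⊢
      refine ht.trans ?_
      have := (hocc (σ.symm r) (σ.symm r')).1 (by simpa using hr)
      exact_mod_cast this
  intro p
  obtain ⟨j, hj⟩ := hq p
  refine ⟨j, ?_⟩
  rw [← hj]
  have := h2 (σ j)
  rw [σ.symm_apply_apply] at this
  exact Prod.ext (h1 j).symm this.symm

theorem ArcSystem.SplitsEvenly.ne_one {σ : Equiv.Perm (Fin 4)} (hσ : ArcSystem.SplitsEvenly σ) :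
    σ ≠ 1 := by
  rintro rfl
  revert hσ
  decide


/-! ### Counting 4-cycles with an algorithm that counts patterns -/

namespace WCmd

/-- The programs `c 0, …, c (n - 1)`, one after the other. -/
def iter (c : ℕ → WCmd) : ℕ → WCmd
  | 0 => skip
  | n + 1 => seq (iter c n) (c n)

theorem wp_seq {ρ : ℕ → ℕ} {CallOk : MemState → ℕ → Prop} {c d : WCmd} {R Q : MemState → Prop}
    {s : MemState} (hc : c.wp ρ CallOk R s)
    (hd : ∀ s', R s' → Frame c s s' → d.wp ρ CallOk Q s') : (seq c d).wp ρ CallOk Q s :=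
  wp_mono c (fun s' hs => hd s' hs.1 hs.2) s (wp_frame c s hc)

theorem wp_iter {ρ : ℕ → ℕ} {CallOk : MemState → ℕ → Prop} {c : ℕ → WCmd} {n : ℕ}
    (I : ℕ → MemState → Prop) (h : ∀ k < n, ∀ s, I k s → (c k).wp ρ CallOk (I (k + 1)) s)
    (s : MemState) (h0 : I 0 s) : (iter c n).wp ρ CallOk (I n) s := by
  induction n with
  | zero => exact h0
  | succ n ih =>
    exact wp_mono _ (fun s hs => h n (Nat.lt_succ_self n) s hs) _
      (ih fun k hk => h k (by omega))

theorem cost_iter (ρ : ℕ → ℕ) (u T : ℕ) (c : ℕ → WCmd) (n : ℕ) :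
    (iter c n).cost ρ u T = ∑ i ∈ Finset.range n, (c i).cost ρ u T := by
  induction n with
  | zero => rfl
  | succ n ih => rw [Finset.sum_range_succ, ← ih]; rfl

end WCmd

theorem Finset.card_filter_range_succ (p : ℕ → Prop) [DecidablePred p] (k : ℕ) :
    ((Finset.range (k + 1)).filter p).card
      = ((Finset.range k).filter p).card + if p k then 1 else 0 := by
  rw [Finset.range_add_one, Finset.filter_insert]
  split_ifs with h
  · rw [Finset.card_insert_of_notMem (by simp)]
  · rfl

namespace ArcOrder

/-- The number of arcs below `k` with source `v`. -/
def cnt (a : ArcOrder) (v k : ℕ) : ℕ := ((Finset.range k).filter fun j => a.src j = v).card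

theorem cnt_succ (a : ArcOrder) (v k : ℕ) :
    a.cnt v (k + 1) = a.cnt v k + if a.src k = v then 1 else 0 :=
  Finset.card_filter_range_succ _ _

theorem cnt_le (a : ArcOrder) (v k : ℕ) : a.cnt v k ≤ k :=
  (Finset.card_filter_le _ _).trans (by simp)

/-- The number of arcs whose group starts below `k`. -/
def run (a : ArcOrder) (k : ℕ) : ℕ := ((Finset.range a.M).filter fun j => a.first j < k).card

theorem run_le (a : ArcOrder) (k : ℕ) : a.run k ≤ a.M :=
  (Finset.card_filter_le _ _).trans (by simp)

theorem deg_le (a : ArcOrder) (k : ℕ) : a.deg k ≤ a.M := a.cnt_le _ _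

theorem first_first (a : ArcOrder) (j : ℕ) : a.first (a.first j) = a.first j :=
  a.first_congr (a.src_first j)

theorem first_eq_self (a : ArcOrder) {k : ℕ} (h : ∀ j < k, a.src j ≠ a.src k) : a.first k = k := by
  by_contra hk
  exact h _ (lt_of_le_of_ne (a.first_le k) hk) (a.src_first k)

theorem run_succ_of_new (a : ArcOrder) {k : ℕ} (h : ∀ j < k, a.src j ≠ a.src k) :
    a.run (k + 1) = a.run k + a.deg k := by
  have hk := a.first_eq_self h
  unfold run deg
  rw [← Finset.card_union_of_disjoint]
  · congr 1
    ext j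
    have : a.src j = a.src k ↔ a.first j = k := by rw [← a.first_eq_iff, hk]
    simp only [Finset.mem_filter, Finset.mem_union, this, Nat.lt_succ_iff_lt_or_eq, and_or_left]
  · rw [Finset.disjoint_left]
    intro j hj hj'
    simp only [Finset.mem_filter] at hj hj'
    have := a.first_eq_iff.2 hj'.2
    omega

theorem run_succ_of_old (a : ArcOrder) {j k : ℕ} (hj : j < k) (h : a.src j = a.src k) :
    a.run (k + 1) = a.run k := by
  unfold run
  congr 1
  refine Finset.filter_congr fun i _ => ?_
  have : a.first i ≠ k := fun hi => by
    have h1 := a.first_first i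
    rw [hi, ← a.first_congr h] at h1
    have := a.first_le j
    omega
  omega

theorem off_eq_run (a : ArcOrder) {k : ℕ} (h : ∀ j < k, a.src j ≠ a.src k) : a.off k = a.run k := by
  unfold off run
  rw [a.first_eq_self h]

end ArcOrder

namespace FourCycleReduction

open WCmd WExpr

/-- Computes the sources (array `4`) of the arcs and the degrees (array `5`) of the nodes. -/
def arcLoop : WCmd :=
  .seq (.assign 6 (.bin .add (.var 0) (.var 0)))
    (.loop 5 6 (.seq
      (.ite (.bin .lt (.var 5) (.var 0)) (.store 4 (.var 5) (.get 0 (.var 5)))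
        (.store 4 (.var 5) (.get 1 (.bin .sub (.var 5) (.var 0)))))
      (.store 5 (.get 4 (.var 5)) (.mods (.bin .add (.get 5 (.get 4 (.var 5))) (.lit 1))
        (.var 6)))))

/-- Enters the arc in register `5` into the sorted order, once its group has a position: the array
`8` receives `ArcOrder.rho + ArcOrder.off`, the array `9` receives `ArcOrder.deg`. -/
def sortTail : WCmd :=
  .seq (.store 8 (.var 5) (.bin .add (.bin .add (.bin .sub (.get 6 (.get 4 (.var 5))) (.lit 1))
      (.get 7 (.get 4 (.var 5)))) (.bin .sub (.get 6 (.get 4 (.var 5))) (.lit 1))))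
    (.seq (.store 7 (.get 4 (.var 5)) (.mods (.bin .add (.get 7 (.get 4 (.var 5))) (.lit 1))
      (.var 6)))
    (.seq (.store 9 (.var 5) (.get 5 (.get 4 (.var 5))))
      (.assign 8 (.mods (.bin .add (.var 8) (.get 5 (.get 4 (.var 5))))
        (.bin .mul (.var 6) (.var 6))))))

/-- Computes the positions of the arcs. For a node `v`, the cell `6` holds `off + 1` as soon as an
arc at `v` has been met, and the cell `7` counts the arcs at `v`; the register `7` holds the total
degree of the nodes that have been met, the register `8` the sum of the degrees of the arcs. -/
def sortLoop : WCmd :=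
  .loop 5 6 (.seq
    (.ite (.get 6 (.get 4 (.var 5))) .skip
      (.seq (.store 6 (.get 4 (.var 5)) (.bin .add (.var 7) (.lit 1)))
        (.assign 7 (.mods (.bin .add (.var 7) (.get 5 (.get 4 (.var 5)))) (.var 6)))))
    sortTail)

/-- The expression for `ArcOrder.pos`. -/
def posExpr (second : Bool → Bool) (e : WExpr) (h v : Bool) : WExpr :=
  .bin .add (.bin .add (.bin .mul (.lit (2 * h.toNat)) (.var 6)) (.get 8 e))
    (.bin .mul (.lit (if second h = v then 1 else 0)) (.get 9 e))

/-- Enters the point of the arc in register `5` that lies in the quadrant `(h, v)`. -/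
def storePoint (sx sy : Bool → Bool) (h v : Bool) : WCmd :=
  .store 2 (posExpr sx (.var 5) h v)
    (posExpr sy (.bin .mod (.bin .add (.var 5) (.var 0)) (.var 6)) v h)

/-- Writes down a permutation and counts the pattern in it. -/
def countOne (sx sy : Bool → Bool) (r : ℕ) : WCmd :=
  .seq (.loop 5 6 (.seq (storePoint sx sy false false) (.seq (storePoint sx sy false true)
      (.seq (storePoint sx sy true false) (storePoint sx sy true true)))))
    (.seq (.assign 1 (.bin .mul (.lit 4) (.var 6))) (.seq .call (.assign r (.var 3))))

/-- The `n`-th pair of flips. -/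
def flips (n : ℕ) : (Bool × Bool) × (Bool × Bool) :=
  ((n.testBit 0, n.testBit 1), (n.testBit 2, n.testBit 3))

/-- The sum of the registers in a list. -/
def sumRegs : List ℕ → WExpr
  | [] => .lit 0
  | r :: l => .bin .add (.var r) (sumRegs l)

/-- The registers with the counts of positive sign. -/
def posRegs : List ℕ := [20, 23, 25, 26, 29, 30, 32, 35]

/-- The registers with the counts of negative sign. -/
def negRegs : List ℕ := [21, 22, 24, 27, 28, 31, 33, 34]

/-- Counts 4-cycles by sixteen calls of a subroutine that counts a pattern.

The number of arcs is in the register `6`, and the array `2` takes the permutation for a call. The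
results are kept in the registers from `20` on. Their signed sum is the number of closed walks of
length four; subtracting those that are no 4-cycles leaves eight times the result. -/
def program (σ : Equiv.Perm (Fin 4)) : WCmd :=
  .seq arcLoop (.seq sortLoop (.seq
    (.iter (fun n => countOne (ArcSystem.sndX σ (flips n).1) (ArcSystem.sndY σ (flips n).2)
      (20 + n)) 16)
    (.assign 4 (.bin .div (.bin .sub (.bin .add (sumRegs posRegs) (.var 6))
      (.bin .add (sumRegs negRegs) (.bin .mul (.lit 2) (.var 8)))) (.lit 8)))))

/-- Degree bounds for the registers. -/
def Γ (r : ℕ) : ℕ :=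
  if r = 3 then 16 else if 20 ≤ r then 16 else [1, 5, 0, 16, 40, 2, 2, 2, 4].getD r 0

/-- Degree bounds for the arrays. -/
def Δ (A : ℕ) : ℕ := [1, 1, 16, 0, 1, 2, 3, 2, 6, 2].getD A 0

theorem chk_program (σ : Equiv.Perm (Fin 4)) : (program σ).chk Γ Δ 50 = true := by
  revert σ
  decide +kernel

variable {ρ : ℕ → ℕ} {CallOk : MemState → ℕ → Prop}

theorem arcLoop_wp (x : EdgeListGraph) (s : MemState) (hρ : 2 * x.edges.length ≤ ρ 6)
    (hm : s.reg 0 = x.edges.length) (h0 : s.arr 0 = x.toMem.arr 0) (h1 : s.arr 1 = x.toMem.arr 1)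
    (h5 : ∀ v, s.arr 5 v = 0) :
    arcLoop.wp ρ CallOk (fun s' => s'.reg 6 = x.arcs.M ∧
      (∀ i < x.arcs.M, s'.arr 4 i = x.arcs.src i) ∧ ∀ v, s'.arr 5 v = x.arcs.cnt v x.arcs.M) s := by
  have hM : x.arcs.M = 2 * x.edges.length := rfl
  simp only [arcLoop, wp, eval, WordOp.eval, MemState.setReg_reg_self]
  refine ⟨by omega, fun k s' => (∀ i < k, s'.arr 4 i = x.arcs.src i) ∧
    ∀ v, s'.arr 5 v = x.arcs.cnt v k, ?_, ?_, ?_⟩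
  · simp [ArcOrder.cnt, h5]
  · rintro k s' hk hf ⟨i1, i2⟩
    have r0 : s'.reg 0 = x.edges.length := by
      rw [hf.1 0 (by simp [wr])]; simpa [MemState.setReg_reg] using hm
    have r6 : s'.reg 6 = x.arcs.M := by
      rw [hf.1 6 (by simp [wr])]; simp [hm, hM, two_mul]
    have a0 : s'.arr 0 = x.toMem.arr 0 := by rw [hf.2 0 (by simp [wa])]; exact h0
    have a1 : s'.arr 1 = x.toMem.arr 1 := by rw [hf.2 1 (by simp [wa])]; exact h1
    have step : ∀ s1 : MemState, s1.reg 5 = k → s1.reg 6 = x.arcs.M → s1.arr 5 = s'.arr 5 →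
        (∀ i, s1.arr 4 i = if i = k then x.arcs.src k else s'.arr 4 i) →
        (∀ i < k + 1, (s1.setCell 5 (s1.arr 4 (s1.reg 5))
          ((s1.arr 5 (s1.arr 4 (s1.reg 5)) + 1) % (s1.reg 6 + 1))).arr 4 i = x.arcs.src i) ∧
        ∀ v, (s1.setCell 5 (s1.arr 4 (s1.reg 5))
          ((s1.arr 5 (s1.arr 4 (s1.reg 5)) + 1) % (s1.reg 6 + 1))).arr 5 v
            = x.arcs.cnt v (k + 1) := by
      intro s1 e5 e6 ea5 ea4
      refine ⟨fun i hi => ?_, fun v => ?_⟩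
      · rw [MemState.setCell_arr_of_ne _ _ _ (by norm_num), ea4]
        split_ifs with h
        · rw [h]
        · exact i1 i (by omega)
      · have hc : x.arcs.cnt (x.arcs.src k) k < x.arcs.M := by
          have := x.arcs.cnt_le (x.arcs.src k) k
          omega
        rw [MemState.setCell_arr, ea4, e5, e6, ea5, i2, i2, ArcOrder.cnt_succ]
        simp only [if_true, true_and]
        by_cases hv : v = x.arcs.src k
        · subst hv
          rw [if_pos rfl, if_pos rfl, Nat.mod_eq_of_lt (by omega)]
        · rw [if_neg hv, if_neg (Ne.symm hv)]; simp
    simp only [MemState.setReg_arr, MemState.setReg_reg_of_ne _ _ (show 0 ≠ 5 by norm_num), r0,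
      ne_eq, ite_eq_right_iff, one_ne_zero, imp_false, not_lt]
    constructor
    · intro hlt
      refine step _ (by simp) (by simp [MemState.setReg_reg, r6]) ?_ fun i => ?_
      · simp [MemState.setCell_arr_of_ne]
      · simp [MemState.setCell_arr, EdgeListGraph.arcs, not_le.1 hlt, a0]
    · intro hlt
      refine step _ (by simp) (by simp [MemState.setReg_reg, r6]) ?_ fun i => ?_
      · simp [MemState.setCell_arr_of_ne]
      · simp [MemState.setCell_arr, EdgeListGraph.arcs, not_lt.2 hlt, a1]
  · rintro s' hf ⟨i1, i2⟩
    have r6 : s'.reg 6 = x.arcs.M := by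
      rw [hf.1 6 (by simp [wr])]; simp [hm, hM, two_mul]
    have e : s.reg 0 + s.reg 0 = x.arcs.M := by omega
    simp only [MemState.setReg_arr, e] at i1 i2 ⊢
    refine ⟨?_, i1, i2⟩
    rw [MemState.setReg_reg_of_ne _ _ (by norm_num), r6]

/-- The state of the sorting loop when `k` arcs have been entered. -/
structure SortInv (a : ArcOrder) (k : ℕ) (s : MemState) : Prop where
  run : s.reg 7 = a.run k
  sum : s.reg 8 = ∑ i ∈ Finset.range k, a.deg i
  off : ∀ j < k, s.arr 6 (a.src j) = a.off j + 1
  new : ∀ v, (∀ j < k, a.src j ≠ v) → s.arr 6 v = 0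
  cnt : ∀ v, s.arr 7 v = a.cnt v k
  pos : ∀ i < k, s.arr 8 i = a.rho i + a.off i ∧ s.arr 9 i = a.deg i

theorem sortTail_wp {a : ArcOrder} {k : ℕ} {s' s1 : MemState} (hk : k < a.M) (h : SortInv a k s')
    (b4 : s'.arr 4 k = a.src k) (b5 : ∀ v, s'.arr 5 v = a.cnt v a.M)
    (e5 : s1.reg 5 = k) (e6 : s1.reg 6 = a.M) (e7 : s1.reg 7 = a.run (k + 1))
    (e8 : s1.reg 8 = s'.reg 8) (eA : ∀ A, A ≠ 6 → s1.arr A = s'.arr A)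
    (e6k : s1.arr 6 (a.src k) = a.off k + 1) (e6v : ∀ v, v ≠ a.src k → s1.arr 6 v = s'.arr 6 v) :
    sortTail.wp ρ CallOk (SortInv a (k + 1)) s1 := by
  obtain ⟨i7, i8, j6, k6, j7, j89⟩ := h
  have hdeg : a.cnt (a.src k) a.M = a.deg k := rfl
  have c4 : s1.arr 4 k = a.src k := by rw [eA 4 (by norm_num), b4]
  have c7 : ∀ v, s1.arr 7 v = a.cnt v k := fun v => by rw [eA 7 (by norm_num), j7]
  have hsum : (∑ i ∈ Finset.range k, a.deg i) + a.deg k < a.M * a.M + 1 := by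
    rw [← Finset.sum_range_succ]
    calc ∑ i ∈ Finset.range (k + 1), a.deg i ≤ ∑ i ∈ Finset.range (k + 1), a.M :=
          Finset.sum_le_sum fun i _ => a.deg_le i
      _ = (k + 1) * a.M := by simp
      _ < _ := Nat.lt_succ_of_le (Nat.mul_le_mul_right _ hk)
  unfold sortTail
  simp only [wp, eval, WordOp.eval, e5]
  simp only [MemState.setCell_reg, e5, e6, e8, c4, i8, e6k, c7,
    MemState.setCell_arr_of_ne _ _ _ (show 4 ≠ 8 by norm_num),
    MemState.setCell_arr_of_ne _ _ _ (show 4 ≠ 7 by norm_num),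
    MemState.setCell_arr_of_ne _ _ _ (show 4 ≠ 9 by norm_num),
    MemState.setCell_arr_of_ne _ _ _ (show 5 ≠ 8 by norm_num),
    MemState.setCell_arr_of_ne _ _ _ (show 5 ≠ 7 by norm_num),
    MemState.setCell_arr_of_ne _ _ _ (show 5 ≠ 9 by norm_num),
    MemState.setCell_arr_of_ne _ _ _ (show 7 ≠ 8 by norm_num),
    eA 5 (by norm_num), b5, hdeg, Nat.mod_eq_of_lt hsum]
  refine ⟨?_, ?_, fun j hj => ?_, fun v hv => ?_, fun v => ?_, fun i hi => ?_⟩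
  · rw [MemState.setReg_reg_of_ne _ _ (by norm_num)]; exact e7
  · rw [MemState.setReg_reg_self, Finset.sum_range_succ]
  · simp only [MemState.setReg_arr, MemState.setCell_arr]
    norm_num
    by_cases h : a.src j = a.src k
    · rw [h, e6k, a.off_congr h]
    · rw [e6v _ h, j6 j (lt_of_le_of_ne (Nat.lt_succ_iff.1 hj) (by rintro rfl; exact h rfl))]
  · simp only [MemState.setReg_arr, MemState.setCell_arr]
    norm_num
    rw [e6v _ (hv k (by omega)).symm]
    exact k6 v fun j hj => hv j (by omega)
  · have h1 := a.cnt_le (a.src k) k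
    simp only [MemState.setReg_arr, MemState.setCell_arr, ArcOrder.cnt_succ]
    norm_num
    by_cases h : v = a.src k
    · rw [if_pos h, if_pos h.symm, Nat.mod_eq_of_lt (by omega), h]
    · rw [if_neg h, if_neg (Ne.symm h), c7]; rfl
  · simp only [MemState.setReg_arr, MemState.setCell_arr]
    norm_num
    by_cases h : i = k
    · subst h
      simp only [if_true, and_true]
      unfold ArcOrder.rho ArcOrder.cnt
      omega
    · rw [if_neg h, if_neg h, eA 8 (by norm_num), eA 9 (by norm_num)]
      exact j89 i (by omega)

theorem sortLoop_wp (a : ArcOrder) (s : MemState) (hρ : a.M ≤ ρ 6) (h6 : s.reg 6 = a.M)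
    (h7 : s.reg 7 = 0) (h8 : s.reg 8 = 0) (a4 : ∀ i < a.M, s.arr 4 i = a.src i)
    (a5 : ∀ v, s.arr 5 v = a.cnt v a.M) (a6 : ∀ v, s.arr 6 v = 0) (a7 : ∀ v, s.arr 7 v = 0) :
    sortLoop.wp ρ CallOk (fun s' => s'.reg 8 = ∑ i ∈ Finset.range a.M, a.deg i ∧
      ∀ i < a.M, s'.arr 8 i = a.rho i + a.off i ∧ s'.arr 9 i = a.deg i) s := by
  unfold sortLoop
  refine ⟨by omega, SortInv a, ?_, ?_, ?_⟩
  · constructor <;> simp [ArcOrder.run, ArcOrder.cnt, h7, h8, a6, a7]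
  · rintro k s' hk hf h
    rw [h6] at hk
    have r6 : s'.reg 6 = a.M := by rw [hf.1 6 (by simp [wr, sortTail])]; exact h6
    have b4 : s'.arr 4 k = a.src k := by rw [hf.2 4 (by simp [wa, sortTail])]; exact a4 k hk
    have b5 : ∀ v, s'.arr 5 v = a.cnt v a.M := fun v => by
      rw [hf.2 5 (by simp [wa, sortTail])]; exact a5 v
    have hdeg : a.cnt (a.src k) a.M = a.deg k := rfl
    have i7 := h.run
    simp only [wp, eval, WordOp.eval, MemState.setReg_reg_self, MemState.setReg_arr, b4]
    constructor
    · intro h0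
      have hold : ∃ j < k, a.src j = a.src k := by
        by_contra hn
        push Not at hn
        exact h0 (h.new _ hn)
      obtain ⟨j, hj, hjs⟩ := hold
      refine sortTail_wp hk h b4 b5 (by simp) (by simp [MemState.setReg_reg, r6]) ?_
        (by simp [MemState.setReg_reg]) (fun A _ => rfl) ?_ (fun _ _ => rfl)
      · rw [a.run_succ_of_old hj hjs, MemState.setReg_reg_of_ne _ _ (by norm_num), i7]
      · rw [MemState.setReg_arr, ← hjs, h.off j hj, a.off_congr hjs]
    · intro h0
      have hnew : ∀ j < k, a.src j ≠ a.src k := fun j hj hs => by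
        rw [← hs, h.off j hj] at h0; omega
      have h1 := a.run_succ_of_new hnew
      have h2 := a.run_le (k + 1)
      refine sortTail_wp hk h b4 b5 ?_ ?_ ?_ ?_ (fun A hA => ?_) ?_ fun v hv => ?_
      · simp [MemState.setReg_reg]
      · simp [MemState.setReg_reg, r6]
      · simp only [MemState.setReg_reg, MemState.setCell_arr, MemState.setCell_reg, r6, i7]
        norm_num
        rw [b4, b5, hdeg, Nat.mod_eq_of_lt (by omega), h1]
      · simp [MemState.setReg_reg]
      · simp [MemState.setCell_arr_of_ne _ _ _ hA]
      · simp [MemState.setReg_reg, MemState.setCell_arr, i7, a.off_eq_run hnew]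
      · simp [MemState.setCell_arr, hv]
  · rintro s' hf h
    rw [h6] at h ⊢
    exact ⟨by rw [MemState.setReg_reg_of_ne _ _ (by norm_num)]; exact h.sum, h.pos⟩

end FourCycleReduction


namespace FourCycleReduction

open WCmd WExpr

variable {ρ : ℕ → ℕ} {CallOk : MemState → ℕ → Prop}

/-- The data of the sorted arcs are in place. -/
structure Sorted (x : EdgeListGraph) (s : MemState) : Prop where
  size : s.reg 0 = x.edges.length
  zero : s.reg 2 = 0
  arcs : s.reg 6 = x.arcs.M
  free : ∀ v, s.arr 3 v = 0
  pos : ∀ i < x.arcs.M, s.arr 8 i = x.arcs.rho i + x.arcs.off i ∧ s.arr 9 i = x.arcs.deg i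

theorem posExpr_eval {x : EdgeListGraph} {s : MemState} (hs : Sorted x s) {e : WExpr}
    (he : e.eval s < x.arcs.M) (second : Bool → Bool) (h v : Bool) :
    (posExpr second e h v).eval s = x.arcs.pos second (e.eval s) h v := by
  simp only [posExpr, eval, WordOp.eval, hs.arcs, (hs.pos _ he).1, (hs.pos _ he).2, ArcOrder.pos]
  split_ifs <;> ring

theorem storePoint_wp {x : EdgeListGraph} {s : MemState} (hs : Sorted x s) (sx sy : Bool → Bool)
    (h v : Bool) {k : Fin x.arcs.M} (hk : s.reg 5 = k) {U : Set x.arcs.Point}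
    (hU : ∀ u ∈ U, s.arr 2 (x.arcs.xpos sx u) = x.arcs.ypos sy u) :
    (storePoint sx sy h v).wp ρ CallOk (fun s' => s'.reg = s.reg ∧ Sorted x s' ∧
      ∀ u ∈ insert (k, h, v) U, s'.arr 2 (x.arcs.xpos sx u) = x.arcs.ypos sy u) s := by
  have hr : (WExpr.bin .mod (.bin .add (.var 5) (.var 0)) (.var 6)).eval s = x.arcs.rev k := by
    simp [eval, WordOp.eval, hk, hs.size, hs.arcs, EdgeListGraph.arcs]
  have e1 := posExpr_eval hs (e := .var 5) (by simp [eval, hk]) sx h v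
  have e2 := posExpr_eval hs (by rw [hr]; exact x.arcs.rev_lt _ k.2) sy v h
  rw [hr] at e2
  simp only [eval, hk] at e1
  simp only [storePoint, wp, e1, e2, MemState.setCell_reg, true_and]
  refine ⟨⟨hs.size, hs.zero, hs.arcs, ?_, ?_⟩, fun u hu => ?_⟩
  · simpa [MemState.setCell_arr_of_ne] using hs.free
  · simpa [MemState.setCell_arr_of_ne] using hs.pos
  · rw [MemState.setCell_arr]
    simp only [true_and]
    split_ifs with hp
    · have := x.arcs.pos_injective u.1.2 k.2 hp
      rw [show u = (k, h, v) from Prod.ext (Fin.ext this.1) (Prod.ext this.2.1 this.2.2)]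
      rfl
    · rcases hu with rfl | hu
      · exact absurd rfl hp
      · exact hU u hu

theorem patternCount_le {n : ℕ} (σ : Equiv.Perm (Fin 4)) (π : Equiv.Perm (Fin n)) :
    patternCount σ π ≤ n ^ 4 := by
  unfold patternCount
  calc Nat.card {i : Fin 4 ↪o Fin n // IsOccurrence σ π i} ≤ Nat.card (Fin 4 → Fin n) :=
        Nat.card_le_card_of_injective (fun i => (i.1 : Fin 4 → Fin n))
          fun i j h => Subtype.ext (DFunLike.coe_injective h)
    _ = n ^ 4 := by simp

/-- A permutation in the array `2` may be handed to a subroutine that counts patterns. -/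
theorem patternProblem_callOk {σ : Equiv.Perm (Fin 4)} {n X Y V : ℕ} {s : MemState}
    (π : Equiv.Perm (Fin n)) (h1 : s.reg 1 = n) (h2 : s.reg 2 = 0) (h3 : ∀ v, s.arr 3 v = 0)
    (hπ : ∀ a : Fin n, s.arr 2 a = π a) (hX : n ≤ X) (hY : n + 2 ≤ Y) (hV : n ^ 4 < V) :
    (patternProblem σ).CallOk X Y V s (patternCount σ π) := by
  refine ⟨⟨n, π⟩, ?_, rfl, hX, hY, (patternCount_le σ π).trans_lt hV, by omega, by omega,
    by omega, fun a ha => ?_⟩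
  · simp only [patternProblem, permToMem, MemState.callInput, h1, h2]
    refine MemState.ext (funext fun r => ?_) (funext fun A => funext fun a => ?_)
    · simp
    · by_cases ha : a < n
      · rcases Nat.lt_or_ge A 2 with hA | hA
        · have : A = 0 ∨ A = 1 := by omega
          rcases this with rfl | rfl
          · simp [ha, hπ ⟨a, ha⟩]
          · simp [h3]
        · simp [ha, show A ≠ 0 by omega, not_lt.2 hA]
      · simp [ha]
  · rw [h1] at ha
    rw [hπ ⟨a, ha⟩, h3]
    have := (π ⟨a, ha⟩).2
    omega

theorem countOne_wp {σ : Equiv.Perm (Fin 4)} {x : EdgeListGraph} {s : MemState} {X Y V : ℕ}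
    (hs : Sorted x s) (hρ : x.arcs.M ≤ ρ 6) (hX : 4 * x.arcs.M ≤ X) (hY : 4 * x.arcs.M + 2 ≤ Y)
    (hV : (4 * x.arcs.M) ^ 4 < V) (sx sy : Bool → Bool) {r : ℕ} (hr : 20 ≤ r) :
    (countOne sx sy r).wp ρ ((patternProblem σ).CallOk X Y V)
      (fun s' => Sorted x s' ∧ s'.reg r = patternCount σ (x.arcs.perm sx sy)) s := by
  unfold countOne
  refine ⟨by rw [hs.arcs]; exact hρ, fun k s' => Sorted x s' ∧ ∀ u ∈ {u : x.arcs.Point | u.1 < k},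
    s'.arr 2 (x.arcs.xpos sx u) = x.arcs.ypos sy u, ⟨hs, by simp⟩, ?_, ?_⟩
  · rintro k s' hk - ⟨h1, h2⟩
    rw [hs.arcs] at hk
    have h1' : Sorted x (s'.setReg 5 k) := by
      refine ⟨?_, ?_, ?_, h1.free, h1.pos⟩ <;> rw [MemState.setReg_reg_of_ne _ _ (by norm_num)]
      exacts [h1.size, h1.zero, h1.arcs]
    have h5 : (s'.setReg 5 k).reg 5 = (⟨k, hk⟩ : Fin x.arcs.M) := MemState.setReg_reg_self _ _ _
    refine wp_seq (storePoint_wp h1' sx sy false false h5 h2) ?_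
    rintro s1 ⟨r1, s1', u1⟩ -
    refine wp_seq (storePoint_wp s1' sx sy false true (by rw [r1, h5]) u1) ?_
    rintro s2 ⟨r2, s2', u2⟩ -
    refine wp_seq (storePoint_wp s2' sx sy true false (by rw [r2, r1, h5]) u2) ?_
    rintro s3 ⟨r3, s3', u3⟩ -
    refine wp_mono _ ?_ _ (storePoint_wp s3' sx sy true true (by rw [r3, r2, r1, h5]) u3)
    rintro s4 ⟨-, s4', u4⟩
    refine ⟨s4', fun u hu => u4 u ?_⟩
    obtain ⟨i, h, v⟩ := u
    simp only [Set.mem_ofPred_eq, Nat.lt_succ_iff_lt_or_eq] at hu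
    rcases hu with hu | hu
    · simp [hu]
    · have : i = ⟨k, hk⟩ := Fin.ext hu
      cases h <;> cases v <;> simp [this]
  · rintro s' - ⟨h1, h2⟩
    simp only [wp, eval, WordOp.eval]
    refine ⟨_, patternProblem_callOk (x.arcs.perm sx sy) ?_ ?_ ?_ ?_ hX hY hV, ?_, ?_⟩
    · simp [MemState.setReg_reg, h1.arcs]
    · simp [MemState.setReg_reg, h1.zero]
    · exact h1.free
    · intro c
      obtain ⟨u, rfl⟩ := (x.arcs.xEquiv sx).surjective c
      have h3 := x.arcs.perm_apply sx sy u (x.arcs.pos_lt u.1.2 _ _)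
      have h4 := h2 u (by rw [hs.arcs]; exact u.1.2)
      exact h4.trans h3.symm
    · refine ⟨?_, ?_, ?_, h1.free, h1.pos⟩
      · simpa [MemState.setReg_reg, show ¬ 0 = r by omega] using h1.size
      · simpa [MemState.setReg_reg, show ¬ 2 = r by omega] using h1.zero
      · simpa [MemState.setReg_reg, show ¬ 6 = r by omega] using h1.arcs
    · simp

theorem program_wp {σ : Equiv.Perm (Fin 4)} (hσ : ArcSystem.SplitsEvenly σ) {x : EdgeListGraph}
    {X Y V : ℕ} (hρ : x.arcs.M ≤ ρ 6) (hX : 4 * x.arcs.M ≤ X) (hY : 4 * x.arcs.M + 2 ≤ Y)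
    (hV : (4 * x.arcs.M) ^ 4 < V) :
    (program σ).wp ρ ((patternProblem σ).CallOk X Y V)
      (fun s => s.reg 4 = x.G.copyCount (SimpleGraph.cycleGraph 4)) (fourCycleProblem.start x) := by
  have z : ∀ A, 2 ≤ A → ∀ v, (fourCycleProblem.start x).arr A v = 0 := by
    intro A hA v
    simp only [CountingProblem.start, fourCycleProblem, EdgeListGraph.toMem]
    split_ifs <;> first | rfl | omega
  refine wp_seq (arcLoop_wp x (fourCycleProblem.start x) hρ rfl rfl rfl (z 5 (by norm_num))) ?_
  rintro s1 ⟨r6, a4, a5⟩ f1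
  have y1 : ∀ A, A ∉ [4, 4, 5] → 2 ≤ A → ∀ v, s1.arr A v = 0 := fun A hA h2 v => by
    rw [f1.2 A (by simpa [wa, arcLoop] using hA)]; exact z A h2 v
  have q1 : ∀ r, r ∉ [6, 5] → s1.reg r = if r = 0 then x.edges.length else 0 := fun r hr => by
    rw [f1.1 r (by simpa [wr, arcLoop] using hr)]; rfl
  refine wp_seq (sortLoop_wp x.arcs.toArcOrder s1 hρ r6
    (by rw [q1 7 (by simp)]; rfl) (by rw [q1 8 (by simp)]; rfl) a4 a5
    (y1 6 (by simp) (by norm_num)) (y1 7 (by simp) (by norm_num))) ?_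
  rintro s2 ⟨r8, hpos⟩ f2
  have hs2 : Sorted x s2 := by
    refine ⟨?_, ?_, ?_, fun v => ?_, hpos⟩
    · rw [f2.1 0 (by simp [wr, sortLoop, sortTail]), q1 0 (by simp)]; rfl
    · rw [f2.1 2 (by simp [wr, sortLoop, sortTail]), q1 2 (by simp)]; rfl
    · rw [f2.1 6 (by simp [wr, sortLoop, sortTail]), r6]
    · rw [f2.2 3 (by simp [wa, sortLoop, sortTail]), y1 3 (by simp) (by norm_num)]
  refine wp_seq (wp_iter (fun n s => (Sorted x s ∧ s.reg 8 = s2.reg 8) ∧ ∀ k < n,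
    s.reg (20 + k) = patternCount σ (x.arcs.perm (ArcSystem.sndX σ (flips k).1)
      (ArcSystem.sndY σ (flips k).2))) ?_ s2 ⟨⟨hs2, rfl⟩, by simp⟩) ?_
  rotate_left
  · rintro s3 ⟨⟨hs3, h8⟩, hc⟩ -
    have hsum := x.sum_sgn_patternCount_arcs hσ
    simp only [Fintype.sum_prod_type, Fintype.sum_bool, ArcSystem.sgn, if_true,
      Bool.false_eq_true, if_false] at hsum
    have hdeg : x.arcs.M ≤ 2 * s2.reg 8 := by
      rw [r8]
      have : ∑ i ∈ Finset.range x.arcs.M, 1 ≤ ∑ i ∈ Finset.range x.arcs.M, x.arcs.deg i :=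
        Finset.sum_le_sum fun i hi => by
          have h1 := x.arcs.rho_lt_off_add_deg (Finset.mem_range.1 hi)
          have h2 := x.arcs.off_le_rho i
          omega
      simp only [Finset.sum_const, Finset.card_range, smul_eq_mul, mul_one] at this
      omega
    have c0 := hc 0 (by norm_num)
    have c1 := hc 1 (by norm_num)
    have c2 := hc 2 (by norm_num)
    have c3 := hc 3 (by norm_num)
    have c4 := hc 4 (by norm_num)
    have c5 := hc 5 (by norm_num)
    have c6 := hc 6 (by norm_num)
    have c7 := hc 7 (by norm_num)
    have c8 := hc 8 (by norm_num)
    have c9 := hc 9 (by norm_num)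
    have c10 := hc 10 (by norm_num)
    have c11 := hc 11 (by norm_num)
    have c12 := hc 12 (by norm_num)
    have c13 := hc 13 (by norm_num)
    have c14 := hc 14 (by norm_num)
    have c15 := hc 15 (by norm_num)
    simp only [show flips 0 = ((false, false), (false, false)) by decide,
      show flips 1 = ((true, false), (false, false)) by decide,
      show flips 2 = ((false, true), (false, false)) by decide,
      show flips 3 = ((true, true), (false, false)) by decide,
      show flips 4 = ((false, false), (true, false)) by decide,
      show flips 5 = ((true, false), (true, false)) by decide,
      show flips 6 = ((false, true), (true, false)) by decide,
      show flips 7 = ((true, true), (true, false)) by decide,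
      show flips 8 = ((false, false), (false, true)) by decide,
      show flips 9 = ((true, false), (false, true)) by decide,
      show flips 10 = ((false, true), (false, true)) by decide,
      show flips 11 = ((true, true), (false, true)) by decide,
      show flips 12 = ((false, false), (true, true)) by decide,
      show flips 13 = ((true, false), (true, true)) by decide,
      show flips 14 = ((false, true), (true, true)) by decide,
      show flips 15 = ((true, true), (true, true)) by decide, Nat.reduceAdd]
      at c0 c1 c2 c3 c4 c5 c6 c7 c8 c9 c10 c11 c12 c13 c14 c15
    simp only [wp, eval, WordOp.eval, sumRegs, posRegs, negRegs, MemState.setReg_reg_self, hs3.arcs,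
      h8, c0, c1, c2, c3, c4, c5, c6, c7, c8, c9, c10, c11, c12, c13, c14, c15]
    have hM : x.arcs.M = 2 * x.edges.length := rfl
    rw [← Nat.cast_sum, ← r8] at hsum
    omega
  · rintro k hk s ⟨⟨hs, h8⟩, hc⟩
    refine wp_mono _ ?_ _ (wp_frame _ _ (countOne_wp hs hρ hX hY hV _ _ (by omega)))
    rintro s' ⟨⟨hs', hr⟩, f⟩
    refine ⟨⟨hs', ?_⟩, fun j hj => ?_⟩
    · rw [f.1 8 (by simp [wr, countOne, storePoint]; omega), h8]
    · rcases Nat.lt_succ_iff_lt_or_eq.1 hj with hj | rfl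
      · rw [f.1 (20 + j) (by simp [wr, countOne, storePoint]; omega), hc j hj]
      · exact hr

end FourCycleReduction

theorem fourCycleProblem_standardInput : fourCycleProblem.StandardInput where
  size_le x := Nat.le_add_left _ _
  reg_zero x := rfl
  reg_two x r hr := by
    simp only [fourCycleProblem, EdgeListGraph.toMem]
    split_ifs <;> omega
  arr_two x A a hA := by
    simp only [fourCycleProblem, EdgeListGraph.toMem]
    split_ifs <;> omega
  arr_lt x A a := by
    simp only [fourCycleProblem, EdgeListGraph.toMem]
    split_ifs with h
    · have := (x.edges[a]).1.2; omega
    · have := (x.edges[a]).2.2; omega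
    · omega
    · omega

theorem Nat.eight_mul_le_pow_four {z : ℕ} (hz : 2 ≤ z) : 8 * z ≤ z ^ 4 := by
  rw [pow_succ]
  exact Nat.mul_le_mul_right _ (Nat.pow_le_pow_left hz 3)

/-- An algorithm that counts a non-trivial pattern yields one that counts 4-cycles. -/
theorem fourCycleProblem_solvable_of_pattern {γ : ℝ} (hγ : 1 ≤ γ) {σ : Equiv.Perm (Fin 4)}
    (hσ : ArcSystem.SplitsEvenly σ) (h : SolvableInSoftO (patternProblem σ) γ) :
    SolvableInSoftO fourCycleProblem γ := by
  open FourCycleReduction in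
  refine solvable_of_reduction hγ h fourCycleProblem_standardInput (program σ) Γ Δ 50 4 0 5000
    (fun x _ => 2 * x.edges.length) (by norm_num) (fun r => ?_) (by decide) (by decide) (by decide)
    (chk_program σ) (fun x => program_wp hσ (x := x) le_rfl ?_ ?_ ?_) (fun x T => ?_) fun x => ?_
  · unfold Γ
    rcases Nat.lt_or_ge r 20 with hr | hr
    · interval_cases r <;> decide
    · simp [hr]
  · change 4 * (2 * x.edges.length) ≤ 8 * (x.edges.length + 2)
    omega
  · change 4 * (2 * x.edges.length) + 2 ≤ (x.edges.length + 2) ^ 4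
    have := Nat.eight_mul_le_pow_four (z := x.edges.length + 2) (by omega)
    omega
  · change (4 * (2 * x.edges.length)) ^ 4 < (x.N + x.edges.length + 2) ^ 16
    have h1 : 4 * (2 * x.edges.length) < (x.N + x.edges.length + 2) ^ 4 := by
      calc 4 * (2 * x.edges.length) < 8 * (x.edges.length + 2) := by omega
        _ ≤ (x.edges.length + 2) ^ 4 := Nat.eight_mul_le_pow_four (by omega)
        _ ≤ (x.N + x.edges.length + 2) ^ 4 := Nat.pow_le_pow_left (by omega) 4
    calc _ < ((x.N + x.edges.length + 2) ^ 4) ^ 4 := Nat.pow_lt_pow_left h1 (by norm_num)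
      _ = _ := by rw [← pow_mul]
  · simp only [program, WCmd.cost, WCmd.cost_iter, arcLoop, sortLoop, sortTail, countOne,
      storePoint, posExpr, sumRegs, posRegs, negRegs, WExpr.cost, Finset.sum_const, Finset.card_range,
      smul_eq_mul]
    rw [pow_zero, mul_one]
    change _ ≤ 5000 * (x.edges.length + 2 + T)
    omega
  · simp only [program, WCmd.cost, WCmd.cost_iter, arcLoop, sortLoop, sortTail, countOne,
      storePoint, posExpr, sumRegs, posRegs, negRegs, WExpr.cost, Finset.sum_const, Finset.card_range,
      smul_eq_mul]
    calc _ ≤ 2 ^ 50 := by norm_num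
      _ ≤ _ := Nat.pow_le_pow_left (by omega) 50


/-! ### Closed sequences of arcs in a layered graph -/

/-- Arcs between `N` nodes that lie in four cyclically ordered layers; parallel arcs are possible.
In the layer `t` there is an arc for every `v` that satisfies `U t v`. -/
structure LayeredArcs (n N : ℕ) where
  /-- `v` is present in the layer `t` -/
  U : Fin 4 → Fin n → Prop
  /-- the source of an arc -/
  src : Fin 4 → Fin n → Fin N
  /-- the target of an arc -/
  dst : Fin 4 → Fin n → Fin N
  /-- the layer of a node -/
  lay : Fin N → Fin 4
  lay_src : ∀ t v, lay (src t v) = t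
  lay_dst : ∀ t v, lay (dst t v) = t + 1

namespace LayeredArcs

variable {n N : ℕ} (a : LayeredArcs n N)

open Classical in
/-- The number of parallel arcs from `u` to `u'`. -/
noncomputable def mult (t : Fin 4) (u u' : Fin N) : ℕ :=
  (Finset.univ.filter fun v => a.U t v ∧ a.src t v = u ∧ a.dst t v = u').card

/-- The bit `k t` of the number of parallel arcs. -/
def Bit (k : Fin 4 → ℕ) (t : Fin 4) (u u' : Fin N) : Prop := (a.mult t u u').testBit (k t) = true

/-- The last one of a class of parallel arcs. -/
def IsLast (t : Fin 4) (v : Fin n) : Prop :=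
  a.U t v ∧ ∀ v', v < v' → a.U t v' → ¬ (a.src t v' = a.src t v ∧ a.dst t v' = a.dst t v)

open Classical in
/-- The pairs of nodes of the layer `t` for which the bit `k t` of the number of parallel arcs is
set. -/
noncomputable def arcList (k : Fin 4 → ℕ) (t : Fin 4) : List (Fin N × Fin N) :=
  ((List.finRange n).filter fun v => a.IsLast t v ∧ a.Bit k t (a.src t v) (a.dst t v)).map
    fun v => (a.src t v, a.dst t v)

/-- The concatenation of the lists `arcList` for the layers below `j` that belong to the set with
the characteristic bits `S`. -/
noncomputable def layerList (k : Fin 4 → ℕ) (S : ℕ) : ℕ → List (Fin N × Fin N)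
  | 0 => []
  | j + 1 => layerList k S j ++ if S.testBit j then a.arcList k (Fin.ofNat 4 j) else []

theorem mult_le (t : Fin 4) (u u' : Fin N) : a.mult t u u' ≤ n := by
  classical
  exact (Finset.card_le_univ _).trans (by simp)

theorem exists_isLast {k : Fin 4 → ℕ} {t : Fin 4} {u u' : Fin N} (h : a.Bit k t u u') :
    ∃ v, a.IsLast t v ∧ a.src t v = u ∧ a.dst t v = u' := by
  classical
  set F := Finset.univ.filter fun v => a.U t v ∧ a.src t v = u ∧ a.dst t v = u' with hF
  have hne : F.Nonempty := by
    rw [← Finset.card_pos, Nat.pos_iff_ne_zero]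
    intro h0
    have : a.mult t u u' = 0 := h0
    simp [Bit, this] at h
  have hm := F.max'_mem hne
  simp only [hF, Finset.mem_filter, Finset.mem_univ, true_and] at hm
  refine ⟨F.max' hne, ⟨hm.1, fun v' hv hU hd => ?_⟩, hm.2⟩
  have := F.le_max' v' (by
    simp only [hF, Finset.mem_filter, Finset.mem_univ, true_and]
    exact ⟨hU, hd.1.trans hm.2.1, hd.2.trans hm.2.2⟩)
  exact absurd hv this.not_gt

theorem mem_arcList {k : Fin 4 → ℕ} {t : Fin 4} {u u' : Fin N} :
    (u, u') ∈ a.arcList k t ↔ a.Bit k t u u' := by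
  simp only [arcList, List.mem_map, List.mem_filter, List.mem_finRange, true_and,
    decide_eq_true_eq, Prod.mk.injEq]
  constructor
  · rintro ⟨v, ⟨-, h⟩, rfl, rfl⟩; exact h
  · intro h
    obtain ⟨v, h1, rfl, rfl⟩ := a.exists_isLast h
    exact ⟨v, ⟨h1, h⟩, rfl, rfl⟩

theorem nodup_arcList (k : Fin 4 → ℕ) (t : Fin 4) : (a.arcList k t).Nodup := by
  refine List.Nodup.map_on ?_ ((List.nodup_finRange n).filter _)
  intro v hv w hw he
  simp only [List.mem_filter, List.mem_finRange, true_and, decide_eq_true_eq] at hv hw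
  simp only [Prod.mk.injEq] at he
  rcases lt_trichotomy v w with h | h | h
  · exact absurd ⟨he.1.symm, he.2.symm⟩ (hv.1.2 w h hw.1.1)
  · exact h
  · exact absurd he (hw.1.2 v h hv.1.1)

theorem lay_of_bit {k : Fin 4 → ℕ} {t : Fin 4} {u u' : Fin N} (h : a.Bit k t u u') :
    a.lay u = t ∧ a.lay u' = t + 1 := by
  obtain ⟨v, -, rfl, rfl⟩ := a.exists_isLast h
  exact ⟨a.lay_src t v, a.lay_dst t v⟩

theorem mem_layerList {k : Fin 4 → ℕ} {S j : ℕ} {u u' : Fin N} :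
    (u, u') ∈ a.layerList k S j ↔ ∃ i < j, S.testBit i ∧ a.Bit k (Fin.ofNat 4 i) u u' := by
  induction j with
  | zero => simp [layerList]
  | succ j ih =>
    rw [layerList, List.mem_append, ih]
    constructor
    · rintro (⟨i, hi, h⟩ | h)
      · exact ⟨i, by omega, h⟩
      · split_ifs at h with hS
        · exact ⟨j, by omega, hS, a.mem_arcList.1 h⟩
        · simp at h
    · rintro ⟨i, hi, h1, h2⟩
      rcases Nat.lt_succ_iff_lt_or_eq.1 hi with hi | rfl
      · exact .inl ⟨i, hi, h1, h2⟩
      · rw [if_pos h1]; exact .inr (a.mem_arcList.2 h2)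

theorem nodup_layerList (k : Fin 4 → ℕ) (S j : ℕ) (hj : j ≤ 4) : (a.layerList k S j).Nodup := by
  induction j with
  | zero => simp [layerList]
  | succ j ih =>
    rw [layerList]
    refine List.nodup_append.2 ⟨ih (by omega), ?_, ?_⟩
    · split_ifs
      · exact a.nodup_arcList k _
      · exact List.nodup_nil
    · rintro ⟨u, u'⟩ h1 e h2 rfl
      obtain ⟨i, hi, -, h3⟩ := a.mem_layerList.1 h1
      split_ifs at h2 with hS
      · have h4 := a.mem_arcList.1 h2
        have h5 := (a.lay_of_bit h3).1.symm.trans (a.lay_of_bit h4).1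
        have h6 := congrArg Fin.val h5
        simp only [Fin.ofNat] at h6
        omega
      · simp at h2

theorem lay_of_mem {k : Fin 4 → ℕ} {S j : ℕ} {e : Fin N × Fin N} (h : e ∈ a.layerList k S j) :
    a.lay e.2 = a.lay e.1 + 1 := by
  obtain ⟨i, -, -, h3⟩ := a.mem_layerList.1 (show (e.1, e.2) ∈ _ from h)
  rw [(a.lay_of_bit h3).1, (a.lay_of_bit h3).2]

/-- The graph with the edges `layerList`. -/
noncomputable def graph (k : Fin 4 → ℕ) (S : ℕ) : EdgeListGraph :=
  EdgeListGraph.ofList (a.layerList k S 4)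
    (by
      refine (a.nodup_layerList k S 4 le_rfl).map_on ?_
      intro e he e' he' h
      have h1 := a.lay_of_mem he
      have h2 := a.lay_of_mem he'
      rcases Sym2.eq_iff.1 h with h | h
      · exact Prod.ext h.1 h.2
      · rw [h.1, h.2] at h1
        have : ∀ t t' : Fin 4, t = t' + 1 → t' ≠ t + 1 := by decide
        exact absurd h1 (this _ _ h2))
    (fun e he h => by
      have h1 := a.lay_of_mem he
      rw [h] at h1
      have : ∀ t : Fin 4, t ≠ t + 1 := by decide
      exact this _ h1)

/-- The graph with the edges `layerList`, as a graph on the nodes of the layers. -/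
noncomputable def simpleGraph (k : Fin 4 → ℕ) (S : ℕ) : SimpleGraph (Fin N) := (a.graph k S).G

/-- The set of layers with the characteristic bits `S`. -/
def mask (S : ℕ) : Finset (Fin 4) := Finset.univ.filter fun t => S.testBit t

theorem sum_mask {M : Type*} [AddCommMonoid M] (F : Finset (Fin 4) → M) :
    ∑ S ∈ Finset.range 16, F (mask S) = ∑ S, F S := by
  have h1 : ∀ S < 16, ∀ S' < 16, mask S = mask S' → S = S' := by decide
  have h2 : ∀ T : Finset (Fin 4), ∃ S < 16, mask S = T := by decide
  refine Finset.sum_nbij mask (fun _ _ => Finset.mem_univ _) (fun S hS S' hS' h => ?_)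
    (fun T _ => ?_) fun _ _ => rfl
  · exact h1 S (by simpa using hS) S' (by simpa using hS') h
  · obtain ⟨S, hS, h⟩ := h2 T
    exact ⟨S, by simpa using hS, h⟩

theorem graph_adj {k : Fin 4 → ℕ} {S : ℕ} {u u' : Fin N} : (a.simpleGraph k S).Adj u u' ↔
    ∃ t ∈ mask S, a.Bit k t u u' ∨ a.Bit k t u' u := by
  have h : ∀ u u', (u, u') ∈ a.layerList k S 4 ↔ ∃ t ∈ mask S, a.Bit k t u u' := by
    intro u u'
    rw [mem_layerList]
    constructor
    · rintro ⟨i, hi, h1, h2⟩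
      refine ⟨Fin.ofNat 4 i, ?_, h2⟩
      simpa [mask, Nat.mod_eq_of_lt hi] using h1
    · rintro ⟨t, h1, h2⟩
      refine ⟨t, t.2, by simpa [mask] using h1, ?_⟩
      have : Fin.ofNat 4 (t : ℕ) = t := Fin.ext (by simp)
      rwa [this]
  refine EdgeListGraph.ofList_adj.trans ?_
  rw [h, h]
  constructor
  · rintro (⟨t, h1, h2⟩ | ⟨t, h1, h2⟩)
    exacts [⟨t, h1, .inl h2⟩, ⟨t, h1, .inr h2⟩]
  · rintro ⟨t, h1, h2 | h2⟩
    exacts [.inl ⟨t, h1, h2⟩, .inr ⟨t, h1, h2⟩]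

theorem _root_.Nat.sum_testBit {w L : ℕ} (h : w < 2 ^ L) :
    w = ∑ j : Fin L, 2 ^ (j : ℕ) * (w.testBit j).toNat := by
  have : ∀ L, w % 2 ^ L = ∑ j ∈ Finset.range L, 2 ^ j * (w.testBit j).toNat := by
    intro L
    induction L with
    | zero => simp [Nat.mod_one]
    | succ L ih => 
      rw [Finset.sum_range_succ, ← ih, pow_succ, Nat.mod_mul, Nat.testBit_eq_decide_div_mod_eq]
      have := Nat.mod_two_eq_zero_or_one (w / 2 ^ L)
      rcases this with h | h <;> simp [h]
  rw [← Finset.sum_range fun j => 2 ^ j * (w.testBit j).toNat, ← this, Nat.mod_eq_of_lt h]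

/-- A closed sequence of arcs passes through a closed sequence of nodes, and every pair of
consecutive nodes leaves the choice between the parallel arcs. -/
theorem card_closed_eq_sum_prod :
    Nat.card {q : Fin 4 → Fin n // ∀ t, a.U t (q t) ∧ a.dst t (q t) = a.src (t + 1) (q (t + 1))}
      = ∑ κ : Fin 4 → Fin N, ∏ t, a.mult t (κ t) (κ (t + 1)) := by
  classical
  have h1 : ∀ κ : Fin 4 → Fin N, ∏ t, a.mult t (κ t) (κ (t + 1)) = (Finset.univ.filter
      fun q : Fin 4 → Fin n => (∀ t, a.U t (q t) ∧ a.dst t (q t) = a.src (t + 1) (q (t + 1))) ∧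
        (fun t => a.src t (q t)) = κ).card := by
    intro κ
    simp only [mult]
    rw [← Fintype.card_piFinset]
    congr 1
    ext q
    simp only [Fintype.mem_piFinset, Finset.mem_filter, Finset.mem_univ, true_and]
    constructor
    · intro h
      exact ⟨fun t => ⟨(h t).1, (h t).2.2.trans (h (t + 1)).2.1.symm⟩, funext fun t => (h t).2.1⟩
    · rintro ⟨h, rfl⟩ t
      exact ⟨(h t).1, rfl, (h t).2⟩
  simp only [h1]
  rw [Nat.card_eq_fintype_card, Fintype.card_subtype,
    Finset.card_eq_sum_card_fiberwise (f := fun q : Fin 4 → Fin n => fun t => a.src t (q t))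
      (t := Finset.univ) (fun _ _ => Finset.mem_univ _)]
  refine Finset.sum_congr rfl fun κ _ => ?_
  rw [Finset.filter_filter]

/-- The number of closed sequences of arcs in terms of numbers of 4-cycles: the multiplicities are
split into their bits, and inclusion-exclusion over the layers singles out those 4-cycles that
pass through all of them. -/
theorem card_closed {L : ℕ} (hL : n < 2 ^ L) :
    (Nat.card {q : Fin 4 → Fin n //
        ∀ t, a.U t (q t) ∧ a.dst t (q t) = a.src (t + 1) (q (t + 1))} : ℤ)
      = ∑ k : Fin 4 → Fin L, 2 ^ (∑ t, (k t : ℕ)) * ∑ S ∈ Finset.range 16,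
        (-1) ^ (mask S).card *
          ((a.simpleGraph (fun t => k t) S).copyCount (SimpleGraph.cycleGraph 4) : ℤ) := by
  classical
  have h1 : ∀ k : Fin 4 → Fin L, ∑ S ∈ Finset.range 16, (-1) ^ (mask S).card *
      ((a.simpleGraph (fun t => k t) S).copyCount (SimpleGraph.cycleGraph 4) : ℤ)
      = Nat.card {κ : Fin 4 → Fin N // ∀ t, a.Bit (fun t => k t) t (κ t) (κ (t + 1))} := by
    intro k
    let G : Finset (Fin 4) → SimpleGraph (Fin N) := fun T =>
      SimpleGraph.fromRel fun u u' => ∃ t ∈ T, a.Bit (fun t => k t) t u u'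
    have hG : ∀ T u u', (G T).Adj u u' ↔ ∃ t ∈ T, a.Bit (fun t => k t) t u u' ∨
        a.Bit (fun t => k t) t u' u := by
      intro T u u'
      simp only [G, SimpleGraph.fromRel_adj]
      constructor
      · rintro ⟨-, ⟨t, h1, h2⟩ | ⟨t, h1, h2⟩⟩
        exacts [⟨t, h1, .inl h2⟩, ⟨t, h1, .inr h2⟩]
      · rintro ⟨t, h1, h2⟩
        refine ⟨?_, ?_⟩
        · rintro rfl
          have h3 := a.lay_of_bit (h2.elim id id)
          have : ∀ t : Fin 4, t ≠ t + 1 := by decide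
          exact this t (h3.1.symm.trans h3.2)
        · rcases h2 with h2 | h2
          exacts [.inl ⟨t, h1, h2⟩, .inr ⟨t, h1, h2⟩]
    rw [← SimpleGraph.sum_copyCount_layers a.lay (a.Bit fun t => k t)
      (fun t u v h => a.lay_of_bit h) G hG,
      ← sum_mask fun T => (-1 : ℤ) ^ T.card * ((G T).copyCount (SimpleGraph.cycleGraph 4) : ℤ)]
    refine Finset.sum_congr rfl fun S _ => ?_
    have : (a.simpleGraph (fun t => k t) S) = G (mask S) := by
      ext u u'
      rw [hG]
      exact a.graph_adj
    rw [← this]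
  simp only [h1]
  rw [card_closed_eq_sum_prod]
  have h2 : ∀ κ : Fin 4 → Fin N, ∏ t, a.mult t (κ t) (κ (t + 1)) = ∑ k : Fin 4 → Fin L,
      2 ^ (∑ t, (k t : ℕ)) *
        if ∀ t, a.Bit (fun t => k t) t (κ t) (κ (t + 1)) then 1 else 0 := by
    intro κ
    rw [Finset.prod_congr rfl fun t _ => Nat.sum_testBit ((a.mult_le t (κ t) (κ (t + 1))).trans_lt
      hL), Finset.prod_univ_sum, Fintype.piFinset_univ]
    refine Finset.sum_congr rfl fun k _ => ?_
    rw [Finset.prod_mul_distrib, Finset.prod_pow_eq_pow_sum]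
    congr 1
    have : ∀ t, ((a.mult t (κ t) (κ (t + 1))).testBit (k t)).toNat
        = if a.Bit (fun t => k t) t (κ t) (κ (t + 1)) then 1 else 0 := by
      intro t
      unfold Bit
      cases (a.mult t (κ t) (κ (t + 1))).testBit (k t) <;> simp
    simp only [this]
    rw [Finset.prod_ite_zero]
    simp
  simp only [h2]
  rw [Finset.sum_comm]
  push_cast
  refine Finset.sum_congr rfl fun k _ => ?_
  rw [← Finset.mul_sum, Nat.card_eq_fintype_card, Fintype.card_subtype, Finset.sum_boole]

end LayeredArcs


/-! ### Splitting occurrences of a pattern by levels -/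

/-- If the elements of a type that satisfy `P` fall into classes, these can be counted
separately. -/
theorem Nat.card_eq_sum_of_existsUnique {α C : Type*} [Finite α] [Fintype C] {P : α → Prop}
    {R : C → α → Prop} (h1 : ∀ c p, R c p → P p) (h2 : ∀ p, P p → ∃! c, R c p) :
    Nat.card {p // P p} = ∑ c, Nat.card {p // R c p} := by
  rw [← Nat.card_sigma]
  exact Nat.card_congr
    { toFun := fun p => ⟨(h2 p.1 p.2).choose, p.1, (h2 p.1 p.2).choose_spec.1⟩
      invFun := fun q => ⟨q.2.1, h1 _ _ q.2.2⟩
      left_inv := fun p => rfl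
      right_inv := fun ⟨c, p, hp⟩ =>
        Sigma.subtype_ext ((h2 p (h1 c p hp)).choose_spec.2 c hp).symm rfl }

/-- The binary expansions of `u` and `v` agree above the bit `l`, which is `0` in `u` and `1` in
`v`. -/
def Nat.SplitAt (l u v : ℕ) : Prop :=
  u >>> (l + 1) = v >>> (l + 1) ∧ u.testBit l = false ∧ v.testBit l = true

theorem Nat.splitAt_succ {l u v : ℕ} : Nat.SplitAt (l + 1) u v ↔ Nat.SplitAt l (u / 2) (v / 2) := by
  unfold Nat.SplitAt
  rw [Nat.testBit_succ, Nat.testBit_succ, Nat.shiftRight_eq_div_pow, Nat.shiftRight_eq_div_pow,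
    Nat.shiftRight_eq_div_pow, Nat.shiftRight_eq_div_pow, Nat.div_div_eq_div_mul,
    Nat.div_div_eq_div_mul, ← _root_.pow_succ' 2 (l + 1)]

theorem Nat.splitAt_zero {u v : ℕ} : Nat.SplitAt 0 u v ↔ u / 2 = v / 2 ∧ u % 2 = 0 ∧ v % 2 = 1 := by
  simp [Nat.SplitAt, Nat.testBit_zero, Nat.shiftRight_eq_div_pow]

theorem Nat.SplitAt.lt {l u v : ℕ} (h : Nat.SplitAt l u v) : u < v := by
  induction l generalizing u v with
  | zero => have := Nat.splitAt_zero.1 h; omega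
  | succ l ih => have := ih (Nat.splitAt_succ.1 h); omega

theorem Nat.SplitAt.eq {l l' u v : ℕ} (h : Nat.SplitAt l u v) (h' : Nat.SplitAt l' u v) :
    l = l' := by
  induction l generalizing l' u v with
  | zero =>
    cases l' with
    | zero => rfl
    | succ l' => have := (Nat.splitAt_succ.1 h').lt; have := Nat.splitAt_zero.1 h; omega
  | succ l ih =>
    cases l' with
    | zero => have := (Nat.splitAt_succ.1 h).lt; have := Nat.splitAt_zero.1 h'; omega
    | succ l' => rw [ih (Nat.splitAt_succ.1 h) (Nat.splitAt_succ.1 h')]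

theorem Nat.exists_splitAt {L u v : ℕ} (h : u < v) (hv : v < 2 ^ L) :
    ∃ l < L, Nat.SplitAt l u v := by
  induction L generalizing u v with
  | zero => simp at hv; omega
  | succ L ih =>
    rw [pow_succ] at hv
    by_cases h2 : u / 2 < v / 2
    · obtain ⟨l, hl, hs⟩ := ih h2 (by omega)
      exact ⟨l + 1, by omega, Nat.splitAt_succ.2 hs⟩
    · exact ⟨0, by omega, Nat.splitAt_zero.2 (by omega)⟩

theorem Nat.shiftRight_eq_of_le {l m u v : ℕ} (h : u >>> (l + 1) = v >>> (l + 1)) (hlm : l ≤ m) :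
    u >>> (m + 1) = v >>> (m + 1) := by
  obtain ⟨j, rfl⟩ := Nat.exists_eq_add_of_le hlm
  rw [show l + j + 1 = l + 1 + j by ring, Nat.shiftRight_add, h, ← Nat.shiftRight_add]

namespace Levels

/-- Consecutive entries of `X` are increasing with the levels `a`. -/
def Chain (a : Fin 3 → ℕ) (X : Fin 4 → ℕ) : Prop :=
  ∀ k : Fin 3, Nat.SplitAt (a k) (X k.castSucc) (X k.succ)

/-- The highest level between the positions `i` and `j`. -/
def top (a : Fin 3 → ℕ) (i j : Fin 4) : ℕ :=
  ((List.finRange 3).filter fun k => min i j ≤ k.castSucc ∧ k.castSucc < max i j).foldr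
    (fun k m => max (a k) m) 0

/-- The conditions that a chain imposes on the bits of its entry `i` alone. -/
def Ends (i : Fin 4) (a : Fin 3 → ℕ) (x : ℕ) : Prop :=
  (∀ k : Fin 3, k.castSucc = i → x.testBit (a k) = false) ∧
    ∀ k : Fin 3, k.succ = i → x.testBit (a k) = true

/-- The three ways to group four positions into two pairs: `opp d i` is the partner of `i`. -/
def opp : Fin 3 → Fin 4 → Fin 4 := ![![2, 3, 0, 1], ![3, 2, 1, 0], ![1, 0, 3, 2]]

/-- A cyclic order of the positions in which partners are opposite. -/
def cyc : Fin 3 → Equiv.Perm (Fin 4) := ![1, Equiv.swap 2 3, Equiv.swap 1 2]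

/-- Levels for which the comparisons within the pairs of `d` follow from the other ones. -/
def Good : Fin 3 → (Fin 3 → ℕ) → Prop
  | 0, _ => True
  | 1, a => a 0 ≤ a 1 ∨ a 2 ≤ a 1
  | 2, a => a 1 ≤ a 0 ∧ a 1 ≤ a 2

instance (d : Fin 3) (a : Fin 3 → ℕ) : Decidable (Good d a) := by
  unfold Good
  split <;> infer_instance

theorem top_comm (a : Fin 3 → ℕ) (i j : Fin 4) : top a i j = top a j i := by
  unfold top
  rw [min_comm, max_comm]

/-- A chain is described by conditions on single entries and by equations between entries that are
not partners. -/
theorem chain_iff {d : Fin 3} {a : Fin 3 → ℕ} (hd : Good d a) (X : Fin 4 → ℕ) :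
    Chain a X ↔ (∀ i, Ends i a (X i)) ∧ ∀ i j, i ≠ j → j ≠ opp d i →
      X i >>> (top a i j + 1) = X j >>> (top a i j + 1) := by
  have t01 : top a 0 1 = max (a 0) 0 := rfl
  have t12 : top a 1 2 = max (a 1) 0 := rfl
  have t23 : top a 2 3 = max (a 2) 0 := rfl
  have t02 : top a 0 2 = max (a 0) (max (a 1) 0) := rfl
  have t13 : top a 1 3 = max (a 1) (max (a 2) 0) := rfl
  have t03 : top a 0 3 = max (a 0) (max (a 1) (max (a 2) 0)) := rfl
  constructor
  · intro h
    have h0 := (h 0).1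
    have h1 := (h 1).1
    have h2 := (h 2).1
    refine ⟨fun i => ⟨fun k hk => by rw [← hk]; exact (h k).2.1,
      fun k hk => by rw [← hk]; exact (h k).2.2⟩, ?_⟩
    have key : ∀ i j, i < j → X i >>> (top a i j + 1) = X j >>> (top a i j + 1) := by
      have e0 : ∀ m, a 0 ≤ m → X 0 >>> (m + 1) = X 1 >>> (m + 1) :=
        fun m hm => Nat.shiftRight_eq_of_le h0 hm
      have e1 : ∀ m, a 1 ≤ m → X 1 >>> (m + 1) = X 2 >>> (m + 1) :=
        fun m hm => Nat.shiftRight_eq_of_le h1 hm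
      have e2 : ∀ m, a 2 ≤ m → X 2 >>> (m + 1) = X 3 >>> (m + 1) :=
        fun m hm => Nat.shiftRight_eq_of_le h2 hm
      have f01 := e0 (top a 0 1) (by rw [t01]; omega)
      have f12 := e1 (top a 1 2) (by rw [t12]; omega)
      have f23 := e2 (top a 2 3) (by rw [t23]; omega)
      have f02 := (e0 (top a 0 2) (by rw [t02]; omega)).trans (e1 (top a 0 2) (by rw [t02]; omega))
      have f13 := (e1 (top a 1 3) (by rw [t13]; omega)).trans (e2 (top a 1 3) (by rw [t13]; omega))
      have f03 := ((e0 (top a 0 3) (by rw [t03]; omega)).trans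
        (e1 (top a 0 3) (by rw [t03]; omega))).trans (e2 (top a 0 3) (by rw [t03]; omega))
      intro i j hij
      fin_cases i <;> fin_cases j <;> first | assumption | exact absurd hij (by decide)
    intro i j hij _
    rcases lt_or_gt_of_ne hij with h | h
    · exact key i j h
    · rw [top_comm]; exact (key j i h).symm
  · rintro ⟨hE, hK⟩ k
    refine ⟨?_, (hE _).1 k rfl, (hE _).2 k rfl⟩
    have f : ∀ i j, i ≠ j → j ≠ opp d i → ∀ m, top a i j ≤ m →
        X i >>> (m + 1) = X j >>> (m + 1) := fun i j h1 h2 m hm =>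
      Nat.shiftRight_eq_of_le (hK i j h1 h2) hm
    have goal : X 0 >>> (a 0 + 1) = X 1 >>> (a 0 + 1) ∧ X 1 >>> (a 1 + 1) = X 2 >>> (a 1 + 1) ∧
        X 2 >>> (a 2 + 1) = X 3 >>> (a 2 + 1) := by
      fin_cases d
      · exact ⟨f 0 1 (by decide) (by decide) _ (by rw [t01]; omega),
          f 1 2 (by decide) (by decide) _ (by rw [t12]; omega),
          f 2 3 (by decide) (by decide) _ (by rw [t23]; omega)⟩
      · have h01 := f 0 1 (by decide) (by decide)
        have h23 := f 2 3 (by decide) (by decide)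
        rw [t01] at h01
        rw [t23] at h23
        refine ⟨h01 _ (by omega), ?_, h23 _ (by omega)⟩
        rcases hd with hd | hd
        · exact (h01 (a 1) (by omega)).symm.trans
            (f 0 2 (by decide) (by decide) _ (by rw [t02]; omega))
        · exact (f 1 3 (by decide) (by decide) _ (by rw [t13]; omega)).trans
            (h23 (a 1) (by omega)).symm
      · obtain ⟨g1, g2⟩ := hd
        have h12 := f 1 2 (by decide) (by decide)
        rw [t12] at h12
        refine ⟨?_, h12 _ (by omega), ?_⟩
        · exact (f 0 2 (by decide) (by decide) _ (by rw [t02]; omega)).trans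
            (h12 (a 0) (by omega)).symm
        · exact (h12 (a 2) (by omega)).symm.trans
            (f 1 3 (by decide) (by decide) _ (by rw [t13]; omega))
    fin_cases k
    exacts [goal.1, goal.2.1, goal.2.2]

/-- The image of the pairing `d` under `σ`. -/
def dual (σ : Equiv.Perm (Fin 4)) (d : Fin 3) : Fin 3 :=
  if opp 0 (σ 0) = σ (opp d 0) then 0 else if opp 1 (σ 0) = σ (opp d 0) then 1 else 2

set_option maxRecDepth 10000 in
theorem dual_opp : ∀ σ d i, σ (opp d i) = opp (dual σ d) (σ i) := by decide

set_option maxRecDepth 10000 in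
theorem dual_injective : ∀ σ, Function.Injective (dual σ) := by decide

/-- The pairing `d` works both for the positions and for the values. -/
def Fits (σ : Equiv.Perm (Fin 4)) (a b : Fin 3 → ℕ) (d : Fin 3) : Prop :=
  Good d a ∧ Good (dual σ d) b

set_option maxRecDepth 100000 in
/-- Two sets of two out of three elements meet. -/
theorem exists_common : ∀ (f : Fin 3 → Fin 3) (A B : Fin 3 → Bool), Function.Injective f →
    (A 0 && (A 1 || A 2)) = true → (B 0 && (B 1 || B 2)) = true →
      ∃ d, A d = true ∧ B (f d) = true := by
  decide

/-- Two out of three pairings are good for the positions and two for the values, so that one of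
them is good for both. -/
theorem exists_fits (σ : Equiv.Perm (Fin 4)) (a b : Fin 3 → ℕ) : ∃ d, Fits σ a b d := by
  have h : ∀ a, (decide (Good 0 a) && (decide (Good 1 a) || decide (Good 2 a))) = true := by
    intro a
    simp only [Bool.and_eq_true, Bool.or_eq_true, decide_eq_true_eq]
    refine ⟨trivial, ?_⟩
    rcases le_total (a 0) (a 1) with h0 | h0
    · exact .inl (.inl h0)
    · rcases le_total (a 2) (a 1) with h2 | h2
      · exact .inl (.inr h2)
      · exact .inr ⟨h0, h2⟩
  obtain ⟨d, h1, h2⟩ := exists_common (dual σ) (fun d => decide (Good d a))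
    (fun d => decide (Good d b)) (dual_injective σ) (h a) (h b)
  exact ⟨d, by simpa using h1, by simpa using h2⟩

/-- The first pairing that works. -/
def Sel (σ : Equiv.Perm (Fin 4)) (a b : Fin 3 → ℕ) (d : Fin 3) : Prop :=
  Fits σ a b d ∧ ∀ d' < d, ¬ Fits σ a b d'

theorem existsUnique_sel (σ : Equiv.Perm (Fin 4)) (a b : Fin 3 → ℕ) : ∃! d, Sel σ a b d := by
  classical
  have hne : (Finset.univ.filter (Fits σ a b)).Nonempty := by
    obtain ⟨d, hd⟩ := exists_fits σ a b
    exact ⟨d, by simpa using hd⟩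
  have hm := Finset.min'_mem _ hne
  refine ⟨_, ⟨by simpa using hm, fun d' hd' h => ?_⟩, fun d hd => ?_⟩
  · exact absurd (Finset.min'_le _ d' (by simpa using h)) hd'.not_ge
  · refine le_antisymm (not_lt.1 fun h => hd.2 _ h (by simpa using hm)) ?_
    exact Finset.min'_le _ d (by simpa using hd.1)

variable {n : ℕ} (σ : Equiv.Perm (Fin 4)) (π : Equiv.Perm (Fin n)) (a b : Fin 3 → ℕ) (d : Fin 3)

/-- The part of a point that two consecutive points of the cyclic order have to share. -/
def key (t : Fin 4) (v : Fin n) : ℕ :=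
  ((v : ℕ) >>> (top a (cyc d t) (cyc d (t + 1)) + 1)) * n +
    (π v : ℕ) >>> (top b (σ (cyc d t)) (σ (cyc d (t + 1))) + 1)

theorem key_lt (t : Fin 4) (v : Fin n) : key σ π a b d t v < n * n := by
  unfold key
  have h1 := Nat.shiftRight_le (v : ℕ) (top a (cyc d t) (cyc d (t + 1)) + 1)
  have h2 := Nat.shiftRight_le (π v : ℕ) (top b (σ (cyc d t)) (σ (cyc d (t + 1))) + 1)
  have h3 := v.2
  have h4 := (π v).2
  calc _ < (v : ℕ) * n + n := by
        have := Nat.mul_le_mul_right n h1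
        omega
    _ = (v + 1) * n := by ring
    _ ≤ n * n := Nat.mul_le_mul_right _ h3

theorem key_eq_iff {t : Fin 4} {v w : Fin n} : key σ π a b d t v = key σ π a b d t w ↔
    (v : ℕ) >>> (top a (cyc d t) (cyc d (t + 1)) + 1)
      = (w : ℕ) >>> (top a (cyc d t) (cyc d (t + 1)) + 1) ∧
    (π v : ℕ) >>> (top b (σ (cyc d t)) (σ (cyc d (t + 1))) + 1)
      = (π w : ℕ) >>> (top b (σ (cyc d t)) (σ (cyc d (t + 1))) + 1) := by
  unfold key
  have h1 := (Nat.shiftRight_le (π v : ℕ) (top b (σ (cyc d t)) (σ (cyc d (t + 1))) + 1)).trans_lt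
    (π v).2
  have h2 := (Nat.shiftRight_le (π w : ℕ) (top b (σ (cyc d t)) (σ (cyc d (t + 1))) + 1)).trans_lt
    (π w).2
  constructor
  · intro h
    have e : ∀ x y : ℕ, y < n → (x * n + y) / n = x ∧ (x * n + y) % n = y := fun x y hy =>
      (Nat.div_mod_unique (by omega)).2 ⟨by ring, hy⟩
    have e1 := e ((v : ℕ) >>> (top a (cyc d t) (cyc d (t + 1)) + 1)) _ h1
    have e2 := e ((w : ℕ) >>> (top a (cyc d t) (cyc d (t + 1)) + 1)) _ h2
    rw [h] at e1
    exact ⟨e1.1.symm.trans e2.1, e1.2.symm.trans e2.2⟩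
  · rintro ⟨h3, h4⟩
    rw [h3, h4]

/-- The node of the layer `t` with the key `κ`. -/
def node (t : Fin 4) (κ : ℕ) (h : κ < n * n) : Fin (4 * (n * n)) :=
  ⟨t * (n * n) + κ, by
    have : (t : ℕ) * (n * n) ≤ 3 * (n * n) := Nat.mul_le_mul_right _ (by omega)
    omega⟩

theorem node_inj {t : Fin 4} {κ κ' : ℕ} {h : κ < n * n} {h' : κ' < n * n} :
    node t κ h = node t κ' h' ↔ κ = κ' := by
  simp [node]

/-- The points of the permutation as arcs between the keys that they share with their predecessor
and their successor. -/
def arcs : LayeredArcs n (4 * (n * n)) where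
  U t v := Ends (cyc d t) a v ∧ Ends (σ (cyc d t)) b (π v)
  src t v := node t (key σ π a b d (t + 3) v) (key_lt ..)
  dst t v := node (t + 1) (key σ π a b d t v) (key_lt ..)
  lay u := ⟨u / (n * n), Nat.div_lt_of_lt_mul (u.2.trans_eq (mul_comm _ _))⟩
  lay_src t v := by
    have h := key_lt σ π a b d (t + 3) v
    refine Fin.ext ?_
    simp only [node]
    rw [mul_comm, Nat.mul_add_div (by omega), Nat.div_eq_of_lt h, add_zero]
  lay_dst t v := by
    have h := key_lt σ π a b d t v
    refine Fin.ext ?_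
    simp only [node]
    rw [mul_comm, Nat.mul_add_div (by omega), Nat.div_eq_of_lt h, add_zero]

theorem cyc_adj : ∀ d t, cyc d t ≠ cyc d (t + 1) ∧ cyc d (t + 1) ≠ opp d (cyc d t) := by decide

theorem exists_cyc : ∀ d i j, i ≠ j → j ≠ opp d i → ∃ t, (i = cyc d t ∧ j = cyc d (t + 1)) ∨
    (j = cyc d t ∧ i = cyc d (t + 1)) := by decide

/-- Occurrences with given levels are closed sequences of arcs. -/
theorem card_chain (hd : Fits σ a b d) :
    Nat.card {p : Fin 4 → Fin n // Chain a (fun i => p i) ∧ Chain b fun r => π (p (σ.symm r))}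
      = Nat.card {q : Fin 4 → Fin n // ∀ t, (arcs σ π a b d).U t (q t) ∧
        (arcs σ π a b d).dst t (q t) = (arcs σ π a b d).src (t + 1) (q (t + 1))} := by
  refine Nat.card_congr (Equiv.subtypeEquiv (Equiv.arrowCongr (cyc d).symm (Equiv.refl _))
    fun p => ?_)
  have hq : ∀ t, (Equiv.arrowCongr (cyc d).symm (Equiv.refl (Fin n)) p) t = p (cyc d t) :=
    fun t => rfl
  have h4 : ∀ t : Fin 4, t + 1 + 3 = t := by decide
  simp only [hq]
  rw [chain_iff hd.1, chain_iff hd.2]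
  have harc : ∀ t, (arcs σ π a b d).dst t (p (cyc d t))
      = (arcs σ π a b d).src (t + 1) (p (cyc d (t + 1))) ↔
      key σ π a b d t (p (cyc d t)) = key σ π a b d t (p (cyc d (t + 1))) := by
    intro t
    simp only [arcs, node_inj, h4]
  simp only [harc, key_eq_iff]
  constructor
  · rintro ⟨⟨e1, k1⟩, e2, k2⟩ t
    refine ⟨⟨e1 _, ?_⟩, k1 _ _ (cyc_adj d t).1 (cyc_adj d t).2, ?_⟩
    · have := e2 (σ (cyc d t))
      rwa [σ.symm_apply_apply] at this
    · have := k2 (σ (cyc d t)) (σ (cyc d (t + 1))) (fun h => (cyc_adj d t).1 (σ.injective h))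
        (fun h => (cyc_adj d t).2 (σ.injective (by rw [dual_opp]; exact h)))
      simpa using this
  · intro h
    refine ⟨⟨fun i => ?_, fun i j h1 h2 => ?_⟩, fun r => ?_, fun r r' h1 h2 => ?_⟩
    · have := (h ((cyc d).symm i)).1.1
      simpa using this
    · obtain ⟨t, ⟨rfl, rfl⟩ | ⟨rfl, rfl⟩⟩ := exists_cyc d i j h1 h2
      · exact (h t).2.1
      · rw [top_comm]; exact (h t).2.1.symm
    · have := (h ((cyc d).symm (σ.symm r))).1.2
      simpa using this
    · obtain ⟨i, rfl⟩ := σ.surjective r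
      obtain ⟨j, rfl⟩ := σ.surjective r'
      rw [σ.symm_apply_apply, σ.symm_apply_apply]
      rw [← dual_opp] at h2
      obtain ⟨t, ⟨rfl, rfl⟩ | ⟨rfl, rfl⟩⟩ := exists_cyc d i j (fun h => h1 (by rw [h]))
        (fun h => h2 (by rw [h]))
      · exact (h t).2.2
      · rw [top_comm]; exact (h t).2.2.symm

theorem strictMono_iff_succ {X : Fin 4 → ℕ} :
    (∀ j j', j < j' ↔ X j < X j') ↔ ∀ k : Fin 3, X k.castSucc < X k.succ := by
  constructor
  · exact fun h k => (h _ _).1 (Fin.castSucc_lt_succ)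
  · intro h
    have := (Fin.strictMono_iff_lt_succ (f := X)).2 h
    exact fun j j' => this.lt_iff_lt.symm

theorem patternCount_eq_card : patternCount σ π = Nat.card {p : Fin 4 → Fin n //
    (∀ k : Fin 3, (p k.castSucc : ℕ) < p k.succ) ∧
      ∀ k : Fin 3, (π (p (σ.symm k.castSucc)) : ℕ) < π (p (σ.symm k.succ))} := by
  have h2 : ∀ p : Fin 4 → Fin n, (∀ j j', σ j < σ j' ↔ π (p j) < π (p j')) ↔
      ∀ k : Fin 3, (π (p (σ.symm k.castSucc)) : ℕ) < π (p (σ.symm k.succ)) := by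
    intro p
    rw [← strictMono_iff_succ (X := fun r => (π (p (σ.symm r)) : ℕ))]
    constructor
    · intro h r r'
      simpa using h (σ.symm r) (σ.symm r')
    · intro h j j'
      simpa using h (σ j) (σ j')
  exact Nat.card_congr
    { toFun := fun i => ⟨i.1, strictMono_iff_succ.1 fun j j' =>
        (i.1.lt_iff_lt (a := j) (b := j')).symm, (h2 _).1 i.2⟩
      invFun := fun p => ⟨OrderEmbedding.ofStrictMono p.1 (fun j j' h =>
        ((strictMono_iff_succ (X := fun i => (p.1 i : ℕ))).2 p.2.1 j j').1 h), (h2 _).2 p.2.2⟩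
      left_inv := fun i => rfl
      right_inv := fun p => rfl }

theorem existsUnique_chain {L : ℕ} {X : Fin 4 → ℕ} (hX : ∀ i, X i < 2 ^ L)
    (h : ∀ k : Fin 3, X k.castSucc < X k.succ) :
    ∃! a : Fin 3 → Fin L, Chain (fun k => a k) X := by
  choose l hl hs using fun k : Fin 3 => Nat.exists_splitAt (h k) (hX k.succ)
  exact ⟨fun k => ⟨l k, hl k⟩, hs, fun a ha => funext fun k => Fin.ext ((ha k).eq (hs k))⟩

open Classical in
/-- The number of occurrences of a pattern in terms of numbers of 4-cycles. -/
theorem patternCount_eq_sum {L : ℕ} (hL : n < 2 ^ L) : (patternCount σ π : ℤ)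
    = ∑ a : Fin 3 → Fin L, ∑ b : Fin 3 → Fin L, ∑ d : Fin 3,
      if Sel σ (fun k => a k) (fun k => b k) d then
        ∑ k : Fin 4 → Fin L, 2 ^ (∑ t, (k t : ℕ)) * ∑ S ∈ Finset.range 16,
          (-1) ^ (LayeredArcs.mask S).card *
            (((arcs σ π (fun k => a k) (fun k => b k) d).simpleGraph (fun t => k t) S).copyCount
              (SimpleGraph.cycleGraph 4) : ℤ)
      else 0 := by
  have hlt : ∀ v : Fin n, (v : ℕ) < 2 ^ L := fun v => v.2.trans hL
  have h1 := Nat.card_eq_sum_of_existsUnique (α := Fin 4 → Fin n)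
    (C := (Fin 3 → Fin L) × (Fin 3 → Fin L))
    (P := fun p => (∀ k : Fin 3, (p k.castSucc : ℕ) < p k.succ) ∧
      ∀ k : Fin 3, (π (p (σ.symm k.castSucc)) : ℕ) < π (p (σ.symm k.succ)))
    (R := fun c p => Chain (fun k => c.1 k) (fun i => p i) ∧
      Chain (fun k => c.2 k) fun r => π (p (σ.symm r)))
    (fun c p h => ⟨fun k => (h.1 k).lt, fun k => (h.2 k).lt⟩)
    (fun p h => by
      obtain ⟨a, ha, ua⟩ := existsUnique_chain (X := fun i => (p i : ℕ)) (fun i => hlt _) h.1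
      obtain ⟨b, hb, ub⟩ := existsUnique_chain (X := fun r => (π (p (σ.symm r)) : ℕ))
        (fun i => hlt _) h.2
      exact ⟨(a, b), ⟨ha, hb⟩, fun c hc => Prod.ext (ua _ hc.1) (ub _ hc.2)⟩)
  rw [patternCount_eq_card, h1, Fintype.sum_prod_type]
  push_cast
  refine Finset.sum_congr rfl fun a _ => Finset.sum_congr rfl fun b _ => ?_
  obtain ⟨d, hd, ud⟩ := existsUnique_sel σ (fun k => a k) (fun k => b k)
  rw [Finset.sum_eq_single d (fun d' _ h => if_neg fun h' => h (ud d' h')) (by simp), if_pos hd,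
    card_chain σ π _ _ d hd.1, LayeredArcs.card_closed _ hL]

end Levels


/-! ### Writing down the edges of one layer -/

namespace WExpr

/-- The bit of `x` with the number `l`. -/
def bit (l x : WExpr) : WExpr := .bin .mod (.bin .shr x l) (.lit 2)

/-- The negation of a truth value. -/
def not (e : WExpr) : WExpr := .bin .sub (.lit 1) e

/-- The conjunction of a list of truth values. -/
def all (l : List WExpr) : WExpr := l.foldr (.bin .mul) (.lit 1)

/-- The maximum. -/
def sup (a b : WExpr) : WExpr := .bin .add a (.bin .sub b a)

theorem eval_bit (s : MemState) (l x : WExpr) :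
    (bit l x).eval s = ((x.eval s).testBit (l.eval s)).toNat := by
  simp only [bit, eval, WordOp.eval, Nat.shiftRight_eq_div_pow, Nat.toNat_testBit]

theorem eval_not {s : MemState} {e : WExpr} : (not e).eval s ≠ 0 ↔ e.eval s = 0 := by
  simp only [not, eval, WordOp.eval]
  omega

theorem eval_all {s : MemState} {l : List WExpr} :
    (all l).eval s ≠ 0 ↔ ∀ e ∈ l, e.eval s ≠ 0 := by
  induction l with
  | nil => simp [all, eval]
  | cons e l ih =>
    rw [List.forall_mem_cons, ← ih]
    exact Nat.mul_ne_zero_iff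

theorem eval_sup (s : MemState) (a b : WExpr) : (sup a b).eval s = max (a.eval s) (b.eval s) := by
  simp only [sup, eval, WordOp.eval]
  omega

end WExpr

namespace PatternReduction

open WCmd WExpr

variable {ρ : ℕ → ℕ} {CallOk : MemState → ℕ → Prop}

/-- Clears the counters. -/
def clearLoop (eP : WExpr) : WCmd := .loop 5 0 (.store 4 eP (.lit 0))

/-- Counts the arcs of every class and notes the last one. -/
def countLoop (eU eP : WExpr) : WCmd :=
  .loop 5 0 (.ite eU
    (.seq (.store 4 eP (.mods (.bin .add (.get 4 eP) (.lit 1)) (.var 0))) (.store 5 eP (.var 5)))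
    .skip)

/-- Lists the end points of the last arcs of those classes whose number of arcs has the bit `eB`. -/
def emitLoop (eU eP eS eD eB : WExpr) : WCmd :=
  .loop 5 0 (.ite (.all [eU, .bin .eq (.get 5 eP) (.var 5), .bit eB (.get 4 eP)])
    (.seq (.store 2 (.var 1) eS) (.seq (.store 3 (.var 1) eD)
      (.assign 1 (.mods (.bin .add (.var 1) (.lit 1)) (.bin .mul (.lit 4) (.var 0))))))
    .skip)

/-- The arrays `2` and `3` hold the list `l`, the register `1` its length. -/
def Holds (s : MemState) (l : List (ℕ × ℕ)) : Prop :=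
  s.reg 1 = l.length ∧ ∀ i (h : i < l.length), s.arr 2 i = l[i].1 ∧ s.arr 3 i = l[i].2

/-- The states agree except for the memory that the loops of a layer use. -/
def Same (s s' : MemState) : Prop :=
  (∀ r, r ∉ [1, 5] → s'.reg r = s.reg r) ∧ ∀ A, A ∉ [2, 3, 4, 5] → s'.arr A = s.arr A

theorem Same.of_frame {c : WCmd} {s s1 s2 : MemState} (h : Same s s1) (hf : Frame c s1 s2)
    (hr : ∀ r ∈ c.wr, r ∈ [1, 5]) (hA : ∀ A ∈ c.wa, A ∈ [2, 3, 4, 5]) : Same s s2 :=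
  ⟨fun r h' => (hf.1 r fun h'' => h' (hr r h'')).trans (h.1 r h'),
    fun A h' => (hf.2 A fun h'' => h' (hA A h'')).trans (h.2 A h')⟩

theorem Same.refl (s : MemState) : Same s s := ⟨fun _ _ => rfl, fun _ _ => rfl⟩

theorem Same.setReg {s s' : MemState} (h : Same s s') (x : ℕ) : Same s (s'.setReg 5 x) :=
  ⟨fun r hr => by
    rw [MemState.setReg_reg_of_ne _ _ (by rintro rfl; simp at hr)]; exact h.1 r hr, h.2⟩

theorem Same.setCell {s s' : MemState} (h : Same s s') {A : ℕ} (hA : A ∈ [2, 3, 4, 5]) (i x : ℕ) :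
    Same s (s'.setCell A i x) :=
  ⟨h.1, fun B hB => by
    rw [MemState.setCell_arr_of_ne _ _ _ (by rintro rfl; exact hB hA)]; exact h.2 B hB⟩

theorem card_filter_lt_succ {n : ℕ} (p : Fin n → Prop) [DecidablePred p] {k : ℕ} (hk : k < n) :
    (Finset.univ.filter fun w : Fin n => (w : ℕ) < k + 1 ∧ p w).card
      = (Finset.univ.filter fun w : Fin n => (w : ℕ) < k ∧ p w).card
        + if p ⟨k, hk⟩ then 1 else 0 := by
  have h : (Finset.univ.filter fun w : Fin n => (w : ℕ) < k + 1 ∧ p w)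
      = (Finset.univ.filter fun w : Fin n => (w : ℕ) < k ∧ p w) ∪
        if p ⟨k, hk⟩ then {⟨k, hk⟩} else ∅ := by
    ext w
    have : (w : ℕ) < k + 1 ↔ (w : ℕ) < k ∨ w = ⟨k, hk⟩ := by
      rw [Nat.lt_succ_iff_lt_or_eq, Fin.ext_iff]
    by_cases hp : p ⟨k, hk⟩
    · simp only [Finset.mem_filter, Finset.mem_univ, true_and, this, hp, if_true, Finset.mem_union,
        Finset.mem_singleton]
      constructor
      · rintro ⟨h | h, h'⟩
        exacts [.inl ⟨h, h'⟩, .inr h]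
      · rintro (⟨h, h'⟩ | rfl)
        exacts [⟨.inl h, h'⟩, ⟨.inr rfl, hp⟩]
    · simp only [Finset.mem_filter, Finset.mem_univ, true_and, this, hp, if_false,
        Finset.union_empty]
      constructor
      · rintro ⟨h | rfl, h'⟩
        exacts [⟨h, h'⟩, absurd h' hp]
      · exact fun h => ⟨.inl h.1, h.2⟩
  rw [h, Finset.card_union_of_disjoint]
  · split_ifs <;> simp
  · split_ifs
    · simp
    · simp

section layer

variable {n : ℕ} {s0 : MemState} {U : Fin n → Prop} {P S D : Fin n → ℕ} {eU eP eS eD eB : WExpr}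
  {kb : ℕ}

theorem clearLoop_wp (hn : s0.reg 0 = n) (hρ : n ≤ ρ 0)
    (hP : ∀ s (v : Fin n), Same s0 s → s.reg 5 = v → eP.eval s = P v) {s : MemState}
    (hs : Same s0 s) : (clearLoop eP).wp ρ CallOk (fun s' => ∀ v, s'.arr 4 (P v) = 0) s := by
  have r0 : s.reg 0 = n := by rw [hs.1 0 (by simp), hn]
  refine ⟨by omega, fun k s' => ∀ v : Fin n, (v : ℕ) < k → s'.arr 4 (P v) = 0, by simp, ?_, ?_⟩
  · intro k s' hk hf h v hv
    rw [r0] at hk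
    have hs' : Same s0 s' := hs.of_frame hf (by simp [wr]) (by simp [wa])
    have e := hP _ ⟨k, hk⟩ (hs'.setReg k) (MemState.setReg_reg_self _ _ _)
    rw [MemState.setCell_arr, e, eval]
    split_ifs with hc
    · rfl
    · refine h v (lt_of_le_of_ne (Nat.lt_succ_iff.1 hv) ?_)
      rintro rfl
      exact hc ⟨rfl, rfl⟩
  · intro s' _ h v
    exact h v (by rw [r0]; exact v.2)

open Classical in
theorem countLoop_wp (hn : s0.reg 0 = n) (hρ : n ≤ ρ 0)
    (hP : ∀ s (v : Fin n), Same s0 s → s.reg 5 = v → eP.eval s = P v)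
    (hU : ∀ s (v : Fin n), Same s0 s → s.reg 5 = v → (eU.eval s ≠ 0 ↔ U v)) {s : MemState}
    (hs : Same s0 s) (h0 : ∀ v, s.arr 4 (P v) = 0) :
    (countLoop eU eP).wp ρ CallOk (fun s' => ∀ v,
      s'.arr 4 (P v) = (Finset.univ.filter fun w => U w ∧ P w = P v).card ∧
      (U v → (s'.arr 5 (P v) = v ↔ ∀ w, v < w → U w → P w ≠ P v))) s := by
  have r0 : s.reg 0 = n := by rw [hs.1 0 (by simp), hn]
  refine ⟨by omega, fun k s' => ∀ v : Fin n,
    s'.arr 4 (P v) = (Finset.univ.filter fun w : Fin n => (w : ℕ) < k ∧ U w ∧ P w = P v).card ∧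
      ((v : ℕ) < k → U v →
        (s'.arr 5 (P v) = v ↔ ∀ w, v < w → (w : ℕ) < k → U w → P w ≠ P v)), ?_, ?_, ?_⟩
  · intro v
    simp [h0]
  · intro k s' hk hf h
    rw [r0] at hk
    have hs' : Same s0 s' := hs.of_frame hf (by simp [wr]) (by simp [wa])
    have r5 : (s'.setReg 5 k).reg 5 = (⟨k, hk⟩ : Fin n) := MemState.setReg_reg_self _ _ _
    have hs1 := hs'.setReg k
    have r0' : (s'.setReg 5 k).reg 0 = n := by rw [hs1.1 0 (by simp), hn]
    refine ⟨fun hne => ?_, fun hz v => ?_⟩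
    · have hu := (hU _ ⟨k, hk⟩ hs1 r5).1 hne
      have e1 := hP _ ⟨k, hk⟩ hs1 r5
      simp only [wp]
      have hs2 := hs1.setCell (A := 4) (by simp) (eP.eval (s'.setReg 5 k))
        ((WExpr.mods (.bin .add (.get 4 eP) (.lit 1)) (.var 0)).eval (s'.setReg 5 k))
      have e2 := hP _ ⟨k, hk⟩ hs2 r5
      rw [e2]
      intro v
      have hle : (Finset.univ.filter fun w : Fin n => (w : ℕ) < k ∧ U w ∧ P w = P ⟨k, hk⟩).card
          ≤ k := by
        calc _ ≤ (Finset.univ.filter fun w : Fin n => (w : ℕ) < k).card :=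
              Finset.card_le_card fun w hw => by
                simp only [Finset.mem_filter] at hw ⊢
                exact ⟨hw.1, hw.2.1⟩
          _ ≤ (Finset.range k).card := Finset.card_le_card_of_injOn (fun w => (w : ℕ))
              (fun w hw => by simpa using hw) (fun a _ b _ h => Fin.ext h)
          _ = k := Finset.card_range k
      have e3 : (WExpr.mods (.bin .add (.get 4 eP) (.lit 1)) (.var 0)).eval (s'.setReg 5 k)
          = (Finset.univ.filter fun w : Fin n => (w : ℕ) < k ∧ U w ∧ P w = P ⟨k, hk⟩).card + 1 := by
        simp only [eval, WordOp.eval, e1, r0', MemState.setReg_arr, (h ⟨k, hk⟩).1]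
        exact Nat.mod_eq_of_lt (by omega)
      rw [e3, e1]
      constructor
      · rw [MemState.setCell_arr_of_ne _ _ _ (by norm_num), MemState.setCell_arr,
          card_filter_lt_succ _ hk]
        by_cases hv : P v = P ⟨k, hk⟩
        · rw [if_pos ⟨rfl, hv⟩, if_pos ⟨hu, hv.symm⟩]
          simp only [hv]
        · rw [if_neg (fun h => hv h.2), if_neg (fun h => hv h.2.symm), add_zero]
          exact (h v).1
      · intro hvk huv
        rw [MemState.setCell_arr]
        simp only [true_and]
        have e4 : (WExpr.var 5).eval ((s'.setReg 5 k).setCell 4 (P ⟨k, hk⟩)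
            ((Finset.univ.filter fun w : Fin n => (w : ℕ) < k ∧ U w ∧ P w = P ⟨k, hk⟩).card + 1))
              = k := r5
        rw [e4]
        rcases Nat.lt_succ_iff_lt_or_eq.1 hvk with hvk | hvk
        · by_cases hv : P v = P ⟨k, hk⟩
          · rw [if_pos hv]
            refine iff_of_false (by omega) fun h => ?_
            exact h ⟨k, hk⟩ hvk (Nat.lt_succ_self k) hu hv.symm
          · rw [if_neg hv, MemState.setCell_arr_of_ne _ _ _ (by norm_num), MemState.setReg_arr,
              (h v).2 hvk huv]
            refine forall_congr' fun w => imp_congr_right fun hw => ⟨fun g hwk hUw => ?_,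
              fun g hwk => g (by omega)⟩
            rcases Nat.lt_succ_iff_lt_or_eq.1 hwk with hwk | hwk
            · exact g hwk hUw
            · rw [show w = ⟨k, hk⟩ from Fin.ext hwk]; exact Ne.symm hv
        · have : v = ⟨k, hk⟩ := Fin.ext hvk
          rw [if_pos (by rw [this])]
          refine iff_of_true hvk.symm fun w hw hwk => ?_
          have : (v : ℕ) < w := hw
          omega
    · have hu : ¬ U ⟨k, hk⟩ := fun hu => (hU _ ⟨k, hk⟩ hs1 r5).2 hu hz
      constructor
      · rw [card_filter_lt_succ _ hk, if_neg (fun h => hu h.1)]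
        exact (h v).1
      · intro hvk huv
        have hvk' : (v : ℕ) < k := lt_of_le_of_ne (Nat.lt_succ_iff.1 hvk) (by
          rintro rfl; exact hu huv)
        rw [MemState.setReg_arr, (h v).2 hvk' huv]
        refine forall_congr' fun w => imp_congr_right fun hw => ⟨fun g hwk hUw => ?_,
          fun g hwk => g (by omega)⟩
        rcases Nat.lt_succ_iff_lt_or_eq.1 hwk with hwk | rfl
        · exact g hwk hUw
        · exact absurd hUw hu
  · intro s' _ h v
    rw [r0] at h
    have := h v
    simpa using this

theorem Holds.append {s : MemState} {l : List (ℕ × ℕ)} (h : Holds s l) (x y : ℕ) {m : ℕ}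
    (hm : m = l.length + 1) :
    Holds (((s.setCell 2 (s.reg 1) x).setCell 3 (s.reg 1) y).setReg 1 m) (l ++ [(x, y)]) := by
  refine ⟨by simp [hm], fun i hi => ?_⟩
  rw [MemState.setReg_arr, MemState.setCell_arr_of_ne (A' := 2) _ _ _ (by norm_num),
    MemState.setCell_arr, MemState.setCell_arr,
    MemState.setCell_arr_of_ne (A' := 3) _ _ _ (by norm_num), h.1]
  simp only [true_and]
  by_cases hl : i = l.length
  · subst hl
    simp
  · have hi' : i < l.length := by simp at hi; omega
    rw [if_neg hl, if_neg hl, List.getElem_append_left hi']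
    exact h.2 i hi'

open Classical in
theorem emitLoop_wp (hn : s0.reg 0 = n) (hρ : n ≤ ρ 0)
    (hP : ∀ s (v : Fin n), Same s0 s → s.reg 5 = v → eP.eval s = P v)
    (hU : ∀ s (v : Fin n), Same s0 s → s.reg 5 = v → (eU.eval s ≠ 0 ↔ U v))
    (hS : ∀ s (v : Fin n), Same s0 s → s.reg 5 = v → eS.eval s = S v)
    (hD : ∀ s (v : Fin n), Same s0 s → s.reg 5 = v → eD.eval s = D v)
    (hB : ∀ s, Same s0 s → eB.eval s = kb) {s : MemState} (hs : Same s0 s)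
    (h4 : ∀ v, s.arr 4 (P v) = (Finset.univ.filter fun w => U w ∧ P w = P v).card ∧
      (U v → (s.arr 5 (P v) = v ↔ ∀ w, v < w → U w → P w ≠ P v)))
    {l : List (ℕ × ℕ)} (hl : l.length ≤ 3 * n) (hh : Holds s l) :
    (emitLoop eU eP eS eD eB).wp ρ CallOk (fun s' => Holds s' (l ++ ((List.finRange n).filter
      fun v => U v ∧ (∀ w, v < w → U w → P w ≠ P v) ∧
        ((Finset.univ.filter fun w => U w ∧ P w = P v).card.testBit kb = true)).map
          fun v => (S v, D v))) s := by
  set q : Fin n → Bool := fun v => U v ∧ (∀ w, v < w → U w → P w ≠ P v) ∧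
    ((Finset.univ.filter fun w => U w ∧ P w = P v).card.testBit kb = true) with hq
  have r0 : s.reg 0 = n := by rw [hs.1 0 (by simp), hn]
  refine ⟨by omega, fun k s' => Holds s' (l ++ (((List.finRange n).take k).filter q).map
    fun v => (S v, D v)), by simpa using hh, ?_, ?_⟩
  · intro k s' hk hf h
    rw [r0] at hk
    have hs' : Same s0 s' := hs.of_frame hf (by simp [wr]) (by simp [wa])
    have r5 : (s'.setReg 5 k).reg 5 = (⟨k, hk⟩ : Fin n) := MemState.setReg_reg_self _ _ _
    have hs1 := hs'.setReg k
    have r0' : (s'.setReg 5 k).reg 0 = n := by rw [hs1.1 0 (by simp), hn]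
    have r1 : (s'.setReg 5 k).reg 1 = s'.reg 1 := MemState.setReg_reg_of_ne _ _ (by norm_num)
    have a4 : s'.arr 4 = s.arr 4 := hf.2 4 (by simp [wa])
    have a5 : s'.arr 5 = s.arr 5 := hf.2 5 (by simp [wa])
    have htake : (List.finRange n).take (k + 1) = (List.finRange n).take k ++ [⟨k, hk⟩] := by
      rw [List.take_add_one, List.getElem?_eq_getElem (by simpa using hk)]
      simp
    have hcond : (WExpr.all [eU, .bin .eq (.get 5 eP) (.var 5), .bit eB (.get 4 eP)]).eval
        (s'.setReg 5 k) ≠ 0 ↔ q ⟨k, hk⟩ = true := by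
      have e1 : (WExpr.bin .eq (.get 5 eP) (.var 5)).eval (s'.setReg 5 k) ≠ 0 ↔
          s.arr 5 (P ⟨k, hk⟩) = k := by
        simp only [eval, WordOp.eval, hP _ ⟨k, hk⟩ hs1 r5, MemState.setReg_arr, a5, r5]
        simp
      have e2 : (WExpr.bit eB (.get 4 eP)).eval (s'.setReg 5 k) ≠ 0 ↔
          (Finset.univ.filter fun w => U w ∧ P w = P ⟨k, hk⟩).card.testBit kb = true := by
        rw [eval_bit, eval, hP _ ⟨k, hk⟩ hs1 r5, MemState.setReg_arr, a4, (h4 _).1, hB _ hs1]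
        cases Nat.testBit _ _ <;> simp
      rw [eval_all]
      simp only [List.forall_mem_cons, List.not_mem_nil, IsEmpty.forall_iff, implies_true, and_true,
        e1, e2, hU _ ⟨k, hk⟩ hs1 r5, hq, decide_eq_true_eq]
      constructor
      · rintro ⟨g1, g2, g3⟩
        exact ⟨g1, ((h4 _).2 g1).1 g2, g3⟩
      · rintro ⟨g1, g2, g3⟩
        exact ⟨g1, ((h4 _).2 g1).2 g2, g3⟩
    beta_reduce
    rw [htake, List.filter_append, List.map_append, ← List.append_assoc]
    refine ⟨fun hne => ?_, fun hz => ?_⟩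
    · have hq1 := hcond.1 hne
      have hs2 := hs1.setCell (A := 2) (by simp) (s'.reg 1) (S ⟨k, hk⟩)
      simp only [wp]
      rw [show (WExpr.var 1).eval (s'.setReg 5 k) = s'.reg 1 from r1, hS _ ⟨k, hk⟩ hs1 r5,
        show (WExpr.var 1).eval ((s'.setReg 5 k).setCell 2 (s'.reg 1) (S ⟨k, hk⟩)) = s'.reg 1
          from r1, hD _ ⟨k, hk⟩ hs2 r5]
      have := Holds.append (s := s'.setReg 5 k) (x := S ⟨k, hk⟩) (y := D ⟨k, hk⟩)
        (m := (l ++ (((List.finRange n).take k).filter q).map fun v => (S v, D v)).length + 1)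
        ⟨r1.trans h.1, h.2⟩ rfl
      rw [r1] at this
      simp only [List.filter_cons, hq1, if_true, List.filter_nil, List.map_cons, List.map_nil]
      convert this using 2
      simp only [eval, WordOp.eval, MemState.setCell_reg, r1, r0', h.1]
      refine Nat.mod_eq_of_lt ?_
      rw [List.length_append, List.length_map]
      have h1 := List.length_filter_le q ((List.finRange n).take k)
      have h2 : ((List.finRange n).take k).length ≤ k := by simp
      omega
    · have hq0 : q ⟨k, hk⟩ = false := by
        by_contra hc
        exact hcond.2 (by simpa using hc) hz
      simp only [List.filter_cons, hq0, Bool.false_eq_true, if_false, List.filter_nil,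
        List.map_nil, List.append_nil]
      exact ⟨r1.trans h.1, h.2⟩
  · intro s' _ h
    rw [r0] at h ⊢
    rw [List.take_of_length_le (by simp)] at h
    exact ⟨by rw [MemState.setReg_reg_of_ne _ _ (by norm_num)]; exact h.1, h.2⟩

end layer

end PatternReduction


/-! ### The expressions for levels and keys -/

namespace PatternReduction

open WCmd WExpr Levels

/-- The expression for `Levels.top`; the levels are kept in the registers from `r` on. -/
def topExpr (r : ℕ) (i j : Fin 4) : WExpr :=
  ((List.finRange 3).filter fun k => min i j ≤ k.castSucc ∧ k.castSucc < max i j).foldr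
    (fun (k : Fin 3) e => .sup (.var (r + k)) e) (.lit 0)

/-- The tests that make up `Levels.Ends`. -/
def endsExprs (r : ℕ) (i : Fin 4) (x : WExpr) : List WExpr :=
  (List.finRange 3).flatMap fun k =>
    (if k.castSucc = i then [.not (.bit (.var (r + k)) x)] else []) ++
      if k.succ = i then [.bit (.var (r + k)) x] else []

/-- The test whether the register `x` is at most the register `y`. -/
def leExpr (x y : ℕ) : WExpr := .not (.bin .lt (.var y) (.var x))

/-- The test for `Levels.Good`. -/
def goodExpr (r : ℕ) : Fin 3 → WExpr
  | 0 => .lit 1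
  | 1 => .bin .add (leExpr r (r + 1)) (leExpr (r + 2) (r + 1))
  | 2 => .all [leExpr (r + 1) r, leExpr (r + 1) (r + 2)]

/-- The test for `Levels.Fits`. -/
def fitsExpr (σ : Equiv.Perm (Fin 4)) (d : Fin 3) : WExpr :=
  .all [goodExpr 20 d, goodExpr 23 (dual σ d)]

/-- The test for `Levels.Sel`. -/
def selExpr (σ : Equiv.Perm (Fin 4)) (d : Fin 3) : WExpr :=
  .all (fitsExpr σ d :: ((List.finRange 3).filter (· < d)).map fun d' => .not (fitsExpr σ d'))

/-- The expression for `Levels.key`, for the point with the number in the register `5`. -/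
def keyExpr (σ : Equiv.Perm (Fin 4)) (d : Fin 3) (t : Fin 4) : WExpr :=
  .bin .add (.bin .mul (.bin .shr (.var 5) (.bin .add (topExpr 20 (cyc d t) (cyc d (t + 1)))
    (.lit 1))) (.var 0)) (.bin .shr (.get 0 (.var 5)) (.bin .add (topExpr 23 (σ (cyc d t))
      (σ (cyc d (t + 1)))) (.lit 1)))

/-- The test whether the point with the number in the register `5` is present in the layer `t`. -/
def presentExpr (σ : Equiv.Perm (Fin 4)) (d : Fin 3) (t : Fin 4) : WExpr :=
  .all (endsExprs 20 (cyc d t) (.var 5) ++ endsExprs 23 (σ (cyc d t)) (.get 0 (.var 5)))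

/-- The expression for the node of the layer `t` with the key `e`. -/
def nodeExpr (t : Fin 4) (e : WExpr) : WExpr :=
  .bin .add (.bin .mul (.lit t) (.bin .mul (.var 0) (.var 0))) e

/-- The expression for the address that belongs to the class of an arc: the pair of the keys at its
end points as a single number. -/
def classExpr (σ : Equiv.Perm (Fin 4)) (d : Fin 3) (t : Fin 4) : WExpr :=
  .bin .add (.bin .mul (keyExpr σ d (t + 3)) (.bin .mul (.var 0) (.var 0))) (keyExpr σ d t)

theorem eval_topExpr (s : MemState) (r : ℕ) (i j : Fin 4) :
    (topExpr r i j).eval s = top (fun k => s.reg (r + k)) i j := by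
  unfold topExpr top
  generalize (List.finRange 3).filter _ = l
  induction l with
  | nil => rfl
  | cons k l ih => rw [List.foldr_cons, List.foldr_cons, eval_sup, ih]; rfl

theorem eval_endsExprs {s : MemState} {r : ℕ} {i : Fin 4} {x : WExpr} :
    (∀ e ∈ endsExprs r i x, e.eval s ≠ 0) ↔ Ends i (fun k => s.reg (r + k)) (x.eval s) := by
  have h1 : ∀ k : Fin 3, (WExpr.not (.bit (.var (r + k)) x)).eval s ≠ 0 ↔
      (x.eval s).testBit (s.reg (r + k)) = false := by
    intro k
    rw [eval_not, eval_bit]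
    simp [eval]
  have h2 : ∀ k : Fin 3, (WExpr.bit (.var (r + k)) x).eval s ≠ 0 ↔
      (x.eval s).testBit (s.reg (r + k)) = true := by
    intro k
    rw [eval_bit]
    simp [eval]
  simp only [endsExprs, List.mem_flatMap, List.mem_finRange, true_and, List.mem_append, Ends,
    forall_exists_index]
  constructor
  · intro h
    exact ⟨fun k hk => (h1 k).1 (h _ k (.inl (by simp [hk]))),
      fun k hk => (h2 k).1 (h _ k (.inr (by simp [hk])))⟩
  · rintro ⟨g1, g2⟩ e k (he | he)
    · split_ifs at he with hk
      · rw [List.mem_singleton.1 he, h1]; exact g1 k hk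
      · simp at he
    · split_ifs at he with hk
      · rw [List.mem_singleton.1 he, h2]; exact g2 k hk
      · simp at he

theorem eval_leExpr {s : MemState} {x y : ℕ} : (leExpr x y).eval s ≠ 0 ↔ s.reg x ≤ s.reg y := by
  rw [leExpr, eval_not]
  simp only [eval, WordOp.eval]
  by_cases h : s.reg y < s.reg x
  · simp [h]
  · simp [h, not_lt.1 h]

theorem eval_goodExpr {s : MemState} {r : ℕ} {d : Fin 3} :
    (goodExpr r d).eval s ≠ 0 ↔ Good d fun k => s.reg (r + k) := by
  fin_cases d
  · simp [goodExpr, Good, eval]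
  · have h : (goodExpr r 1).eval s ≠ 0 ↔
        (leExpr r (r + 1)).eval s ≠ 0 ∨ (leExpr (r + 2) (r + 1)).eval s ≠ 0 := by
      simp only [goodExpr, eval, WordOp.eval]
      omega
    exact h.trans (or_congr eval_leExpr eval_leExpr)
  · refine (eval_all (l := [leExpr (r + 1) r, leExpr (r + 1) (r + 2)])).trans ?_
    simp only [List.forall_mem_cons, List.not_mem_nil, IsEmpty.forall_iff, implies_true, and_true,
      eval_leExpr]
    rfl

theorem eval_fitsExpr {s : MemState} {σ : Equiv.Perm (Fin 4)} {d : Fin 3} :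
    (fitsExpr σ d).eval s ≠ 0 ↔
      Fits σ (fun k => s.reg (20 + k)) (fun k => s.reg (23 + k)) d := by
  rw [fitsExpr, eval_all]
  simp only [List.forall_mem_cons, List.not_mem_nil, IsEmpty.forall_iff, implies_true, and_true,
    eval_goodExpr]
  rfl

theorem eval_selExpr {s : MemState} {σ : Equiv.Perm (Fin 4)} {d : Fin 3} :
    (selExpr σ d).eval s ≠ 0 ↔
      Sel σ (fun k => s.reg (20 + k)) (fun k => s.reg (23 + k)) d := by
  rw [selExpr, eval_all, List.forall_mem_cons, eval_fitsExpr]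
  refine and_congr_right fun _ => ?_
  simp only [List.forall_mem_map, List.mem_filter, List.mem_finRange, true_and, decide_eq_true_eq]
  refine forall_congr' fun d' => imp_congr_right fun _ => ?_
  rw [eval_not, ← eval_fitsExpr, not_not]

/-- The input and the selected levels `a`, `b` and bits `k` are in memory, together with the powers
of two that belong to the bits. -/
structure Ready {n : ℕ} (π : Equiv.Perm (Fin n)) (a b : Fin 3 → ℕ) (k : Fin 4 → ℕ)
    (s : MemState) : Prop where
  len : s.reg 0 = n
  val : ∀ v : Fin n, s.arr 0 v = π v
  posLevel : ∀ i : Fin 3, s.reg (20 + i) = a i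
  valLevel : ∀ i : Fin 3, s.reg (23 + i) = b i
  bitIndex : ∀ t : Fin 4, s.reg (26 + t) = k t
  pow : ∀ t : Fin 4, s.arr 6 (k t) = 2 ^ k t

section layer

variable {n : ℕ} {π : Equiv.Perm (Fin n)} {a b : Fin 3 → ℕ} {k : Fin 4 → ℕ} {s s' : MemState}

theorem Ready.congr (h : Ready π a b k s) (hr : ∀ r, r ∉ [1, 3, 4, 5] → s'.reg r = s.reg r)
    (hA : ∀ A, A ∉ [2, 3, 4, 5] → s'.arr A = s.arr A) : Ready π a b k s' where
  len := (hr 0 (by simp)).trans h.len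
  val v := by rw [hA 0 (by simp)]; exact h.val v
  posLevel i := (hr _ (by simp; omega)).trans (h.posLevel i)
  valLevel i := (hr _ (by simp; omega)).trans (h.valLevel i)
  bitIndex i := (hr _ (by simp; omega)).trans (h.bitIndex i)
  pow t := by rw [hA 6 (by simp)]; exact h.pow t

theorem Ready.same (h : Ready π a b k s) (hs : Same s s') : Ready π a b k s' :=
  h.congr (fun r hr => hs.1 r (by simp at hr ⊢; omega)) hs.2

variable (σ : Equiv.Perm (Fin 4)) (d : Fin 3) (t : Fin 4)

theorem eval_keyExpr (h : Ready π a b k s) {v : Fin n} (h5 : s.reg 5 = v) :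
    (keyExpr σ d t).eval s = key σ π a b d t v := by
  simp only [keyExpr, eval, WordOp.eval, eval_topExpr, h5, h.len, h.val, h.posLevel, h.valLevel,
    key]

theorem eval_presentExpr (h : Ready π a b k s) {v : Fin n} (h5 : s.reg 5 = v) :
    (presentExpr σ d t).eval s ≠ 0 ↔ (arcs σ π a b d).U t v := by
  rw [presentExpr, eval_all, List.forall_mem_append, eval_endsExprs, eval_endsExprs]
  simp only [eval, h5, h.val, h.posLevel, h.valLevel]
  rfl

theorem eval_nodeExpr (h : Ready π a b k s) (e : WExpr) :
    (nodeExpr t e).eval s = t * (n * n) + e.eval s := by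
  simp only [nodeExpr, eval, WordOp.eval, h.len]

theorem eval_classExpr (h : Ready π a b k s) {v : Fin n} (h5 : s.reg 5 = v) :
    (classExpr σ d t).eval s = key σ π a b d (t + 3) v * (n * n) + key σ π a b d t v := by
  simp only [classExpr, eval, WordOp.eval, h.len, eval_keyExpr σ d _ h h5]

/-- Two arcs of a layer are parallel if and only if they belong to the same address. -/
theorem class_eq_iff {v w : Fin n} :
    key σ π a b d (t + 3) w * (n * n) + key σ π a b d t w
      = key σ π a b d (t + 3) v * (n * n) + key σ π a b d t v ↔
    (arcs σ π a b d).src t w = (arcs σ π a b d).src t v ∧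
      (arcs σ π a b d).dst t w = (arcs σ π a b d).dst t v := by
  simp only [arcs, node_inj]
  have h1 := key_lt σ π a b d t v
  have h2 := key_lt σ π a b d t w
  constructor
  · intro h
    have e : ∀ x y : ℕ, y < n * n → (x * (n * n) + y) / (n * n) = x ∧
        (x * (n * n) + y) % (n * n) = y := fun x y hy =>
      (Nat.div_mod_unique (by omega)).2 ⟨by ring, hy⟩
    have e1 := e (key σ π a b d (t + 3) v) _ h1
    have e2 := e (key σ π a b d (t + 3) w) _ h2
    rw [h] at e2
    exact ⟨e2.1.symm.trans e1.1, e2.2.symm.trans e1.2⟩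
  · rintro ⟨h3, h4⟩
    rw [h3, h4]

/-- Appends the edges of the layer `t` to the list in the arrays `2` and `3`. -/
def layer : WCmd :=
  .seq (clearLoop (classExpr σ d t)) (.seq (countLoop (presentExpr σ d t) (classExpr σ d t))
    (emitLoop (presentExpr σ d t) (classExpr σ d t) (nodeExpr t (keyExpr σ d (t + 3)))
      (nodeExpr (t + 1) (keyExpr σ d t)) (.var (26 + t))))

/-- A list of edges as a list of pairs of numbers. -/
def vals {N : ℕ} (l : List (Fin N × Fin N)) : List (ℕ × ℕ) := l.map fun e => ((e.1 : ℕ), (e.2 : ℕ))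

variable {ρ : ℕ → ℕ} {CallOk : MemState → ℕ → Prop}

open Classical in
theorem layer_wp (hρ : n ≤ ρ 0) (h : Ready π a b k s) {l : List (ℕ × ℕ)} (hl : l.length ≤ 3 * n)
    (hh : Holds s l) : (layer σ d t).wp ρ CallOk
      (fun s' => Holds s' (l ++ vals ((arcs σ π a b d).arcList k t)) ∧ Same s s') s := by
  have hP : ∀ s' (v : Fin n), Same s s' → s'.reg 5 = v → (classExpr σ d t).eval s'
      = key σ π a b d (t + 3) v * (n * n) + key σ π a b d t v :=
    fun s' v hs h5 => eval_classExpr σ d t (h.same hs) h5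
  have hU : ∀ s' (v : Fin n), Same s s' → s'.reg 5 = v →
      ((presentExpr σ d t).eval s' ≠ 0 ↔ (arcs σ π a b d).U t v) :=
    fun s' v hs h5 => eval_presentExpr σ d t (h.same hs) h5
  have hS : ∀ s' (v : Fin n), Same s s' → s'.reg 5 = v →
      (nodeExpr t (keyExpr σ d (t + 3))).eval s' = (arcs σ π a b d).src t v :=
    fun s' v hs h5 => by rw [eval_nodeExpr t (h.same hs), eval_keyExpr σ d _ (h.same hs) h5]; rfl
  have hD : ∀ s' (v : Fin n), Same s s' → s'.reg 5 = v →
      (nodeExpr (t + 1) (keyExpr σ d t)).eval s' = (arcs σ π a b d).dst t v :=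
    fun s' v hs h5 => by
      rw [eval_nodeExpr (t + 1) (h.same hs), eval_keyExpr σ d _ (h.same hs) h5]; rfl
  have hB : ∀ s', Same s s' → (WExpr.var (26 + t)).eval s' = k t :=
    fun s' hs => (h.same hs).bitIndex t
  have hlist : vals ((arcs σ π a b d).arcList k t) = ((List.finRange n).filter fun v =>
      (arcs σ π a b d).U t v ∧ (∀ w, v < w → (arcs σ π a b d).U t w →
        key σ π a b d (t + 3) w * (n * n) + key σ π a b d t w
          ≠ key σ π a b d (t + 3) v * (n * n) + key σ π a b d t v) ∧
        ((Finset.univ.filter fun w => (arcs σ π a b d).U t w ∧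
          key σ π a b d (t + 3) w * (n * n) + key σ π a b d t w
          = key σ π a b d (t + 3) v * (n * n) + key σ π a b d t v).card.testBit (k t) = true)).map
          fun v => (((arcs σ π a b d).src t v : ℕ), ((arcs σ π a b d).dst t v : ℕ)) := by
    rw [vals, LayeredArcs.arcList, List.map_map]
    congr 1
    refine List.filter_congr fun v _ => ?_
    simp only [ne_eq, class_eq_iff, LayeredArcs.IsLast, LayeredArcs.Bit, LayeredArcs.mult,
      and_assoc]
  rw [hlist]
  have hsame : ∀ c : WCmd, ∀ s1 s2, Same s s1 → Frame c s1 s2 → (∀ r ∈ c.wr, r ∈ [1, 5]) →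
      (∀ A ∈ c.wa, A ∈ [2, 3, 4, 5]) → Same s s2 := fun c s1 s2 h1 hf => h1.of_frame hf
  refine wp_mono _ (fun s' hs => ⟨hs.1, hsame _ _ _ (Same.refl s) hs.2
    (by simp [layer, clearLoop, countLoop, emitLoop, wr])
    (by simp [layer, clearLoop, countLoop, emitLoop, wa])⟩) _ (wp_frame _ _ ?_)
  refine wp_seq (clearLoop_wp h.len hρ hP (Same.refl s)) fun s1 h1 f1 => ?_
  have hs1 : Same s s1 := (Same.refl s).of_frame f1 (by simp [clearLoop, wr])
    (by simp [clearLoop, wa])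
  refine wp_seq (countLoop_wp h.len hρ hP hU hs1 h1) fun s2 h2 f2 => ?_
  have hs2 : Same s s2 := hs1.of_frame f2 (by simp [countLoop, wr]) (by simp [countLoop, wa])
  refine emitLoop_wp h.len hρ hP hU hS hD hB hs2 h2 hl ?_
  refine ⟨?_, fun i hi => ?_⟩
  · rw [f2.1 1 (by simp [countLoop, wr]), f1.1 1 (by simp [clearLoop, wr]), hh.1]
  · rw [f2.2 2 (by simp [countLoop, wa]), f1.2 2 (by simp [clearLoop, wa]),
      f2.2 3 (by simp [countLoop, wa]), f1.2 3 (by simp [clearLoop, wa])]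
    exact hh.2 i hi

/-- Writes down the edges of the layers that belong to `S`. -/
def writeGraph (S : ℕ) : WCmd :=
  .seq (.assign 1 (.lit 0)) (.iter (fun j => if S.testBit j then layer σ d (Fin.ofNat 4 j)
    else .skip) 4)

theorem length_arcList_le {n N : ℕ} (A : LayeredArcs n N) (k : Fin 4 → ℕ) (t : Fin 4) :
    (A.arcList k t).length ≤ n := by
  classical
  rw [LayeredArcs.arcList, List.length_map]
  exact (List.length_filter_le _ _).trans (by simp)

theorem length_layerList_le {n N : ℕ} (A : LayeredArcs n N) (k : Fin 4 → ℕ) (S j : ℕ) :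
    (A.layerList k S j).length ≤ j * n := by
  induction j with
  | zero => simp [LayeredArcs.layerList]
  | succ j ih =>
    rw [LayeredArcs.layerList, List.length_append, add_mul, one_mul]
    refine add_le_add ih ?_
    split_ifs
    · exact length_arcList_le A k _
    · simp

theorem Same.trans {s s1 s2 : MemState} (h : Same s s1) (h' : Same s1 s2) : Same s s2 :=
  ⟨fun r hr => (h'.1 r hr).trans (h.1 r hr), fun A hA => (h'.2 A hA).trans (h.2 A hA)⟩

theorem writeGraph_wp (S : ℕ) (hρ : n ≤ ρ 0) (h : Ready π a b k s) : (writeGraph σ d S).wp ρ CallOk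
      (fun s' => Holds s' (vals ((arcs σ π a b d).layerList k S 4)) ∧ Same s s') s := by
  have h1 : Same s (s.setReg 1 0) :=
    ⟨fun r hr => MemState.setReg_reg_of_ne _ _ (by rintro rfl; simp at hr), fun _ _ => rfl⟩
  refine wp_seq (R := fun s1 => s1 = s.setReg 1 0) rfl ?_
  rintro _ rfl -
  refine wp_iter (fun j s' => Holds s' (vals ((arcs σ π a b d).layerList k S j)) ∧
    Same s s') ?_ _ ⟨⟨by simp [vals, LayeredArcs.layerList], by
      simp [vals, LayeredArcs.layerList]⟩, h1⟩
  rintro j hj s' ⟨hh, hs⟩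
  have hl : (vals ((arcs σ π a b d).layerList k S j)).length ≤ 3 * n := by
    rw [vals, List.length_map]
    exact (length_layerList_le _ k S j).trans (Nat.mul_le_mul_right _ (by omega))
  by_cases hS : S.testBit j
  · rw [if_pos hS]
    refine wp_mono _ ?_ _ (layer_wp σ d (Fin.ofNat 4 j) hρ (h.same hs) hl hh)
    rintro s2 ⟨h2, h3⟩
    refine ⟨?_, hs.trans h3⟩
    rw [LayeredArcs.layerList, if_pos hS, vals, List.map_append]
    exact h2
  · rw [if_neg hS]
    refine ⟨?_, hs⟩
    rw [LayeredArcs.layerList, if_neg hS, List.append_nil]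
    exact hh

end layer

end PatternReduction


/-! ### Counting patterns with an algorithm that counts 4-cycles -/

theorem SimpleGraph.copyCount_cycleGraph_four_le {N : ℕ} (G : SimpleGraph (Fin N)) :
    G.copyCount (cycleGraph 4) ≤ N ^ 4 := by
  have h := eight_mul_copyCount G
  have h2 : Nat.card {v : Fin 4 → Fin N // G.IsFourCycle v} ≤ N ^ 4 := by
    calc _ ≤ Nat.card (Fin 4 → Fin N) :=
          Nat.card_le_card_of_injective _ Subtype.val_injective
      _ = N ^ 4 := by simp
  omega

/-- A sum over all digits of the numbers below `L ^ 10`. -/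
theorem Nat.sum_digits_ten (L : ℕ) (F : (Fin 3 → ℕ) → (Fin 3 → ℕ) → (Fin 4 → ℕ) → ℤ) :
    ∑ z ∈ Finset.range (L ^ 10), F (fun i => z / L ^ (i : ℕ) % L)
        (fun i => z / L ^ (3 + i : ℕ) % L) (fun t => z / L ^ (6 + t : ℕ) % L)
      = ∑ a : Fin 3 → Fin L, ∑ b : Fin 3 → Fin L, ∑ k : Fin 4 → Fin L,
        F (fun i => a i) (fun i => b i) fun t => k t := by
  rw [Finset.sum_range]
  have e1 := Equiv.sum_comp (finFunctionFinEquiv (m := L) (n := 10)).symm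
    fun δ : Fin (3 + (3 + 4)) → Fin L => F (fun i => δ (Fin.castAdd _ i))
      (fun i => δ (Fin.natAdd 3 (Fin.castAdd 4 i))) fun t => δ (Fin.natAdd 3 (Fin.natAdd 3 t))
  have e2 := Equiv.sum_comp (((Equiv.refl _).prodCongr (Fin.appendEquiv (α := Fin L) 3 4)).trans
    (Fin.appendEquiv 3 (3 + 4)))
    fun δ : Fin (3 + (3 + 4)) → Fin L => F (fun i => δ (Fin.castAdd _ i))
      (fun i => δ (Fin.natAdd 3 (Fin.castAdd 4 i))) fun t => δ (Fin.natAdd 3 (Fin.natAdd 3 t))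
  refine Eq.trans ?_ (e1.trans (e2.symm.trans ?_))
  · refine Finset.sum_congr rfl fun z _ => ?_
    have h : ∀ t : Fin 4, 6 + (t : ℕ) = 3 + (3 + t) := fun t => by omega
    simp only [h]
    rfl
  · simp only [Fintype.sum_prod_type, Equiv.trans_apply, Equiv.prodCongr_apply, Prod.map_apply,
      Equiv.refl_apply, Fin.appendEquiv, Equiv.coe_fn_mk, Fin.append_left, Fin.append_right]

namespace PatternReduction

open WCmd WExpr Levels

/-- The contribution of a choice of levels, bits and layers to the number of occurrences, times its
sign. -/
def termExpr : WExpr :=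
  .bin .mul (.var 3) (.bin .mul (.bin .mul (.get 6 (.var 26)) (.get 6 (.var 27)))
    (.bin .mul (.get 6 (.var 28)) (.get 6 (.var 29))))

/-- The fourth power of the length of the permutation, a bound for the result. -/
def fourthPower : WExpr := .bin .mul (.bin .mul (.var 0) (.var 0)) (.bin .mul (.var 0) (.var 0))

/-- `termExpr` with the sign of inclusion-exclusion, modulo a number that exceeds the result. -/
def signedExpr (S : ℕ) : WExpr :=
  if Even (LayeredArcs.mask S).card then termExpr
  else .bin .sub (.bin .add fourthPower (.lit 1)) (.mods termExpr fourthPower)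

/-- Adds one term to the result, which is kept modulo a number that exceeds it. -/
def block (σ : Equiv.Perm (Fin 4)) (d : Fin 3) (S : ℕ) : WCmd :=
  .ite (selExpr σ d) (.seq (writeGraph σ d S) (.seq .call
    (.assign 4 (.mods (.bin .add (.var 4) (signedExpr S)) fourthPower)))) .skip

/-- Adds the terms for all pairings and all sets of layers. -/
def blocks (σ : Equiv.Perm (Fin 4)) : WCmd :=
  .iter (fun d => .iter (fun S => block σ (Fin.ofNat 3 d) S) 16) 3

/-- Computes the digits of the register `6` with respect to the base in the register `9`. -/
def digits : WCmd :=
  .seq (.assign 8 (.var 6)) (.iter (fun i => .seq (.assign (20 + i) (.bin .mod (.var 8) (.var 9)))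
    (.assign 8 (.bin .div (.var 8) (.var 9)))) 10)

/-- Computes the powers of two up to `n`, and their number. -/
def powers : WCmd :=
  .seq (.assign 12 (.lit 1)) (.loop 5 0 (.ite (.bin .lt (.var 12) (.bin .add (.var 0) (.lit 1)))
    (.seq (.store 6 (.var 9) (.var 12))
      (.seq (.assign 12 (.mods (.bin .add (.var 12) (.var 12)) (.bin .add (.var 0) (.var 0))))
        (.assign 9 (.mods (.bin .add (.var 9) (.lit 1)) (.var 0)))))
    .skip))

/-- The square of an expression. -/
def sq (e : WExpr) : WExpr := .bin .mul e e

/-- Counts a pattern by polylogarithmically many calls of a subroutine that counts 4-cycles.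

The number `L` of stored powers of two (array `6`) is in the register `9`. The counter of the main
loop in the register `6` runs through the numbers below `L ^ 10`; its ten digits to the base `L` are
put into the registers from `20` on, and they are the levels of the positions, the levels of the
values, and the indices of the bits of the multiplicities. The instance for a call is built in the
registers `1` and `2` and the arrays `2` and `3`, with the arrays `4` and `5` for the multiplicity
and the last member of every class of parallel arcs. The result is accumulated in the register
`4`. -/
def program (σ : Equiv.Perm (Fin 4)) : WCmd :=
  .seq powers (.seq (.assign 2 (.bin .mul (.lit 4) (sq (.var 0))))
    (.seq (.assign 7 (.bin .mul (sq (sq (sq (.var 9)))) (sq (.var 9))))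
      (.loop 6 7 (.seq digits (blocks σ)))))

/-- Degree bounds for the registers. -/
def Γ (r : ℕ) : ℕ := [1, 4, 5, 16, 4, 1, 10, 10, 10, 1, 0, 0, 2].getD r (if 20 ≤ r then 10 else 0)

/-- Degree bounds for the arrays. -/
def Δ (A : ℕ) : ℕ := [1, 1, 5, 5, 1, 1, 2].getD A 0

theorem chk_program (σ : Equiv.Perm (Fin 4)) : (program σ).chk Γ Δ 50 = true := by
  revert σ
  decide +kernel

theorem cost_layer_le (ρ : ℕ → ℕ) (u T : ℕ) (σ : Equiv.Perm (Fin 4)) (d : Fin 3) (t : Fin 4) :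
    (layer σ d t).cost ρ u T ≤ 4000 * (u * (ρ 0 + 1)) := by
  have h : ∀ σ d t, (presentExpr σ d t).cost ≤ 200 ∧ (classExpr σ d t).cost ≤ 200 ∧
      (nodeExpr t (keyExpr σ d (t + 3))).cost ≤ 100 ∧
      (nodeExpr (t + 1) (keyExpr σ d t)).cost ≤ 100 := by
    decide +kernel
  obtain ⟨h1, h2, h3, h4⟩ := h σ d t
  have loop : ∀ c : WCmd, c.cost ρ u T ≤ 1000 * u →
      (WCmd.loop 5 0 c).cost ρ u T ≤ 1004 * (u * (ρ 0 + 1)) := by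
    intro c hc
    have := Nat.mul_le_mul_left (ρ 0) (Nat.add_le_add_right hc (4 * u))
    have e : 1004 * (u * (ρ 0 + 1)) = ρ 0 * (1000 * u + 4 * u) + 1004 * u := by ring
    simp only [WCmd.cost]
    omega
  refine (add_le_add (loop _ ?_) (add_le_add (loop _ ?_) (loop _ ?_))).trans
    (b := 1004 * (u * (ρ 0 + 1)) + (1004 * (u * (ρ 0 + 1)) + 1004 * (u * (ρ 0 + 1)))) (by omega)
  all_goals
    simp only [WCmd.cost, WExpr.cost, WExpr.all, WExpr.bit, List.foldr, ← add_mul, add_zero]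
    exact Nat.mul_le_mul_right _ (by omega)

theorem cost_program_le (ρ : ℕ → ℕ) (u T : ℕ) (σ : Equiv.Perm (Fin 4)) :
    (program σ).cost ρ u T ≤ 100 * (u * (ρ 0 + 1))
      + ρ 7 * (1000000 * (u * (ρ 0 + 1)) + 48 * T) := by
  have hW : ∀ d S, (writeGraph σ d S).cost ρ u T ≤ 16002 * (u * (ρ 0 + 1)) := by
    intro d S
    have h : ∀ j ∈ Finset.range 4, (if S.testBit j then layer σ d (Fin.ofNat 4 j)
        else .skip).cost ρ u T ≤ 4000 * (u * (ρ 0 + 1)) := by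
      intro j _
      split_ifs
      · exact cost_layer_le ρ u T σ d _
      · exact Nat.zero_le _
    have h2 := Finset.sum_le_sum h
    rw [← cost_iter, Finset.sum_const, Finset.card_range, smul_eq_mul] at h2
    have h3 : u ≤ u * (ρ 0 + 1) := Nat.le_mul_of_pos_right _ (by omega)
    simp only [writeGraph, WCmd.cost, WExpr.cost] at h2 ⊢
    omega
  have hsel : ∀ d, (selExpr σ d).cost ≤ 200 := by
    clear hW
    revert σ
    decide +kernel
  have hB : ∀ d S, (block σ d S).cost ρ u T ≤ 17000 * (u * (ρ 0 + 1)) + T := by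
    intro d S
    have h1 := hW d S
    have h2 := Nat.mul_le_mul_right u (hsel d)
    have h3 : u ≤ u * (ρ 0 + 1) := Nat.le_mul_of_pos_right _ (by omega)
    have h4 : (signedExpr S).cost ≤ 40 := by
      unfold signedExpr
      split_ifs <;> decide
    have h5 := Nat.mul_le_mul_right u h4
    simp only [block, fourthPower, WCmd.cost, WExpr.cost, add_mul] at h1 h2 h5 ⊢
    omega
  have hBs : (blocks σ).cost ρ u T ≤ 48 * (17000 * (u * (ρ 0 + 1)) + T) := by
    rw [blocks, cost_iter]
    refine (Finset.sum_le_sum (g := fun _ => 16 * (17000 * (u * (ρ 0 + 1)) + T))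
      fun d _ => ?_).trans (by simp; omega)
    rw [cost_iter]
    exact (Finset.sum_le_sum fun S _ => hB _ S).trans (by simp)
  have hbody : (WCmd.seq digits (blocks σ)).cost ρ u T + 4 * u
      ≤ 1000000 * (u * (ρ 0 + 1)) + 48 * T := by
    have h3 : u ≤ u * (ρ 0 + 1) := Nat.le_mul_of_pos_right _ (by omega)
    simp only [WCmd.cost, digits, WExpr.cost, cost_iter, Finset.sum_const, Finset.card_range,
      smul_eq_mul] at hBs ⊢
    omega
  have h6 := Nat.mul_le_mul_left (ρ 7) hbody
  have h7 : powers.cost ρ u T ≤ 50 * (u * (ρ 0 + 1)) := by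
    simp only [powers, WCmd.cost, WExpr.cost, ← add_mul, add_zero, Nat.reduceAdd, ← mul_assoc]
    calc _ ≤ 50 * (ρ 0 + 1) * u := Nat.mul_le_mul_right _ (by omega)
      _ = _ := by ring
  have h8 : u ≤ u * (ρ 0 + 1) := Nat.le_mul_of_pos_right _ (by omega)
  simp only [program, sq, WCmd.cost, WExpr.cost] at h6 h7 ⊢
  omega

section correctness

variable {ρ : ℕ → ℕ} {n : ℕ} {π : Equiv.Perm (Fin n)} {a b : Fin 3 → ℕ} {k : Fin 4 → ℕ}
  {s : MemState} (σ : Equiv.Perm (Fin 4)) (d : Fin 3) (S : ℕ)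

variable (π a b k) in
open Classical in
/-- The contribution of a choice of levels, bits and layers to the number of occurrences. -/
noncomputable def term : ℤ :=
  if Sel σ a b d then (-1) ^ (LayeredArcs.mask S).card * (2 ^ (∑ t, k t) *
    (((arcs σ π a b d).simpleGraph k S).copyCount (SimpleGraph.cycleGraph 4) : ℤ)) else 0

/-- The register `4` holds the residue of `x`, and the memory is prepared for the calls. -/
structure Partial (π : Equiv.Perm (Fin n)) (a b : Fin 3 → ℕ) (k : Fin 4 → ℕ) (x : ℤ)
    (s : MemState) : Prop extends Ready π a b k s where
  nodes : s.reg 2 = 4 * (n * n)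
  result_le : s.reg 4 ≤ n ^ 4
  result : (s.reg 4 : ℤ) ≡ x [ZMOD ((n ^ 4 + 1 : ℕ) : ℤ)]

theorem Same.trans_setReg {s s' : MemState} (h : Same s s') (v : ℕ) :
    ∀ r, r ∉ [1, 3, 4, 5] → (s'.setReg 3 v).reg r = s.reg r := fun r hr => by
  rw [MemState.setReg_reg_of_ne _ _ (by rintro rfl; simp at hr)]
  exact h.1 r (by simp at hr ⊢; omega)

/-- The list in memory is the input of a legitimate call. -/
theorem callOk_graph (h2 : s.reg 2 = 4 * (n * n))
    (hh : Holds s (vals ((arcs σ π a b d).layerList k S 4))) :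
    fourCycleProblem.CallOk (8 * (n + 2)) ((n + 2) ^ 4) ((n + 2) ^ 16) s
      (((arcs σ π a b d).simpleGraph k S).copyCount (SimpleGraph.cycleGraph 4)) := by
  set l := (arcs σ π a b d).layerList k S 4 with hl
  have hlen : l.length ≤ 4 * n := length_layerList_le _ k S 4
  have hv : (vals l).length = l.length := List.length_map _
  have r1 : s.reg 1 = l.length := hh.1.trans hv
  have hcell : ∀ i (hi : i < l.length), s.arr 2 i = (l[i].1 : ℕ) ∧ s.arr 3 i = (l[i].2 : ℕ) := by
    intro i hi
    have := hh.2 i (hv.symm ▸ hi)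
    simpa [vals] using this
  have hpow : 4 * (n * n) + 4 * n + 2 < (n + 2) ^ 4 := by nlinarith [sq_nonneg (n * n + 2 * n)]
  have hcount : ((arcs σ π a b d).simpleGraph k S).copyCount (SimpleGraph.cycleGraph 4)
      < (n + 2) ^ 16 := by
    calc _ ≤ (4 * (n * n)) ^ 4 := SimpleGraph.copyCount_cycleGraph_four_le _
      _ < ((n + 2) ^ 4) ^ 4 := Nat.pow_lt_pow_left (by omega) (by norm_num)
      _ = _ := by rw [← pow_mul]
  refine ⟨(arcs σ π a b d).graph k S, ?_, rfl, ?_, ?_, hcount, ?_, ?_, ?_, ?_⟩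
  · ext r
    · change (if r = 0 then l.length else if r = 1 then 4 * (n * n) else 0) = _
      simp only [MemState.callInput, r1, h2]
    · rename_i i
      change (if h : i < l.length then
        if r = 0 then (l[i].1 : ℕ) else if r = 1 then (l[i].2 : ℕ) else 0 else 0) = _
      simp only [MemState.callInput, r1]
      by_cases hi : i < l.length
      · rw [dif_pos hi]
        rcases r with - | - | r
        · simp [hi, (hcell i hi).1]
        · simp [hi, (hcell i hi).2]
        · simp
      · simp [hi]
  · change l.length ≤ _
    omega
  · change 4 * (n * n) + l.length + 2 ≤ _
    omega
  · omega
  · omega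
  · omega
  · intro i hi
    rw [r1] at hi
    have h1 := (l[i].1).2
    have h2 := (l[i].2).2
    rw [(hcell i hi).1, (hcell i hi).2]
    omega

theorem eval_fourthPower (h0 : s.reg 0 = n) : fourthPower.eval s = n ^ 4 := by
  simp only [fourthPower, eval, WordOp.eval, h0]
  ring

theorem eval_termExpr (h : Ready π a b k s) :
    termExpr.eval s = 2 ^ (∑ t, k t) * s.reg 3 := by
  have hb : ∀ t : Fin 4, (WExpr.get 6 (.var (26 + t))).eval s = 2 ^ k t := fun t => by
    rw [eval, eval, h.bitIndex, h.pow]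
  have h0 := hb 0
  have h1 := hb 1
  have h2 := hb 2
  have h3 := hb 3
  simp only [Fin.isValue, Fin.val_zero, Fin.val_one, Fin.val_two,
    show ((3 : Fin 4) : ℕ) = 3 from rfl, Nat.reduceAdd] at h0 h1 h2 h3
  simp only [termExpr, WExpr.eval, WordOp.eval] at h0 h1 h2 h3 ⊢
  rw [h0, h1, h2, h3, Fin.sum_univ_four]
  ring

theorem signedExpr_modEq (h : Ready π a b k s) : ((signedExpr S).eval s : ℤ) ≡
    (-1) ^ (LayeredArcs.mask S).card * (2 ^ (∑ t, k t) * s.reg 3) [ZMOD ((n ^ 4 + 1 : ℕ) : ℤ)] := by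
  unfold signedExpr
  split_ifs with he
  · rw [eval_termExpr h, he.neg_one_pow, one_mul]
    push_cast
    exact Int.ModEq.refl _
  · rw [Nat.not_even_iff_odd] at he
    simp only [eval, WordOp.eval, eval_fourthPower h.len, eval_termExpr h, he.neg_one_pow]
    rw [Nat.cast_sub (Nat.mod_lt _ (Nat.succ_pos _)).le]
    set M := n ^ 4 + 1
    set x := 2 ^ (∑ t, k t) * s.reg 3 with hx
    have e1 : ((x % M : ℕ) : ℤ) ≡ x [ZMOD (M : ℤ)] := by
      rw [Int.natCast_mod]; exact Int.mod_modEq _ _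
    have e2 : (M : ℤ) ≡ 0 [ZMOD (M : ℤ)] := Int.modEq_zero_iff_dvd.2 dvd_rfl
    refine (e2.sub e1).trans ?_
    rw [zero_sub, neg_one_mul, hx]
    push_cast
    exact Int.ModEq.refl _

theorem block_wp (hρ : n ≤ ρ 0) {x : ℤ} (h : Partial π a b k x s) :
    (block σ d S).wp ρ (fourCycleProblem.CallOk (8 * (n + 2)) ((n + 2) ^ 4) ((n + 2) ^ 16))
      (Partial π a b k (x + term π a b k σ d S)) s := by
  have hsel : (selExpr σ d).eval s ≠ 0 ↔ Sel σ a b d := by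
    rw [eval_selExpr]
    simp only [h.posLevel, h.valLevel]
  refine ⟨fun hne => ?_, fun hz => ?_⟩
  · have hs := hsel.1 hne
    refine wp_seq (writeGraph_wp σ d S hρ h.toReady) ?_
    rintro s1 ⟨hh, hsame⟩ -
    refine ⟨_, callOk_graph σ d S ((hsame.1 2 (by simp)).trans h.nodes) hh, ?_⟩
    set v := ((arcs σ π a b d).simpleGraph k S).copyCount (SimpleGraph.cycleGraph 4) with hv
    have hR : Ready π a b k (s1.setReg 3 v) := h.toReady.congr (hsame.trans_setReg v) hsame.2
    have r3 : (s1.setReg 3 v).reg 3 = v := MemState.setReg_reg_self _ _ _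
    have r4 : (s1.setReg 3 v).reg 4 = s.reg 4 := by
      rw [MemState.setReg_reg_of_ne _ _ (by norm_num), hsame.1 4 (by simp)]
    simp only [wp, eval, WordOp.eval, eval_fourthPower hR.len, r4]
    have hmod := Nat.mod_lt (s.reg 4 + (signedExpr S).eval (s1.setReg 3 v))
      (Nat.succ_pos (n ^ 4))
    refine ⟨hR.congr (fun r hr => MemState.setReg_reg_of_ne _ _ (by rintro rfl; simp at hr))
      fun _ _ => rfl, ?_, ?_, ?_⟩
    · rw [MemState.setReg_reg_of_ne _ _ (by norm_num), hsame.trans_setReg v 2 (by simp), h.nodes]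
    · rw [MemState.setReg_reg_self]
      exact Nat.lt_succ_iff.1 hmod
    · rw [MemState.setReg_reg_self, Int.natCast_mod]
      refine (Int.mod_modEq _ _).trans ?_
      push_cast
      have h3 := signedExpr_modEq S hR
      rw [r3] at h3
      have := h.result.add h3
      rw [term, if_pos hs]
      push_cast at this
      exact this
  · have hs : ¬ Sel σ a b d := fun hs => hsel.2 hs hz
    rw [term, if_neg hs, add_zero]
    exact h

theorem blocks_wp (hρ : n ≤ ρ 0) {x : ℤ} (h : Partial π a b k x s) :
    (blocks σ).wp ρ (fourCycleProblem.CallOk (8 * (n + 2)) ((n + 2) ^ 4) ((n + 2) ^ 16))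
      (Partial π a b k (x + ∑ d, ∑ S ∈ Finset.range 16, term π a b k σ d S)) s := by
  have e : ∑ d, ∑ S ∈ Finset.range 16, term π a b k σ d S
      = ∑ d ∈ Finset.range 3, ∑ S ∈ Finset.range 16, term π a b k σ (Fin.ofNat 3 d) S := by
    rw [Finset.sum_range]
    exact Finset.sum_congr rfl fun d _ => by rw [Fin.ofNat_val_eq_self]
  rw [e]
  refine wp_iter (fun j s' => Partial π a b k (x + ∑ d ∈ Finset.range j,
    ∑ S ∈ Finset.range 16, term π a b k σ (Fin.ofNat 3 d) S) s') ?_ s (by simpa using h)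
  intro j _ s' h'
  rw [Finset.sum_range_succ, ← add_assoc]
  refine wp_iter (fun i s' => Partial π a b k (x + (∑ d ∈ Finset.range j,
    ∑ S ∈ Finset.range 16, term π a b k σ (Fin.ofNat 3 d) S) + ∑ S ∈ Finset.range i,
      term π a b k σ (Fin.ofNat 3 j) S) s') ?_ s' (by simpa using h')
  intro i _ s2 h2
  rw [Finset.sum_range_succ, ← add_assoc]
  exact block_wp σ _ i hρ h2

variable {CallOk : MemState → ℕ → Prop}

theorem digits_wp : digits.wp ρ CallOk
    (fun s' => ∀ i < 10, s'.reg (20 + i) = s.reg 6 / s.reg 9 ^ i % s.reg 9) s := by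
  refine wp_seq (R := fun s1 => s1 = s.setReg 8 (s.reg 6)) rfl ?_
  rintro _ rfl -
  refine wp_mono _ (fun s' h => h.2.2) _ (wp_iter (n := 10) (fun j s' =>
    s'.reg 8 = s.reg 6 / s.reg 9 ^ j ∧ s'.reg 9 = s.reg 9 ∧
      ∀ i < j, s'.reg (20 + i) = s.reg 6 / s.reg 9 ^ i % s.reg 9) ?_ _ ?_)
  · rintro j hj s' ⟨h8, h9, hd⟩
    simp only [wp, eval, WordOp.eval]
    simp only [MemState.setReg_reg]
    refine ⟨?_, ?_, fun i hi => ?_⟩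
    · rw [if_pos trivial, if_neg (by omega), if_neg (by omega), h8, h9, Nat.div_div_eq_div_mul,
        pow_succ]
    · rw [if_neg (by omega), if_neg (by omega), h9]
    · rw [if_neg (by omega)]
      by_cases hij : i = j
      · rw [if_pos (by omega), h8, h9, hij]
      · rw [if_neg (by omega)]
        exact hd i (by omega)
  · simp [MemState.setReg_reg]

theorem powers_wp (hρ : n ≤ ρ 0) (h0 : s.reg 0 = n) (h9 : s.reg 9 = 0) :
    powers.wp ρ CallOk (fun s' => n < 2 ^ s'.reg 9 ∧ ∀ j < s'.reg 9, s'.arr 6 j = 2 ^ j ∧ 2 ^ j ≤ n)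
      s := by
  refine wp_seq (R := fun s1 => s1 = s.setReg 12 1) rfl ?_
  rintro _ rfl -
  have e0 : (s.setReg 12 1).reg 0 = n := by rw [MemState.setReg_reg_of_ne _ _ (by norm_num), h0]
  -- after `i` rounds, the number of stored powers of two is `i`, or large enough
  refine ⟨by rw [e0]; exact hρ, fun i s' => s'.reg 12 = 2 ^ s'.reg 9 ∧ s'.reg 9 ≤ i ∧
    (s'.reg 9 = i ∨ n < 2 ^ s'.reg 9) ∧ ∀ j < s'.reg 9, s'.arr 6 j = 2 ^ j ∧ 2 ^ j ≤ n, ?_, ?_, ?_⟩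
  · simp [MemState.setReg_reg, h9]
  · rintro i s' hi hf ⟨h12, hle, hor, hp⟩
    rw [e0] at hi
    have r0 : (s'.setReg 5 i).reg 0 = n := by
      rw [MemState.setReg_reg_of_ne _ _ (by norm_num), hf.1 0 (by simp [wr]), e0]
    have r12 : (s'.setReg 5 i).reg 12 = 2 ^ s'.reg 9 := by
      rw [MemState.setReg_reg_of_ne _ _ (by norm_num), h12]
    have r9 : (s'.setReg 5 i).reg 9 = s'.reg 9 := MemState.setReg_reg_of_ne _ _ (by norm_num)
    have hc : (WExpr.bin .lt (.var 12) (.bin .add (.var 0) (.lit 1))).eval (s'.setReg 5 i)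
        = if 2 ^ s'.reg 9 < n + 1 then 1 else 0 := by
      simp only [eval, WordOp.eval, r0, r12]
    refine ⟨fun hne => ?_, fun hz => ?_⟩
    · have hlt : 2 ^ s'.reg 9 < n + 1 := by
        by_contra h
        exact hne (by rw [hc, if_neg h])
      have h9i : s'.reg 9 = i := hor.resolve_right (by omega)
      simp only [wp, eval, WordOp.eval, MemState.setCell_reg, r9, r12, r0,
        MemState.setReg_reg_of_ne _ _ (show 9 ≠ 12 by norm_num),
        MemState.setReg_reg_of_ne _ _ (show 0 ≠ 12 by norm_num)]
      rw [Nat.mod_eq_of_lt (show 2 ^ s'.reg 9 + 2 ^ s'.reg 9 < n + n + 1 by omega),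
        Nat.mod_eq_of_lt (show s'.reg 9 + 1 < n + 1 by omega)]
      rw [MemState.setReg_reg_self, MemState.setReg_reg_of_ne _ _ (show 12 ≠ 9 by norm_num),
        MemState.setReg_reg_self]
      refine ⟨by rw [pow_succ]; omega, by omega, .inl (by omega), fun j hj => ?_⟩
      rw [MemState.setReg_arr, MemState.setReg_arr, MemState.setCell_arr]
      by_cases hj9 : j = s'.reg 9
      · rw [if_pos ⟨rfl, hj9⟩, hj9]
        exact ⟨rfl, by omega⟩
      · rw [if_neg fun h => hj9 h.2]
        exact hp j (by omega)
    · have hge : n < 2 ^ s'.reg 9 := by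
        by_contra h
        rw [hc, if_pos (by omega)] at hz
        exact one_ne_zero hz
      change (s'.setReg 5 i).reg 12 = _ ∧ _
      rw [r9, r12]
      exact ⟨rfl, by omega, .inr hge, hp⟩
  · rintro s' hf ⟨h12, hle, hor, hp⟩
    rw [e0] at hor ⊢
    rw [MemState.setReg_reg_of_ne _ _ (show 9 ≠ 5 by norm_num)]
    refine ⟨hor.elim (fun h => ?_) id, hp⟩
    rw [h]
    exact Nat.lt_two_pow_self

open Classical in
/-- The terms for all choices of levels and bits add up to the number of occurrences. -/
theorem sum_term {L : ℕ} (hL : n < 2 ^ L) :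
    ∑ z ∈ Finset.range (L ^ 10), ∑ d, ∑ S ∈ Finset.range 16,
      term π (fun i => z / L ^ (i : ℕ) % L) (fun i => z / L ^ (3 + i : ℕ) % L)
        (fun t => z / L ^ (6 + t : ℕ) % L) σ d S = patternCount σ π := by
  rw [Nat.sum_digits_ten L fun a b k => ∑ d, ∑ S ∈ Finset.range 16, term π a b k σ d S,
    patternCount_eq_sum σ π hL]
  refine Finset.sum_congr rfl fun a _ => Finset.sum_congr rfl fun b _ => ?_
  rw [Finset.sum_comm]
  refine Finset.sum_congr rfl fun d _ => ?_
  unfold term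
  split_ifs
  · refine Finset.sum_congr rfl fun k _ => ?_
    rw [Finset.mul_sum]
    exact Finset.sum_congr rfl fun S _ => mul_left_comm _ _ _
  · simp

theorem program_wp (hρ0 : n ≤ ρ 0) (hρ7 : ∀ L, (∀ j < L, 2 ^ j ≤ n) → L ^ 10 ≤ ρ 7)
    (h0 : s.reg 0 = n) (h4 : s.reg 4 = 0) (h9 : s.reg 9 = 0) (hπ : ∀ v : Fin n, s.arr 0 v = π v) :
    (program σ).wp ρ (fourCycleProblem.CallOk (8 * (n + 2)) ((n + 2) ^ 4) ((n + 2) ^ 16))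
      (fun s' => s'.reg 4 = patternCount σ π) s := by
  refine wp_seq (powers_wp hρ0 h0 h9) ?_
  rintro s1 ⟨hL, hpow⟩ f1
  set L := s1.reg 9 with hLd
  have r0 : s1.reg 0 = n := by rw [f1.1 0 (by simp [powers, wr]), h0]
  have r4 : s1.reg 4 = 0 := by rw [f1.1 4 (by simp [powers, wr]), h4]
  refine wp_seq (R := fun s2 => s2 = s1.setReg 2 (4 * (n * n))) ?_ ?_
  · simp only [wp, sq, eval, WordOp.eval, r0]
  rintro _ rfl -
  refine wp_seq (R := fun s2 => s2 = (s1.setReg 2 (4 * (n * n))).setReg 7 (L ^ 10)) ?_ ?_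
  · simp only [wp, sq, eval, WordOp.eval, MemState.setReg_reg_of_ne _ _ (show 9 ≠ 2 by norm_num),
      ← hLd]
    congr 1
    ring
  rintro _ rfl -
  set s2 := (s1.setReg 2 (4 * (n * n))).setReg 7 (L ^ 10) with hs2
  have e : ∀ r, r ≠ 2 → r ≠ 7 → s2.reg r = s1.reg r := fun r h2 h7 => by
    rw [hs2, MemState.setReg_reg_of_ne _ _ h7, MemState.setReg_reg_of_ne _ _ h2]
  have e7 : s2.reg 7 = L ^ 10 := MemState.setReg_reg_self _ _ _
  have e2 : s2.reg 2 = 4 * (n * n) := by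
    rw [hs2, MemState.setReg_reg_of_ne _ _ (by norm_num), MemState.setReg_reg_self]
  have hframe : ∀ {s' : MemState}, Frame (.loop 6 7 (.seq digits (blocks σ))) s2 s' →
      (∀ r ∈ [0, 2, 9], s'.reg r = s2.reg r) ∧ ∀ A ∈ [0, 6], s'.arr A = s1.arr A := by
    have h1 : ∀ σ, (∀ r ∈ [0, 2, 9], r ∉ (WCmd.loop 6 7 (.seq digits (blocks σ))).wr) ∧
        ∀ A ∈ [0, 6], A ∉ (WCmd.loop 6 7 (.seq digits (blocks σ))).wa := by
      decide +kernel
    exact fun {s'} hf => ⟨fun r hr => hf.1 r ((h1 σ).1 r hr), fun A hA => hf.2 A ((h1 σ).2 A hA)⟩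
  refine ⟨by rw [e7]; exact hρ7 L fun j hj => (hpow j hj).2, fun z s' => s'.reg 4 ≤ n ^ 4 ∧
    (s'.reg 4 : ℤ) ≡ ∑ z ∈ Finset.range z, ∑ d, ∑ S ∈ Finset.range 16,
      term π (fun i => z / L ^ (i : ℕ) % L) (fun i => z / L ^ (3 + i : ℕ) % L)
        (fun t => z / L ^ (6 + t : ℕ) % L) σ d S [ZMOD ((n ^ 4 + 1 : ℕ) : ℤ)], ?_, ?_, ?_⟩
  · beta_reduce
    rw [e 4 (by norm_num) (by norm_num), r4]
    exact ⟨Nat.zero_le _, by simp⟩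
  · rintro z s' hz hf ⟨hle, hmod⟩
    rw [e7] at hz
    have hL0 : 0 < L := Nat.pos_of_ne_zero fun h => by simp [h] at hz
    obtain ⟨hr, hA⟩ := hframe hf
    refine wp_seq digits_wp fun s3 hd f3 => ?_
    have g : ∀ r ∉ digits.wr, r ≠ 6 → s3.reg r = s'.reg r := fun r h h6 => by
      rw [f3.1 r h, MemState.setReg_reg_of_ne _ _ h6]
    have gA : ∀ A, s3.arr A = s'.arr A := fun A => by
      rw [f3.2 A (by rw [show digits.wa = [] from rfl]; simp)]; rfl
    rw [MemState.setReg_reg_self, MemState.setReg_reg_of_ne _ _ (show 9 ≠ 6 by norm_num),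
      hr 9 (by simp), e 9 (by norm_num) (by norm_num), ← hLd] at hd
    have hP : Partial π (fun i => z / L ^ (i : ℕ) % L) (fun i => z / L ^ (3 + i : ℕ) % L)
        (fun t => z / L ^ (6 + t : ℕ) % L) (∑ z ∈ Finset.range z, ∑ d, ∑ S ∈ Finset.range 16,
      term π (fun i => z / L ^ (i : ℕ) % L) (fun i => z / L ^ (3 + i : ℕ) % L)
        (fun t => z / L ^ (6 + t : ℕ) % L) σ d S) s3 := by
      refine ⟨⟨?_, fun v => ?_, fun i => hd i (by omega), fun i => ?_, fun t => ?_, fun t => ?_⟩,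
        ?_, ?_, ?_⟩
      · rw [g 0 (by decide) (by norm_num), hr 0 (by simp), e 0 (by norm_num) (by norm_num), r0]
      · rw [gA, hA 0 (by simp), f1.2 0 (by simp [powers, wa])]
        exact hπ v
      · rw [show 23 + (i : ℕ) = 20 + (3 + i) by ring]
        exact hd _ (by omega)
      · rw [show 26 + (t : ℕ) = 20 + (6 + t) by ring]
        exact hd _ (by omega)
      · rw [gA, hA 6 (by simp)]
        exact (hpow _ (Nat.mod_lt _ hL0)).1
      · rw [g 2 (by decide) (by norm_num), hr 2 (by simp), e2]
      · rw [g 4 (by decide) (by norm_num)]; exact hle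
      · rw [g 4 (by decide) (by norm_num)]; exact hmod
    refine wp_mono _ (fun s4 h => ⟨h.result_le, ?_⟩) _ (blocks_wp σ hρ0 hP)
    rw [Finset.sum_range_succ]
    exact h.result
  · rintro s' - ⟨hle, hmod⟩
    rw [e7, sum_term σ hL] at hmod
    rw [MemState.setReg_reg_of_ne _ _ (by norm_num)]
    have h1 := FourCycleReduction.patternCount_le σ π
    exact Nat.ModEq.eq_of_lt_of_lt (Int.natCast_modEq_iff.1 hmod) (by omega) (by omega)

end correctness

end PatternReduction

theorem patternProblem_standardInput (σ : Equiv.Perm (Fin 4)) :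
    (patternProblem σ).StandardInput where
  size_le x := le_rfl
  reg_zero x := rfl
  reg_two x r hr := by
    simp only [patternProblem, permToMem]
    rw [if_neg (by omega)]
  arr_two x A a hA := by
    simp only [patternProblem, permToMem]
    split_ifs <;> omega
  arr_lt x A a := by
    simp only [patternProblem, permToMem]
    split_ifs with h
    · have := (x.2 ⟨a, h⟩).2; omega
    · omega
    · omega

/-- An algorithm that counts 4-cycles yields one that counts a pattern. -/
theorem patternProblem_solvable_of_fourCycle {γ : ℝ} (hγ : 1 ≤ γ) (σ : Equiv.Perm (Fin 4))
    (h : SolvableInSoftO fourCycleProblem γ) : SolvableInSoftO (patternProblem σ) γ := by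
  open PatternReduction in
  refine solvable_of_reduction hγ h (patternProblem_standardInput σ) (program σ) Γ Δ 50 4 10
    2000000 (fun y r => if r = 7 then Nat.clog 2 (y.1 + 2) ^ 10 else y.1) (by norm_num)
    (fun r => ?_) (by decide) (by decide) (by decide) (chk_program σ)
    (fun y => program_wp (n := y.1) (π := y.2) σ le_rfl (fun L hL => ?_) rfl rfl rfl fun v => ?_)
    (fun y T => ?_) fun y => ?_
  · unfold Γ
    rcases Nat.lt_or_ge r 13 with hr | hr
    · interval_cases r <;> decide
    · rw [List.getD_eq_default _ _ (by simpa using hr)]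
      split_ifs <;> omega
  · simp only [if_true]
    refine Nat.pow_le_pow_left ?_ 10
    rcases L with - | L
    · omega
    · have h1 : 2 ^ L ≤ y.1 := hL L (Nat.lt_succ_self L)
      exact (Nat.lt_clog_iff_pow_lt one_lt_two).2 (by omega)
  · exact dif_pos v.2
  · have hc : 1 ≤ Nat.clog 2 (y.1 + 2) ^ 10 :=
      Nat.one_le_pow _ _ (Nat.clog_pos (by norm_num) (by omega))
    refine (cost_program_le _ 1 T σ).trans ?_
    change 100 * (1 * (y.1 + 1)) + Nat.clog 2 (y.1 + 2) ^ 10 * (1000000 * (1 * (y.1 + 1)) + 48 * T)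
      ≤ 2000000 * Nat.clog 2 (y.1 + 2) ^ 10 * (y.1 + 2 + T)
    generalize Nat.clog 2 (y.1 + 2) ^ 10 = c at *
    have h1 := Nat.mul_le_mul_right (100 * (1 * (y.1 + 1))) hc
    calc _ ≤ c * (100 * (1 * (y.1 + 1)) + (1000000 * (1 * (y.1 + 1)) + 48 * T)) := by
          rw [mul_add c (100 * (1 * (y.1 + 1)))]
          exact Nat.add_le_add_right (by omega) _
      _ ≤ c * (2000000 * (y.1 + 2 + T)) := Nat.mul_le_mul_left _ (by omega)
      _ = _ := by ring
  · refine (cost_program_le _ 0 1 σ).trans ?_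
    change 100 * (0 * (y.1 + 1)) + Nat.clog 2 (y.1 + 2) ^ 10 * (1000000 * (0 * (y.1 + 1)) + 48 * 1)
      ≤ (y.1 + 2) ^ 50
    have h1 : Nat.clog 2 (y.1 + 2) ≤ y.1 + 2 :=
      Nat.clog_le_of_le_pow (Nat.lt_two_pow_self).le
    calc _ = Nat.clog 2 (y.1 + 2) ^ 10 * 48 := by ring
      _ ≤ (y.1 + 2) ^ 10 * (y.1 + 2) ^ 6 := Nat.mul_le_mul (Nat.pow_le_pow_left h1 10)
          ((by norm_num : 48 ≤ 2 ^ 6).trans (Nat.pow_le_pow_left (by omega) 6))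
      _ = (y.1 + 2) ^ 16 := by rw [← pow_add]
      _ ≤ _ := Nat.pow_le_pow_right (by omega) (by norm_num)


/-! ### The equivalence -/

theorem mainTheorem1 (γ : ℝ) (σ : Equiv.Perm (Fin 4)) (hσ : IsNontrivialPattern σ) :
    SolvableInSoftO fourCycleProblem γ ↔ SolvableInSoftO (patternProblem σ) γ := by
  have hs := hσ.splitsEvenly
  rcases lt_or_ge γ 1 with hγ | hγ
  -- below linear time neither problem can be solved
  · exact iff_of_false (not_solvable_fourCycleProblem hγ) (not_solvable_patternProblem hγ hs.ne_one)
  · exact ⟨patternProblem_solvable_of_fourCycle hγ σ, fourCycleProblem_solvable_of_pattern hγ hs⟩
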